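/- Let $\Gamma$ be the chain of rings of circumference $2\pi$ touching at vertices $v_j$, $j\in\mathbb Z$; the upper and the lower halfcircle of the $j$-th ring, which joins $v_j$ to $v_{j+1}$, are both parametrized by $[j\pi,(j+1)\pi]$, so that $L^2(\Gamma)=L^2(\mathbb R)\oplus L^2(\mathbb R)$. For $A,\alpha\in\mathbb R$ let $-\Delta_\alpha$ be the operator in $L^2(\Gamma)$ acting as $-\mathcal D^2$ on each edge, where $\mathcal D=\frac{d}{dx}+iA$ on the upper and $\mathcal D=\frac{d}{dx}-iA$ on the lower halfcircles. Its domain consists of all functions of $L^2(\Gamma)$ whose components $\psi_j$ (upper) and $\varphi_j$ (lower) are of class $H^2$ on every edge, with $\mathcal D^2$ of the function in $L^2(\Gamma)$, and which satisfy for all $j\in\mathbb Z$ the $\delta$-coupling $$\psi_j(j\pi)=\varphi_j(j\pi)=\psi_{j-1}(j\pi)=\varphi_{j-1}(j\pi),\qquad \mathcal D\psi_j(j\pi)+\mathcal D\varphi_j(j\pi)-\mathcal D\psi_{j-1}(j\pi)-\mathcal D\varphi_{j-1}(j\pi)=\alpha\,\psi_j(j\pi).$$ Put $\xi(k)=\frac1{\cos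 A\pi}\bigl(\cos k\pi+\frac{\alpha}{4k}\sin k\pi\bigr)$ for $k\neq0$ and $\xi(0)=\frac1{\cos A\pi}\bigl(1+\frac{\alpha\pi}{4}\bigr)$. A spectral band is a connected component of the absolutely continuous spectrum of $-\Delta_\alpha$. **Theorem (non-magnetic case).** Let $A\in\mathbb Z$ and $\alpha\in\mathbb R$. Then $-\Delta_\alpha$ is self-adjoint. Its eigenvalues are exactly the numbers $k^2$, $k=1,2,\dots$, and each of them has infinite multiplicity. Its spectrum is the union of these eigenvalues and of the spectral bands, and there is no singular continuous part: the pure point and the absolutely continuous subspaces together span a dense subspace of $L^2(\Gamma)$. Moreover: 1. If $\alpha>0$, then every spectral band is contained in an interval $(n^2,(n+1)^2]$ with $n\in\{0,1,2,\dots\}$, each of these intervals contains exactly one band, and this band is a non-degenerate compact interval with upper edge $(n+1)^2$. 2. If $\alpha<0$, then each interval $[n^2,(n+1)^2)$ with $n\in\{1,2,\dots\}$ contains exactly one spectral band, and this band is a non-degenerate compact interval with lower edge $n^2$. There is exactly one further spectral band. It is an interval $[a,b]$ with $a<b$ and $a<0$, where $a$ and $b$ are the smallest and the second smallest element of the set of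 real numbers $k^2$ with $k\in\mathbb R\cup i\mathbb R$ and $|\xi(k)|=1$. If $-8/\pi<\alpha<0$, then $b\in(0,1)$; if $\alpha=-8/\pi$, then $b=0$; if $\alpha<-8/\pi$, then $b<0$. -/

import Mathlib

open MeasureTheory

noncomputable section

/-! ### Unbounded operators in a complex Hilbert space -/

section Operators

variable {E : Type*} [NormedAddCommGroup E] [InnerProductSpace ℂ E]

/-- `z` lies in the resolvent set of `T`: the map `T - z : dom T → E` is a bijection with a
bounded inverse `R`. -/
def InResolventSet (T : E →ₗ.[ℂ] E) (z : ℂ) : Prop :=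
  ∃ R : E →L[ℂ] E,
    (∀ f : E, ∃ h : R f ∈ T.domain, T ⟨R f, h⟩ - z • R f = f) ∧
    (∀ x : T.domain, R (T x - z • (x : E)) = x)

/-- The spectrum of an unbounded operator. -/
def opSpectrum (T : E →ₗ.[ℂ] E) : Set ℂ := {z | ¬ InResolventSet T z}

/-- The eigenspace `ker (T - z)`, as a subspace of the Hilbert space. -/
def opEigenspace (T : E →ₗ.[ℂ] E) (z : ℂ) : Submodule ℂ E :=
  (LinearMap.ker (T.toFun - z • T.domain.subtype)).map T.domain.subtype

/-- `μ` is the spectral measure of the vector `f` with respect to the (self-adjoint) operator `T`: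
the finite Borel measure whose Stieltjes transform is `z ↦ ⟪f, (T - z)⁻¹ f⟫` off the real axis.
(The Stieltjes transform determines a finite measure, and it is the measure
`B ↦ ⟪f, 1_B(T) f⟫` given by the spectral theorem.) -/
structure IsSpectralMeasure (T : E →ₗ.[ℂ] E) (f : E) (μ : Measure ℝ) : Prop where
  finite : IsFiniteMeasure μ
  stieltjes : ∀ z : ℂ, z.im ≠ 0 → ∃ g : T.domain,
    T g - z • (g : E) = f ∧ inner ℂ f (g : E) = ∫ x : ℝ, ((x : ℂ) - z)⁻¹ ∂μ

/-- The pure point subspace: the closed linear span of all eigenvectors. -/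
def ppSubspace (T : E →ₗ.[ℂ] E) : Submodule ℂ E :=
  (⨆ z : ℂ, opEigenspace T z).topologicalClosure

/-- The absolutely continuous subspace: the (closed linear span of the) set of vectors whose
spectral measure is absolutely continuous with respect to Lebesgue measure. For self-adjoint `T`
this set is itself a closed subspace. -/
def acSubspace (T : E →ₗ.[ℂ] E) : Submodule ℂ E :=
  (Submodule.span ℂ {f : E | ∃ μ : Measure ℝ, IsSpectralMeasure T f μ ∧ μ ≪ volume}).topologicalClosure

/-- The part of `T` in the subspace `K`: its graph is the graph of `T` intersected with `K × K`. -/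
def opPart (T : E →ₗ.[ℂ] E) (K : Submodule ℂ E) : K →ₗ.[ℂ] K :=
  (T.graph.comap (K.subtype.prodMap K.subtype)).toLinearPMap

/-- The absolutely continuous spectrum: the (real) spectrum of the part of `T` in its absolutely
continuous subspace. -/
def acSpectrum (T : E →ₗ.[ℂ] E) : Set ℝ :=
  {x | (x : ℂ) ∈ opSpectrum (opPart T (acSubspace T))}

/-- A spectral band: a connected component of the absolutely continuous spectrum. -/
def IsSpectralBand (T : E →ₗ.[ℂ] E) (B : Set ℝ) : Prop :=
  ∃ x ∈ acSpectrum T, B = connectedComponentIn (acSpectrum T) x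

end Operators

/-! ### The magnetic chain graph -/

/-- `L²(Γ)`: the ring chain is parametrized by two copies of the real line, the first for the upper
and the second for the lower halfcircles. The vertices are the points `jπ`, `j ∈ ℤ`, in which both
lines are glued together, and the halfcircles of the `j`-th ring are the intervals
`[jπ, (j+1)π]`. -/
abbrev L2Chain : Type :=
  WithLp 2 (Lp ℂ 2 (volume : Measure ℝ) × Lp ℂ 2 (volume : Measure ℝ))

/-- On `[a, b]`, the function `u` is absolutely continuous and its quasiderivative
`u' + i A u` equals `p` almost everywhere. -/
def HasQuasiDerivOn (A a b : ℝ) (u p : ℝ → ℂ) : Prop :=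
  IntervalIntegrable (fun t => p t - Complex.I * A * u t) volume a b ∧
  ∀ x ∈ Set.Icc a b, u x = u a + ∫ t in a..x, (p t - Complex.I * A * u t)

/-- On the edge `[jπ, (j+1)π]` the function `ψ` has the `H²`-representative `u` with quasiderivative
`𝒟u = p`, and `-𝒟²u = f`, where `𝒟 = d/dx + i A`. -/
structure EdgeEquation (A : ℝ) (j : ℤ) (ψ f u p : ℝ → ℂ) : Prop where
  ae_eq : ∀ᵐ x ∂(volume.restrict (Set.Icc (j * Real.pi) ((j + 1) * Real.pi))), ψ x = u x
  deriv_u : HasQuasiDerivOn A (j * Real.pi) ((j + 1) * Real.pi) u p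
  deriv_p : HasQuasiDerivOn A (j * Real.pi) ((j + 1) * Real.pi) p (fun x => -f x)

/-- The pair `(Ψ, F)` belongs to the graph of `-Δ_α`. The operator acts as `-𝒟²` on every edge, with
`𝒟 = d/dx + i A` on the upper and `𝒟 = d/dx - i A` on the lower halfcircles; `u j, v j` are the
components of `Ψ` on the upper and lower halfcircle of the `j`-th ring and `p j, q j` are their
quasiderivatives. At every vertex the `δ`-coupling of strength `α` is imposed. -/
def InHamiltonianGraph (A α : ℝ) (Ψ F : L2Chain) : Prop :=
  ∃ u p v q : ℤ → ℝ → ℂ,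
    (∀ j, EdgeEquation A j Ψ.fst F.fst (u j) (p j)) ∧
    (∀ j, EdgeEquation (-A) j Ψ.snd F.snd (v j) (q j)) ∧
    (∀ j : ℤ,
      u j (j * Real.pi) = v j (j * Real.pi) ∧
      u j (j * Real.pi) = u (j - 1) (j * Real.pi) ∧
      u j (j * Real.pi) = v (j - 1) (j * Real.pi)) ∧
    (∀ j : ℤ,
      p j (j * Real.pi) + q j (j * Real.pi)
        - p (j - 1) (j * Real.pi) - q (j - 1) (j * Real.pi) = α * u j (j * Real.pi))

/-! The graph is a linear subspace and single-valued, so that it defines an operator. -/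

lemma HasQuasiDerivOn.add {A a b : ℝ} {u p u' p' : ℝ → ℂ}
    (h : HasQuasiDerivOn A a b u p) (h' : HasQuasiDerivOn A a b u' p') :
    HasQuasiDerivOn A a b (fun x => u x + u' x) (fun x => p x + p' x) := by
  have e : (fun t => (p t + p' t) - Complex.I * A * (u t + u' t)) =
      fun t => (p t - Complex.I * A * u t) + (p' t - Complex.I * A * u' t) := by
    funext t; ring
  refine ⟨?_, fun x hx => ?_⟩
  · rw [e]; exact h.1.add h'.1
  · have hsub : Set.uIcc a x ⊆ Set.uIcc a b := by
      rw [Set.uIcc_of_le hx.1, Set.uIcc_of_le (hx.1.trans hx.2)]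
      exact Set.Icc_subset_Icc_right hx.2
    simp only [e]
    rw [intervalIntegral.integral_add (h.1.mono_set hsub) (h'.1.mono_set hsub),
      h.2 x hx, h'.2 x hx]
    ring

lemma HasQuasiDerivOn.smul {A a b : ℝ} {u p : ℝ → ℂ} (c : ℂ)
    (h : HasQuasiDerivOn A a b u p) :
    HasQuasiDerivOn A a b (fun x => c * u x) (fun x => c * p x) := by
  have e : (fun t => c * p t - Complex.I * A * (c * u t)) =
      fun t => c * (p t - Complex.I * A * u t) := by
    funext t; ring
  refine ⟨?_, fun x hx => ?_⟩
  · rw [e]; exact h.1.const_mul c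
  · simp only [e]
    rw [intervalIntegral.integral_const_mul, h.2 x hx]
    ring

lemma HasQuasiDerivOn.congr {A a b : ℝ} {u p p' : ℝ → ℂ}
    (h : HasQuasiDerivOn A a b u p) (hp : p =ᵐ[volume] p') :
    HasQuasiDerivOn A a b u p' := by
  have e : (fun t => p t - Complex.I * A * u t) =ᵐ[volume]
      fun t => p' t - Complex.I * A * u t := by
    filter_upwards [hp] with t ht
    rw [ht]
  refine ⟨h.1.congr_ae (ae_restrict_of_ae e), fun x hx => ?_⟩
  rw [h.2 x hx]
  congr 1
  exact intervalIntegral.integral_congr_ae (by filter_upwards [e] with t ht _ using ht)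

lemma HasQuasiDerivOn.ae_eq_zero {A a b : ℝ} (hab : a < b) {u p : ℝ → ℂ}
    (h : HasQuasiDerivOn A a b u p)
    (hu : ∀ᵐ x ∂(volume.restrict (Set.Icc a b)), u x = 0) :
    ∀ᵐ x ∂(volume.restrict (Set.Icc a b)), p x = 0 := by
  have hcont : ContinuousOn u (Set.Icc a b) := by
    have h1 : ContinuousOn (fun x => u a + ∫ t in a..x, (p t - Complex.I * A * u t))
        (Set.Icc a b) := by
      have := intervalIntegral.continuousOn_primitive_interval' h.1 Set.left_mem_uIcc
      rw [Set.uIcc_of_le hab.le] at this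
      exact continuousOn_const.add this
    exact h1.congr h.2
  have hu0 : Set.EqOn u (fun _ => 0) (Set.Icc a b) :=
    Measure.eqOn_Icc_of_ae_eq volume hab.ne hu hcont continuousOn_const
  have hint : ∀ x ∈ Set.Icc a b, ∫ t in a..x, (p t - Complex.I * A * u t) = 0 := by
    intro x hx
    have := h.2 x hx
    rw [hu0 hx, hu0 (Set.left_mem_Icc.2 hab.le)] at this
    simpa using this.symm
  rw [← restrict_Ioo_eq_restrict_Icc, ae_restrict_iff' measurableSet_Ioo]
  filter_upwards [h.1.ae_hasDerivAt_integral] with x hx hxI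
  have hxI' : x ∈ Set.Icc a b := Set.Ioo_subset_Icc_self hxI
  have hd := hx (by rwa [Set.uIcc_of_le hab.le]) a (by simp)
  have hd0 : HasDerivAt (fun x => ∫ t in a..x, (p t - Complex.I * A * u t)) 0 x :=
    (hasDerivAt_const x (0 : ℂ)).congr_of_eventuallyEq (by
      filter_upwards [Ioo_mem_nhds hxI.1 hxI.2] with y hy
      exact hint y (Set.Ioo_subset_Icc_self hy))
  have := hd.unique hd0
  rw [hu0 hxI'] at this
  simpa using this

lemma EdgeEquation.add {A : ℝ} {j : ℤ} {ψ ψ' f f' : Lp ℂ 2 (volume : Measure ℝ)}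
    {u p u' p' : ℝ → ℂ} (h : EdgeEquation A j ψ f u p) (h' : EdgeEquation A j ψ' f' u' p') :
    EdgeEquation A j (ψ + ψ' : Lp ℂ 2 (volume : Measure ℝ))
      (f + f' : Lp ℂ 2 (volume : Measure ℝ))
      (fun x => u x + u' x) (fun x => p x + p' x) where
  ae_eq := by
    filter_upwards [h.ae_eq, h'.ae_eq, ae_restrict_of_ae (Lp.coeFn_add ψ ψ')] with x h1 h2 h3
    rw [h3, Pi.add_apply, h1, h2]
  deriv_u := h.deriv_u.add h'.deriv_u
  deriv_p := by
    refine (h.deriv_p.add h'.deriv_p).congr ?_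
    filter_upwards [Lp.coeFn_add f f'] with x hx
    rw [hx, Pi.add_apply]
    ring

lemma EdgeEquation.smul {A : ℝ} {j : ℤ} {ψ f : Lp ℂ 2 (volume : Measure ℝ)}
    {u p : ℝ → ℂ} (c : ℂ) (h : EdgeEquation A j ψ f u p) :
    EdgeEquation A j (c • ψ : Lp ℂ 2 (volume : Measure ℝ))
      (c • f : Lp ℂ 2 (volume : Measure ℝ)) (fun x => c * u x) (fun x => c * p x) where
  ae_eq := by
    filter_upwards [h.ae_eq, ae_restrict_of_ae (Lp.coeFn_smul c ψ)] with x h1 h3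
    rw [h3, Pi.smul_apply, h1, smul_eq_mul]
  deriv_u := h.deriv_u.smul c
  deriv_p := by
    refine (h.deriv_p.smul c).congr ?_
    filter_upwards [Lp.coeFn_smul c f] with x hx
    rw [hx, Pi.smul_apply, smul_eq_mul]
    ring

lemma EdgeEquation.zero (A : ℝ) (j : ℤ) :
    EdgeEquation A j (0 : Lp ℂ 2 (volume : Measure ℝ)) (0 : Lp ℂ 2 (volume : Measure ℝ))
      (fun _ => 0) (fun _ => 0) where
  ae_eq := ae_restrict_of_ae (Lp.coeFn_zero ℂ 2 volume)
  deriv_u := by simp [HasQuasiDerivOn]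
  deriv_p := by
    refine HasQuasiDerivOn.congr (p := fun _ => 0) (by simp [HasQuasiDerivOn]) ?_
    filter_upwards [Lp.coeFn_zero ℂ 2 (volume : Measure ℝ)] with x hx
    rw [hx]; simp

/-- The graph of `-Δ_α` as a subspace. -/
def hamiltonianGraph (A α : ℝ) : Submodule ℂ (L2Chain × L2Chain) where
  carrier := {x | InHamiltonianGraph A α x.1 x.2}
  zero_mem' := by
    refine ⟨fun _ _ => 0, fun _ _ => 0, fun _ _ => 0, fun _ _ => 0,
      fun j => EdgeEquation.zero A j, fun j => EdgeEquation.zero (-A) j, ?_, ?_⟩ <;> simp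
  add_mem' := by
    rintro x y ⟨u, p, v, q, h1, h2, h3, h4⟩ ⟨u', p', v', q', h1', h2', h3', h4'⟩
    refine ⟨fun j t => u j t + u' j t, fun j t => p j t + p' j t, fun j t => v j t + v' j t,
      fun j t => q j t + q' j t, fun j => (h1 j).add (h1' j), fun j => (h2 j).add (h2' j),
      fun j => ⟨?_, ?_, ?_⟩, fun j => ?_⟩
    · linear_combination (h3 j).1 + (h3' j).1
    · linear_combination (h3 j).2.1 + (h3' j).2.1
    · linear_combination (h3 j).2.2 + (h3' j).2.2
    · linear_combination h4 j + h4' j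
  smul_mem' := by
    rintro c x ⟨u, p, v, q, h1, h2, h3, h4⟩
    refine ⟨fun j t => c * u j t, fun j t => c * p j t, fun j t => c * v j t,
      fun j t => c * q j t, fun j => (h1 j).smul c, fun j => (h2 j).smul c,
      fun j => ⟨?_, ?_, ?_⟩, fun j => ?_⟩
    · linear_combination c * (h3 j).1
    · linear_combination c * (h3 j).2.1
    · linear_combination c * (h3 j).2.2
    · linear_combination c * h4 j

lemma EdgeEquation.eq_zero {A : ℝ} {ψ f : Lp ℂ 2 (volume : Measure ℝ)} (hψ : ψ = 0)
    {u p : ℤ → ℝ → ℂ} (h : ∀ j, EdgeEquation A j ψ f (u j) (p j)) : f = 0 := by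
  have key : ∀ j : ℤ, ∀ᵐ x ∂(volume : Measure ℝ),
      x ∈ Set.Icc (j * Real.pi) ((j + 1) * Real.pi) → f x = 0 := by
    intro j
    have hlt : (j : ℝ) * Real.pi < (j + 1) * Real.pi := by nlinarith [Real.pi_pos]
    have hu : ∀ᵐ x ∂(volume.restrict (Set.Icc ((j : ℝ) * Real.pi) ((j + 1) * Real.pi))),
        u j x = 0 := by
      filter_upwards [(h j).ae_eq, ae_restrict_of_ae (Lp.coeFn_zero ℂ 2 volume)] with x h1 h2
      rw [← h1, hψ, h2]; rfl
    have := (h j).deriv_p.ae_eq_zero hlt ((h j).deriv_u.ae_eq_zero hlt hu)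
    rw [ae_restrict_iff' measurableSet_Icc] at this
    filter_upwards [this] with x hx hxI
    simpa using hx hxI
  rw [Lp.eq_zero_iff_ae_eq_zero]
  filter_upwards [ae_all_iff.2 key] with x hx
  refine hx ⌊x / Real.pi⌋ ⟨?_, ?_⟩
  · rw [← le_div_iff₀ Real.pi_pos]; exact Int.floor_le _
  · rw [← div_le_iff₀ Real.pi_pos]; exact (Int.lt_floor_add_one _).le

lemma hamiltonianGraph_single_valued (A α : ℝ) (x : L2Chain × L2Chain)
    (hx : x ∈ hamiltonianGraph A α) (hx0 : x.1 = 0) : x.2 = 0 := by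
  obtain ⟨u, p, v, q, h1, h2, -, -⟩ := hx
  have e1 : x.2.fst = 0 := EdgeEquation.eq_zero (by rw [hx0]; rfl) h1
  have e2 : x.2.snd = 0 := EdgeEquation.eq_zero (by rw [hx0]; rfl) h2
  exact (WithLp.ofLp_injective 2) (Prod.ext e1 e2)

/-- The Hamiltonian `-Δ_α` of the ring chain with magnetic potential `A` and with the same coupling
constant `α` at every vertex. -/
def hamiltonian (A α : ℝ) : L2Chain →ₗ.[ℂ] L2Chain :=
  (hamiltonianGraph A α).toLinearPMap

lemma hamiltonian_graph (A α : ℝ) : (hamiltonian A α).graph = hamiltonianGraph A α :=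
  Submodule.toLinearPMap_graph_eq _ (hamiltonianGraph_single_valued A α)

/-- The function `ξ(k) = (cos kπ + (α / 4k) sin kπ) / cos Aπ`, extended continuously to `k = 0`. -/
def xi (A α : ℝ) (k : ℂ) : ℂ :=
  if k = 0 then (1 + α * Real.pi / 4) / Complex.cos (A * Real.pi)
  else (Complex.cos (k * Real.pi) + α / (4 * k) * Complex.sin (k * Real.pi)) /
    Complex.cos (A * Real.pi)

/-- The real numbers `k²` with `|ξ(k)| = 1`; the condition `k² ∈ ℝ` means that `k` is real or purely
imaginary. -/
def bandEdgeSet (A α : ℝ) : Set ℝ := {e | ∃ k : ℂ, k ^ 2 = (e : ℂ) ∧ ‖xi A α k‖ = 1}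

end

/-! Multiplication by `exp (± i A x)` on the upper and lower halfcircles turns `𝒟` into `d/dx`. For
integer `A` the two phases agree at every vertex `jπ`, so the vertex conditions keep their form. The
sum `chainS` and the difference `chainD` of the transformed components then decouple
(`inHamiltonianGraph_iff`): the sum lives on a line with `δ`-couplings of strength `β = α/2` at all
vertices (a Kronig–Penney operator), the difference on the same line with Dirichlet conditions at
all vertices. The Dirichlet part carries the eigenvalues `n²`, with one sine function per ring and
hence infinite multiplicity.

For the Kronig–Penney part, variation of constants reduces `(T - k²) ψ = g` to a difference equation
for the vertex data, whose transfer matrix has determinant `1` and trace `2 * discr β k`. If `discr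
β k` is not in `[-1, 1]`, the equation is solvable in `ℓ²` (`KPGraph.exists_of_discr`). If it is,
square summable homogeneous data vanish, which excludes eigenvectors and gives a right-hand side
without solution (`KPGraph.not_surjective`). So the spectrum of this part is `bandSet β`, the set of
energies where the discriminant lies in `[-1, 1]`. Symmetry together with surjectivity of `T - c` at
one real `c` gives self-adjointness (`isSelfAdjoint_of_surjAt`).

Absolute continuity is obtained without an explicit spectral representation. For vectors built from
dipole data at the vertices, the form `⟪f, (T - z)⁻¹ f⟫` stays bounded as `z` approaches the real
axis, even at band edges (`exists_resolvent_bound`). The Poisson kernel then bounds the spectral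
measure of small balls by a multiple of the radius, hence by Lebesgue measure. These vectors are
total in the Kronig–Penney part (`L2R.eq_zero_of_inner_dipole`), while absolutely continuous vectors
are orthogonal to eigenvectors. Thus the absolutely continuous subspace is exactly `chainD = 0`
(`mem_acSubspace_iff`), and its spectrum is `bandSet β`.

The shape of the bands comes from half-angle factorizations of `1 ± discr`. Between consecutive
squares only one factor of `1 - discr²` can change sign, and it does so once (`exists_band_of_pos`,
`exists_band_of_neg`). Below energy `1`, for attractive coupling, there are two such factors, and
Sturm comparison gives each a single zero; these zeros are the edges of the lowest band
(`exists_lowest_band`). -/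

noncomputable section

/-! ### Symmetric operators with a surjective shift -/

section Abstract

variable {E : Type*} [NormedAddCommGroup E] [InnerProductSpace ℂ E]

/-- `T - z` maps the domain of `T` onto the whole space. -/
def SurjAt (T : E →ₗ.[ℂ] E) (z : ℂ) : Prop :=
  ∀ f : E, ∃ x : T.domain, T x - z • (x : E) = f

lemma InResolventSet.surjAt {T : E →ₗ.[ℂ] E} {z : ℂ} (h : InResolventSet T z) : SurjAt T z := by
  obtain ⟨R, h1, -⟩ := h
  intro f
  obtain ⟨h, e⟩ := h1 f
  exact ⟨⟨R f, h⟩, e⟩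

lemma InResolventSet.eq_zero {T : E →ₗ.[ℂ] E} {z : ℂ} (h : InResolventSet T z) {x : T.domain}
    (hx : T x = z • (x : E)) : (x : E) = 0 := by
  obtain ⟨R, -, h2⟩ := h
  have := h2 x
  rw [hx, sub_self, map_zero] at this
  exact this.symm

lemma shift_symm {T : E →ₗ.[ℂ] E} (hT : T.IsFormalAdjoint T) (z : ℂ) (x y : T.domain) :
    inner ℂ (T x - z • (x : E)) (y : E) =
      inner ℂ (x : E) (T y - (starRingEnd ℂ z) • (y : E)) := by
  rw [inner_sub_left, inner_sub_right, hT x y, inner_smul_left, inner_smul_right]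

/-- For real `z` the kernel of `T - z` is orthogonal to its range, which is everything. -/
lemma eq_zero_of_surjAt {T : E →ₗ.[ℂ] E} (hT : T.IsFormalAdjoint T) {z : ℝ} (h : SurjAt T z)
    {x : T.domain} (hx : T x - (z : ℂ) • (x : E) = 0) : (x : E) = 0 := by
  obtain ⟨y, hy⟩ := h x
  have := shift_symm hT z x y
  rw [hx, inner_zero_left, Complex.conj_ofReal, hy] at this
  exact inner_self_eq_zero.1 this.symm

/-- Holds because `⟪T x, x⟫` is real for a symmetric operator. -/
lemma im_mul_norm_sq_eq {T : E →ₗ.[ℂ] E} (hT : T.IsFormalAdjoint T) {z : ℂ}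
    {x : T.domain} {f : E} (hx : T x - z • (x : E) = f) :
    (inner ℂ f (x : E)).im = z.im * ‖(x : E)‖ ^ 2 := by
  have h1 : (inner ℂ (T x) (x : E)).im = 0 := by
    have h2 := hT x x
    have h3 := inner_conj_symm (𝕜 := ℂ) (T x) (x : E)
    rw [← h2] at h3
    exact Complex.conj_eq_iff_im.1 h3
  rw [← hx, inner_sub_left, inner_smul_left, Complex.sub_im, h1, inner_self_eq_norm_sq_to_K]
  simp [← Complex.ofReal_pow]

lemma eq_of_sub_smul_eq {T : E →ₗ.[ℂ] E} (hT : T.IsFormalAdjoint T) {z : ℂ} (hz : z.im ≠ 0)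
    {x y : T.domain} (h : T x - z • (x : E) = T y - z • (y : E)) : x = y := by
  have h0 : T (x - y) - z • ((x - y : T.domain) : E) = 0 := by
    rw [LinearPMap.map_sub]
    simp only [Submodule.coe_sub, smul_sub]
    rw [sub_sub_sub_comm, h, sub_self]
  have := im_mul_norm_sq_eq hT h0
  rw [inner_zero_left, Complex.zero_im] at this
  have h2 : ‖((x - y : T.domain) : E)‖ ^ 2 = 0 := by
    rcases mul_eq_zero.1 this.symm with h | h
    · exact absurd h hz
    · exact h
  have h3 := norm_eq_zero.1 (pow_eq_zero_iff (two_ne_zero)|>.1 h2)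
  exact sub_eq_zero.1 (Subtype.ext h3)

variable [CompleteSpace E]

/-- The inverse is symmetric and everywhere defined, so it is bounded by the Hellinger–Toeplitz
theorem. No estimate on the solutions of `(T - z) x = f` is needed. -/
lemma exists_selfAdjoint_resolvent {T : E →ₗ.[ℂ] E} (hT : T.IsFormalAdjoint T) {z : ℝ}
    (h : SurjAt T z) : ∃ R : E →L[ℂ] E, IsSelfAdjoint R ∧
      (∀ f : E, ∃ h : R f ∈ T.domain, T ⟨R f, h⟩ - (z : ℂ) • R f = f) ∧
      (∀ x : T.domain, R (T x - (z : ℂ) • (x : E)) = x) := by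
  choose g hg using h
  have inj : ∀ x y : T.domain, T x - (z : ℂ) • (x : E) = T y - (z : ℂ) • (y : E) → x = y := by
    intro x y hxy
    have h0 : T (x - y) - (z : ℂ) • ((x - y : T.domain) : E) = 0 := by
      rw [LinearPMap.map_sub]
      simp only [Submodule.coe_sub, smul_sub]
      rw [sub_sub_sub_comm, hxy, sub_self]
    exact sub_eq_zero.1 (Subtype.ext (eq_zero_of_surjAt hT (fun f => ⟨g f, hg f⟩) h0))
  let L : E →ₗ[ℂ] E :=
    { toFun := fun f => g f
      map_add' := fun a b => by
        rw [← Submodule.coe_add]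
        congr 1
        apply inj
        rw [hg, LinearPMap.map_add, Submodule.coe_add, smul_add, add_sub_add_comm, hg, hg]
      map_smul' := fun c a => by
        rw [RingHom.id_apply, ← Submodule.coe_smul]
        congr 1
        apply inj
        rw [hg, LinearPMap.map_smul, Submodule.coe_smul, smul_comm, ← smul_sub, hg] }
  have hsym : L.IsSymmetric := by
    intro a b
    have := shift_symm hT z (g a) (g b)
    rw [Complex.conj_ofReal, hg, hg] at this
    exact this.symm
  refine ⟨⟨L, hsym.continuous⟩, ?_, fun f => ⟨(g f).2, hg f⟩, fun x => ?_⟩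
  · rw [ContinuousLinearMap.isSelfAdjoint_iff_isSymmetric]
    exact hsym
  · change (g _ : E) = x
    congr 1
    apply inj
    rw [hg]

lemma inResolventSet_ofReal {T : E →ₗ.[ℂ] E} (hT : T.IsFormalAdjoint T) {z : ℝ}
    (h : SurjAt T z) : InResolventSet T z := by
  obtain ⟨R, -, h1, h2⟩ := exists_selfAdjoint_resolvent hT h
  exact ⟨R, h1, h2⟩

/-- If `f = (T - z) x` is orthogonal to the domain and `x = (T - z) y`, then `‖x‖² = ⟪(T - z) x, y⟫
= ⟪f, y⟫ = 0`. -/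
lemma dense_domain_of_surjAt {T : E →ₗ.[ℂ] E} (hT : T.IsFormalAdjoint T) {z : ℝ}
    (h : SurjAt T z) : Dense (T.domain : Set E) := by
  rw [Submodule.dense_iff_topologicalClosure_eq_top,
    Submodule.topologicalClosure_eq_top_iff]
  rw [Submodule.eq_bot_iff]
  intro f hf
  obtain ⟨x, hx⟩ := h f
  have hx0 : (x : E) = 0 := by
    obtain ⟨y, hy⟩ := h x
    have := shift_symm hT z x y
    rw [Complex.conj_ofReal, hy, hx, (Submodule.mem_orthogonal' _ _).1 hf y y.2] at this
    exact inner_self_eq_zero.1 this.symm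
  have hx1 : x = 0 := Subtype.ext hx0
  rw [← hx, hx1]
  simp

/-- For `y` in the domain of the adjoint choose `x` in the domain of `T` with `(T - z) x = (T* - z)
y`. Then `y - x` is orthogonal to the range of `T - z`, hence zero. -/
theorem isSelfAdjoint_of_surjAt {T : E →ₗ.[ℂ] E} (hT : T.IsFormalAdjoint T) {z : ℝ}
    (h : SurjAt T z) : IsSelfAdjoint T := by
  have hd := dense_domain_of_surjAt hT h
  rw [LinearPMap.isSelfAdjoint_def]
  have hle : T ≤ T.adjoint := hT.le_adjoint hd
  refine (LinearPMap.eq_of_le_of_domain_eq hle (le_antisymm hle.1 ?_)).symm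
  intro y hy
  obtain ⟨x, hx⟩ := h (T.adjoint ⟨y, hy⟩ - (z : ℂ) • y)
  have hA := LinearPMap.adjoint_isFormalAdjoint hd
  obtain ⟨w, hw⟩ := h (y - x)
  have h1 : inner ℂ (T.adjoint ⟨y, hy⟩) (w : E) = inner ℂ y (T w) := hA ⟨y, hy⟩ w
  have h2 := hT x w
  have h3 : inner ℂ (y - x) (y - x) = (0 : ℂ) := by
    nth_rewrite 2 [← hw]
    have h4 : inner ℂ (T x) (w : E) - z * inner ℂ (x : E) (w : E) =
        inner ℂ (T.adjoint ⟨y, hy⟩) (w : E) - z * inner ℂ y (w : E) := by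
      have := congrArg (fun v => inner ℂ v (w : E)) hx
      simpa only [inner_sub_left, inner_smul_left, Complex.conj_ofReal] using this
    rw [inner_sub_left, inner_sub_right, inner_sub_right, inner_smul_right, inner_smul_right,
      ← h1, ← h2]
    linear_combination -h4
  have h5 := sub_eq_zero.1 (inner_self_eq_zero.1 h3)
  rw [h5]
  exact x.2

end Abstract
end

noncomputable section

/-! ### Spectral measures from the functional calculus of a bounded resolvent -/

section SpectralMeasure

variable {E : Type*} [NormedAddCommGroup E] [InnerProductSpace ℂ E] [CompleteSpace E]

/-- The spectral measure of a bounded self-adjoint operator. -/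
lemma exists_measure_cfcHom {R : E →L[ℂ] E} (hR : IsSelfAdjoint R) (f : E) :
    ∃ ν : Measure (spectrum ℝ R), IsFiniteMeasure ν ∧
      ∀ φ : C(spectrum ℝ R, ℝ), inner ℂ f (cfcHom hR φ f) = ((∫ t, φ t ∂ν : ℝ) : ℂ) := by
  let L : CompactlySupportedContinuousMap (spectrum ℝ R) ℝ →ₗ[ℝ] ℝ :=
    { toFun := fun φ => (inner ℂ f (cfcHom hR φ.toContinuousMap f)).re
      map_add' := fun φ ψ => by
        have : (φ + ψ).toContinuousMap = φ.toContinuousMap + ψ.toContinuousMap := rfl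
        rw [this, map_add, _root_.add_apply, inner_add_right, Complex.add_re]
      map_smul' := fun c φ => by
        have : (c • φ).toContinuousMap = c • φ.toContinuousMap := rfl
        rw [this, map_smul, _root_.smul_apply, RingHom.id_apply,
          inner_smul_right_eq_smul]
        simp }
  let Λ : CompactlySupportedContinuousMap (spectrum ℝ R) ℝ →ₚ[ℝ] ℝ :=
    PositiveLinearMap.mk₀ L (fun φ hφ => by
      have h1 : (0 : C(spectrum ℝ R, ℝ)) ≤ φ.toContinuousMap := fun t => hφ t
      have h2 := cfcHom_mono hR h1
      rw [map_zero, ContinuousLinearMap.nonneg_iff_isPositive] at h2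
      exact h2.re_inner_nonneg_right f)
  refine ⟨RealRMK.rieszMeasure Λ, inferInstance, fun φ => ?_⟩
  have h1 := RealRMK.integral_rieszMeasure Λ (CompactlySupportedContinuousMap.continuousMapEquiv φ)
  have h2 : (∫ t, φ t ∂(RealRMK.rieszMeasure Λ)) = (inner ℂ f (cfcHom hR φ f)).re := h1
  rw [h2]
  refine (Complex.conj_eq_iff_re.1 ?_).symm
  rw [inner_conj_symm]
  have h3 : IsSelfAdjoint (cfcHom hR φ) := cfcHom_predicate hR φ
  exact (ContinuousLinearMap.isSelfAdjoint_iff_isSymmetric.1 h3) f f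

/-- For `R = (T - c)⁻¹` and `ω = z - c` the operator `B = R (1 - ω R)⁻¹` is `(T - z)⁻¹`. Since the
functional calculus used is the real one, `t / (1 - ω t)` is split into its real part `φ₁` and
imaginary part `φ₂`, with common denominator `|1 - ω t|² = (1 - a t)² + (b t)²`. -/
lemma exists_cfcHom_resolvent {R : E →L[ℂ] E} (hR : IsSelfAdjoint R) {ω : ℂ} (hω : ω.im ≠ 0) :
    ∃ φ₁ φ₂ : C(spectrum ℝ R, ℝ), ∃ B : E →L[ℂ] E,
      (∀ f, B f = cfcHom hR φ₁ f + Complex.I • cfcHom hR φ₂ f) ∧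
      (∀ t : spectrum ℝ R, (φ₁ t : ℂ) + Complex.I * φ₂ t = t / (1 - ω * t)) ∧
      (∀ f, B f = R (f + ω • B f)) ∧ (∀ f, B (f - ω • R f) = R f) := by
  set a := ω.re
  set b := ω.im
  have hq : ∀ t : ℝ, (1 - a * t) ^ 2 + (b * t) ^ 2 ≠ 0 := by
    intro t h
    have h1 : b * t = 0 := by nlinarith [sq_nonneg (1 - a * t), sq_nonneg (b * t)]
    have h2 : t = 0 := (mul_eq_zero.1 h1).resolve_left hω
    rw [h2] at h
    norm_num at h
  let τ : C(spectrum ℝ R, ℝ) := (ContinuousMap.id ℝ).restrict (spectrum ℝ R)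
  let φ₁ : C(spectrum ℝ R, ℝ) := ⟨fun t => t * (1 - a * t) / ((1 - a * t) ^ 2 + (b * t) ^ 2), by
    refine Continuous.div ?_ ?_ (fun t => hq t) <;> fun_prop⟩
  let φ₂ : C(spectrum ℝ R, ℝ) := ⟨fun t => b * t ^ 2 / ((1 - a * t) ^ 2 + (b * t) ^ 2), by
    refine Continuous.div ?_ ?_ (fun t => hq t) <;> fun_prop⟩
  have e1 : φ₁ - a • (τ * φ₁) + b • (τ * φ₂) = τ := by
    ext t
    simp only [ContinuousMap.add_apply, ContinuousMap.sub_apply, ContinuousMap.smul_apply,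
      ContinuousMap.mul_apply, φ₁, φ₂, τ, ContinuousMap.coe_mk, ContinuousMap.restrict_apply,
      ContinuousMap.id_apply, smul_eq_mul]
    have h := div_self (hq t)
    linear_combination (t : ℝ) * h
  have e2 : φ₂ - a • (τ * φ₂) - b • (τ * φ₁) = 0 := by
    ext t
    simp only [ContinuousMap.zero_apply, ContinuousMap.sub_apply, ContinuousMap.smul_apply,
      ContinuousMap.mul_apply, φ₁, φ₂, τ, ContinuousMap.coe_mk, ContinuousMap.restrict_apply,
      ContinuousMap.id_apply, smul_eq_mul]
    have := hq t
    field_simp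
    ring
  have hτ : cfcHom hR τ = R := cfcHom_id hR
  set X := cfcHom hR φ₁ with hX
  set Y := cfcHom hR φ₂ with hY
  have E1 : X - a • (R * X) + b • (R * Y) = R := by
    have := congrArg (cfcHom hR) e1
    simpa only [map_add, map_sub, map_smul, map_mul, hτ] using this
  have E2 : Y - a • (R * Y) - b • (R * X) = 0 := by
    have := congrArg (cfcHom hR) e2
    simpa only [map_add, map_sub, map_smul, map_mul, hτ, map_zero] using this
  have cX : R * X = X * R := by
    rw [← hτ, hX, ← map_mul, ← map_mul, mul_comm]
  have cY : R * Y = Y * R := by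
    rw [← hτ, hY, ← map_mul, ← map_mul, mul_comm]
  have key : ∀ f, X f + Complex.I • Y f - ω • (R (X f) + Complex.I • R (Y f)) = R f := by
    intro f
    have h1 := congrArg (fun A : E →L[ℂ] E => A f) E1
    have h2 := congrArg (fun A : E →L[ℂ] E => A f) E2
    simp only [_root_.add_apply, _root_.sub_apply,
      _root_.smul_apply, mul_apply_eq_comp,
      _root_.zero_apply, ← Complex.coe_smul] at h1 h2
    have hω' : ω = a + b * Complex.I := (Complex.re_add_im ω).symm
    have h3 : ω • (R (X f) + Complex.I • R (Y f)) = (a : ℂ) • R (X f) - (b : ℂ) • R (Y f) +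
        Complex.I • ((a : ℂ) • R (Y f) + (b : ℂ) • R (X f)) := by
      have h4 : ω * Complex.I = Complex.I * a - b := by
        rw [hω']
        linear_combination (b : ℂ) * Complex.I_mul_I
      rw [smul_add, smul_smul, h4, hω']
      module
    have h5 : X f = R f + (a : ℂ) • R (X f) - (b : ℂ) • R (Y f) := by
      rw [← h1]; module
    have h6 : Y f = (a : ℂ) • R (Y f) + (b : ℂ) • R (X f) := by
      rw [← sub_eq_zero, ← h2]; module
    rw [h3, ← h6]
    nth_rewrite 1 [h5]
    module
  refine ⟨φ₁, φ₂, X + Complex.I • Y, fun f => rfl, fun t => ?_, fun f => ?_, fun f => ?_⟩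
  · have hne : 1 - ω * (t : ℂ) ≠ 0 := by
      intro h
      have h1 := congrArg Complex.re h
      have h2 := congrArg Complex.im h
      simp at h1 h2
      exact hq t (by rw [show b * (t : ℝ) = 0 from mul_eq_zero.2 h2, show 1 - a * (t : ℝ) = 0 from h1]; norm_num)
    have hq' : ((1 - a * t) ^ 2 + (b * t) ^ 2 : ℂ) ≠ 0 := by exact_mod_cast hq t
    simp only [φ₁, φ₂, ContinuousMap.coe_mk]
    push_cast
    rw [eq_div_iff hne]
    have hω' : ω = a + b * Complex.I := (Complex.re_add_im ω).symm
    rw [hω']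
    have h := div_self hq'
    linear_combination (t : ℂ) * h - (b : ℂ) ^ 2 * t ^ 3 / ((1 - a * t) ^ 2 + (b * t) ^ 2) * Complex.I_mul_I
  · have := key f
    change X f + Complex.I • Y f = R (f + ω • (X f + Complex.I • Y f))
    rw [map_add, map_smul, map_add, map_smul, ← this]
    abel
  · change X (f - ω • R f) + Complex.I • Y (f - ω • R f) = R f
    have h1 : ∀ g, R (X g) = X (R g) := fun g => congrArg (fun A : E →L[ℂ] E => A g) cX
    have h2 : ∀ g, R (Y g) = Y (R g) := fun g => congrArg (fun A : E →L[ℂ] E => A g) cY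
    refine Eq.trans ?_ (key f)
    rw [h1, h2, map_sub, map_sub, map_smul, map_smul]
    module

variable {T : E →ₗ.[ℂ] E}

lemma inResolventSet_of_im_ne_zero (hT : T.IsFormalAdjoint T) {c : ℝ} (h : SurjAt T c) {z : ℂ}
    (hz : z.im ≠ 0) : InResolventSet T z := by
  obtain ⟨R, hR, h1, h2⟩ := exists_selfAdjoint_resolvent hT h
  obtain ⟨φ₁, φ₂, B, -, -, h3, h4⟩ := exists_cfcHom_resolvent hR (ω := z - c) (by simpa using hz)
  refine ⟨B, fun f => ?_, fun x => ?_⟩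
  · obtain ⟨hd, e⟩ := h1 (f + (z - c) • B f)
    simp only [← h3 f] at hd e
    refine ⟨hd, ?_⟩
    calc T ⟨B f, hd⟩ - z • B f = (T ⟨B f, hd⟩ - (c : ℂ) • B f) - (z - c) • B f := by module
      _ = f := by rw [e, add_sub_cancel_right]
  · have := h4 (T x - (c : ℂ) • (x : E))
    rw [h2 x] at this
    refine Eq.trans ?_ this
    congr 1
    module

/-- Every vector has a spectral measure. -/
theorem exists_isSpectralMeasure (hT : T.IsFormalAdjoint T) {c : ℝ} (h : SurjAt T c) (f : E) :
    ∃ μ : Measure ℝ, IsSpectralMeasure T f μ := by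
  obtain ⟨R, hR, h1, h2⟩ := exists_selfAdjoint_resolvent hT h
  obtain ⟨ν, hν, hν'⟩ := exists_measure_cfcHom hR f
  have hm : Measurable (fun t : spectrum ℝ R => (t : ℝ)⁻¹ + c) := by fun_prop
  have hs : MeasurableSet {t : spectrum ℝ R | (t : ℝ) ≠ 0} :=
    (measurableSet_singleton (0 : ℝ)).compl.preimage measurable_subtype_coe
  -- The spectral variable `t` of `R = (T - c)⁻¹` corresponds to `x = 1/t + c`. The point `t = 0`
  -- corresponds to no finite `x` and has to be removed, because `0⁻¹ = 0` would send it to `c`.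
  -- Nothing is lost, since `t / (1 - ω t)` vanishes there.
  refine ⟨(ν.restrict {t | (t : ℝ) ≠ 0}).map (fun t : spectrum ℝ R => (t : ℝ)⁻¹ + c), inferInstance,
    fun z hz => ?_⟩
  obtain ⟨φ₁, φ₂, B, hB, hφ, h3, h4⟩ :=
    exists_cfcHom_resolvent hR (ω := z - c) (by simpa using hz)
  obtain ⟨hd, e⟩ := h1 (f + (z - c) • B f)
  simp only [← h3 f] at hd e
  refine ⟨⟨B f, hd⟩, ?_, ?_⟩
  · calc T ⟨B f, hd⟩ - z • B f = (T ⟨B f, hd⟩ - (c : ℂ) • B f) - (z - c) • B f := by module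
      _ = f := by rw [e, add_sub_cancel_right]
  · have hmeas : Measurable (fun x : ℝ => ((x : ℂ) - z)⁻¹) := by fun_prop
    rw [integral_map hm.aemeasurable hmeas.aestronglyMeasurable]
    have h5 : ∀ t : spectrum ℝ R, (t : ℝ) ≠ 0 →
        (((((t : ℝ)⁻¹ + c : ℝ) : ℂ) - z)⁻¹ : ℂ) = (φ₁ t : ℂ) + Complex.I * φ₂ t := by
      intro t ht
      have ht' : ((t : ℝ) : ℂ) ≠ 0 := by exact_mod_cast ht
      rw [hφ, inv_eq_one_div]
      push_cast
      have : ((t : ℝ) : ℂ)⁻¹ + c - z = (1 - (z - c) * (t : ℝ)) / (t : ℝ) := by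
        field_simp
        ring
      rw [this, one_div_div]
    rw [setIntegral_congr_fun hs (fun t ht => h5 t ht)]
    rw [setIntegral_eq_integral_of_forall_compl_eq_zero]
    · rw [integral_add, integral_const_mul, integral_complex_ofReal, integral_complex_ofReal,
        ← hν', ← hν', ← inner_smul_right,
        ← inner_add_right, ← hB]
      · exact Integrable.ofReal (φ₁.continuous.integrable_of_hasCompactSupport
          (HasCompactSupport.of_compactSpace _))
      · exact (Integrable.ofReal (φ₂.continuous.integrable_of_hasCompactSupport
          (HasCompactSupport.of_compactSpace _))).const_mul _
    · intro t ht
      have ht' : (t : ℝ) = 0 := by simpa using ht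
      rw [hφ, ht']; simp

end SpectralMeasure
end

noncomputable section

/-! ### Absolute continuity from bounded Stieltjes transforms -/

section AbsoluteContinuity

lemma stieltjes_im (μ : Measure ℝ) [IsFiniteMeasure μ] (x : ℝ) {ε : ℝ} (hε : 0 < ε) :
    Integrable (fun y : ℝ => ε / ((y - x) ^ 2 + ε ^ 2)) μ ∧
    (∫ y : ℝ, ((y : ℂ) - (x + ε * Complex.I))⁻¹ ∂μ).im = ∫ y, ε / ((y - x) ^ 2 + ε ^ 2) ∂μ := by
  have hnz : ∀ y : ℝ, (y : ℂ) - (x + ε * Complex.I) ≠ 0 := by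
    intro y h
    have := congrArg Complex.im h
    simp at this
    exact hε.ne' this
  have hb : ∀ y : ℝ, ‖((y : ℂ) - (x + ε * Complex.I))⁻¹‖ ≤ ε⁻¹ := by
    intro y
    rw [norm_inv]
    apply inv_anti₀ hε
    have h1 := Complex.abs_im_le_norm ((y : ℂ) - (x + ε * Complex.I))
    simp at h1
    rwa [abs_of_pos hε] at h1
  have hi : Integrable (fun y : ℝ => ((y : ℂ) - (x + ε * Complex.I))⁻¹) μ := by
    have hmeas : Measurable (fun y : ℝ => ((y : ℂ) - (x + ε * Complex.I))⁻¹) := by fun_prop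
    exact Integrable.of_bound hmeas.aestronglyMeasurable ε⁻¹ (Filter.Eventually.of_forall hb)
  have he : ∀ y : ℝ, (((y : ℂ) - (x + ε * Complex.I))⁻¹).im = ε / ((y - x) ^ 2 + ε ^ 2) := by
    intro y
    rw [Complex.inv_im, Complex.normSq_apply]
    simp
    ring
  have h1 := hi.im
  simp only [RCLike.im_to_complex, he] at h1
  refine ⟨h1, ?_⟩
  have h2 := integral_im hi
  simp only [RCLike.im_to_complex, he] at h2
  exact h2.symm

/-- On the ball of radius `ε` the Poisson kernel `ε / ((y - x)² + ε²)` is at least `1 / (2ε)`. -/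
lemma measureReal_closedBall_le (μ : Measure ℝ) [IsFiniteMeasure μ] (x : ℝ) {ε : ℝ} (hε : 0 < ε) :
    μ.real (Metric.closedBall x ε) ≤
      2 * ε * ‖∫ y : ℝ, ((y : ℂ) - (x + ε * Complex.I))⁻¹ ∂μ‖ := by
  obtain ⟨h1, h2⟩ := stieltjes_im μ x hε
  have h3 : μ.real (Metric.closedBall x ε) * (1 / (2 * ε)) ≤ ∫ y, ε / ((y - x) ^ 2 + ε ^ 2) ∂μ := by
    rw [← smul_eq_mul, ← setIntegral_const]
    refine le_trans (setIntegral_mono_on ?_ h1.integrableOn Metric.isClosed_closedBall.measurableSet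
      (fun y hy => ?_)) (setIntegral_le_integral h1 (Filter.Eventually.of_forall fun y => ?_))
    · exact integrable_const _
    · rw [Metric.mem_closedBall, Real.dist_eq] at hy
      rw [div_le_div_iff₀ (by positivity) (by positivity)]
      have := sq_le_sq' (by linarith [neg_abs_le (y - x)]) ((le_abs_self (y - x)).trans hy)
      nlinarith
    · simp only [Pi.zero_apply]; positivity
  have h4 := (le_abs_self _).trans
    (Complex.abs_im_le_norm (∫ y : ℝ, ((y : ℂ) - (x + ε * Complex.I))⁻¹ ∂μ))
  rw [h2] at h4
  have h5 := h3.trans h4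
  rw [mul_one_div, div_le_iff₀ (by positivity)] at h5
  linarith

/-- A set of diameter `r < δ` that meets the window lies in balls of radius slightly above `r`
around one of its points, so its mass is at most `C r`. Hence `μ / C` on the window is dominated by
the one-dimensional Hausdorff measure, which is Lebesgue measure on the line. -/
lemma absolutelyContinuous_of_closedBall_le {μ : Measure ℝ} [IsFiniteMeasure μ]
    (h : ∀ K : ℕ, ∃ C δ : ℝ, 0 < C ∧ 0 < δ ∧ ∀ x ∈ Set.Icc (-(K : ℝ)) K, ∀ ε, 0 < ε → ε < δ →
      μ.real (Metric.closedBall x ε) ≤ C * ε) : μ ≪ volume := by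
  have key : ∀ K : ℕ, μ.restrict (Set.Icc (-(K : ℝ)) K) ≪ volume := by
    intro K
    obtain ⟨C, δ, hC, hδ, hx⟩ := h K
    have hle : (ENNReal.ofReal C)⁻¹ • μ.restrict (Set.Icc (-(K : ℝ)) K) ≤ Measure.hausdorffMeasure 1 := by
      refine Measure.le_hausdorffMeasure 1 _ (ENNReal.ofReal (δ / 2)) (by simpa using hδ) ?_
      intro s hs
      rw [ENNReal.rpow_one, Measure.smul_apply, smul_eq_mul, mul_comm, ← div_eq_mul_inv]
      refine ENNReal.div_le_of_le_mul ?_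
      rcases (s ∩ Set.Icc (-(K : ℝ)) K).eq_empty_or_nonempty with h0 | ⟨x, hxs, hxK⟩
      · refine le_trans ?_ zero_le
        rw [Measure.restrict_apply' measurableSet_Icc, h0, measure_empty]
      · have hfin : Metric.ediam s ≠ ⊤ := ne_top_of_le_ne_top ENNReal.ofReal_ne_top hs
        set r := (Metric.ediam s).toReal with hr
        have hr' : Metric.ediam s = ENNReal.ofReal r := (ENNReal.ofReal_toReal hfin).symm
        have hrδ : r < δ := by
          have := ENNReal.toReal_mono ENNReal.ofReal_ne_top hs
          rw [ENNReal.toReal_ofReal (by positivity)] at this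
          linarith
        have hr0 : 0 ≤ r := ENNReal.toReal_nonneg
        have hb : ∀ ε, r < ε → ε < δ → μ.real s ≤ C * ε := by
          intro ε h1 h2
          refine le_trans (measureReal_mono ?_) (hx x hxK ε (hr0.trans_lt h1) h2)
          intro y hy
          rw [Metric.mem_closedBall, dist_comm, ← ENNReal.ofReal_le_ofReal_iff (hr0.trans h1.le), ← edist_dist]
          exact (Metric.edist_le_ediam_of_mem hxs hy).trans
            (hr' ▸ ENNReal.ofReal_le_ofReal h1.le)
        have hb' : μ.real s ≤ C * r := by
          refine le_of_forall_gt_imp_ge_of_dense ?_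
          intro a ha
          have h1 : r < a / C := by rwa [lt_div_iff₀ hC, mul_comm]
          obtain ⟨ε, h2, h3⟩ := exists_between (lt_min h1 hrδ)
          refine (hb ε h2 (h3.trans_le (min_le_right _ _))).trans ?_
          have := (h3.trans_le (min_le_left _ _)).le
          rwa [le_div_iff₀ hC, mul_comm] at this
        refine (Measure.restrict_apply_le _ _).trans ?_
        rw [hr', ← ENNReal.ofReal_mul hr0, mul_comm]
        rw [← ENNReal.ofReal_toReal (measure_ne_top μ s)]
        exact ENNReal.ofReal_le_ofReal hb'
    rw [hausdorffMeasure_real] at hle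
    have h2 := Measure.absolutelyContinuous_of_le hle
    refine Measure.AbsolutelyContinuous.trans ?_ h2
    exact Measure.absolutelyContinuous_smul (by simp)
  intro s hs
  have h1 : s ⊆ ⋃ K : ℕ, s ∩ Set.Icc (-(K : ℝ)) K := by
    intro x hx
    obtain ⟨K, hK⟩ := exists_nat_ge |x|
    exact Set.mem_iUnion.2 ⟨K, hx, abs_le.1 hK⟩
  refine measure_mono_null h1 (measure_iUnion_null fun K => ?_)
  rw [← Measure.restrict_apply' measurableSet_Icc]
  exact key K hs

/-- A vector with locally bounded boundary values of the resolvent form has an absolutely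
continuous spectral measure. -/
lemma absolutelyContinuous_of_stieltjes_bounded {μ : Measure ℝ} [IsFiniteMeasure μ]
    (h : ∀ K : ℕ, ∃ C δ : ℝ, 0 < δ ∧ ∀ x ∈ Set.Icc (-(K : ℝ)) K, ∀ ε, 0 < ε → ε < δ →
      ‖∫ y : ℝ, ((y : ℂ) - (x + ε * Complex.I))⁻¹ ∂μ‖ ≤ C) : μ ≪ volume := by
  refine absolutelyContinuous_of_closedBall_le fun K => ?_
  obtain ⟨C, δ, hδ, hx⟩ := h K
  refine ⟨2 * (|C| + 1), δ, by positivity, hδ, fun x hxK ε h1 h2 => ?_⟩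
  refine (measureReal_closedBall_le μ x h1).trans ?_
  have := (hx x hxK ε h1 h2).trans (le_abs_self C)
  nlinarith

variable {E : Type*} [NormedAddCommGroup E] [InnerProductSpace ℂ E]

/-- With `g = (T - l - iε)⁻¹ f` one has `⟪e, f⟫ = -iε ⟪e, g⟫`, and `ε² ‖g‖²` is the integral of `ε²
/ ((y - l)² + ε²)`. By dominated convergence this tends to `μ {l}`, which is zero for an absolutely
continuous measure. -/
lemma inner_eigenvector_eq_zero {T : E →ₗ.[ℂ] E} (hT : T.IsFormalAdjoint T) {f : E} {μ : Measure ℝ}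
    (hμ : IsSpectralMeasure T f μ) (hac : μ ≪ volume) {l : ℝ} {e : T.domain}
    (he : T e = (l : ℂ) • (e : E)) : inner ℂ (e : E) f = 0 := by
  have := hμ.finite
  have key : ∀ n : ℕ, ‖inner ℂ (e : E) f‖ ^ 2 ≤
      ‖(e : E)‖ ^ 2 * ∫ y, (1 / ((n : ℝ) + 1)) ^ 2 / ((y - l) ^ 2 + (1 / ((n : ℝ) + 1)) ^ 2) ∂μ := by
    intro n
    set ε : ℝ := 1 / ((n : ℝ) + 1) with hεd
    have hε : 0 < ε := by positivity
    obtain ⟨g, hg, hm⟩ := hμ.stieltjes (l + ε * Complex.I) (by simpa using hε.ne')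
    have h1 := im_mul_norm_sq_eq hT hg
    rw [hm, (stieltjes_im μ l hε).2] at h1
    have h1' : ∫ y, ε / ((y - l) ^ 2 + ε ^ 2) ∂μ = ε * ‖(g : E)‖ ^ 2 := by simpa using h1
    have h2 : inner ℂ (e : E) f = -(ε * Complex.I) * inner ℂ (e : E) (g : E) := by
      rw [← hg, inner_sub_right, ← hT e g, he, inner_smul_left, inner_smul_right, Complex.conj_ofReal]
      ring
    have h3 : ‖inner ℂ (e : E) f‖ ≤ ε * (‖(e : E)‖ * ‖(g : E)‖) := by
      rw [h2, norm_mul, norm_neg, norm_mul, Complex.norm_I, mul_one, Complex.norm_real,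
        Real.norm_of_nonneg hε.le]
      exact mul_le_mul_of_nonneg_left (norm_inner_le_norm _ _) hε.le
    calc ‖inner ℂ (e : E) f‖ ^ 2 ≤ (ε * (‖(e : E)‖ * ‖(g : E)‖)) ^ 2 := by gcongr
      _ = ‖(e : E)‖ ^ 2 * (ε * (ε * ‖(g : E)‖ ^ 2)) := by ring
      _ = _ := by
        rw [← h1', ← integral_const_mul]
        congr 2
        ext y
        ring
  have hlim : Filter.Tendsto (fun n : ℕ => ∫ y, (1 / ((n : ℝ) + 1)) ^ 2 /
      ((y - l) ^ 2 + (1 / ((n : ℝ) + 1)) ^ 2) ∂μ) Filter.atTop (nhds (∫ _, (0 : ℝ) ∂μ)) := by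
    refine tendsto_integral_of_dominated_convergence (fun _ => (1 : ℝ)) (fun n => ?_)
      (integrable_const _) (fun n => Filter.Eventually.of_forall fun y => ?_) ?_
    · exact Measurable.aestronglyMeasurable (by fun_prop)
    · rw [Real.norm_of_nonneg (by positivity), div_le_one (by positivity)]
      nlinarith [sq_nonneg (y - l)]
    · have hne : ∀ᵐ y ∂μ, y ≠ l := by
        rw [ae_iff]
        simpa using hac (by simp : volume ({l} : Set ℝ) = 0)
      filter_upwards [hne] with y hy
      have h0 := tendsto_one_div_add_atTop_nhds_zero_nat (𝕜 := ℝ)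
      have h1 := (h0.pow 2).div ((h0.pow 2).const_add ((y - l) ^ 2))
        (by have := sub_ne_zero.2 hy; positivity)
      simpa [Pi.div_def] using h1
  rw [integral_zero] at hlim
  have h0 := ge_of_tendsto' (hlim.const_mul (‖(e : E)‖ ^ 2)) key
  rw [mul_zero] at h0
  have h1 : ‖inner ℂ (e : E) f‖ = 0 := by nlinarith [norm_nonneg (inner ℂ (e : E) f)]
  exact norm_eq_zero.1 h1

end AbsoluteContinuity
end

noncomputable section

/-! ### Absolutely continuous functions on an interval -/

/-- On `[a, b]`, the function `u` is a primitive of the integrable function `p`. -/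
def IsPrim (a b : ℝ) (u p : ℝ → ℂ) : Prop :=
  IntervalIntegrable p volume a b ∧ ∀ x ∈ Set.Icc a b, u x = u a + ∫ t in a..x, p t

/-- Reduced to real integrands by splitting `p` into its real and imaginary parts. -/
lemma absolutelyContinuousOnInterval_primitive {a b : ℝ} {p : ℝ → ℂ}
    (hp : IntervalIntegrable p volume a b) (c : ℂ) :
    AbsolutelyContinuousOnInterval (fun x => c + ∫ t in a..x, p t) a b := by
  have hre : IntervalIntegrable (fun t => (p t).re) volume a b := ⟨hp.1.re, hp.2.re⟩
  have him : IntervalIntegrable (fun t => (p t).im) volume a b := ⟨hp.1.im, hp.2.im⟩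
  have hconst : ∀ c : ℂ, AbsolutelyContinuousOnInterval (fun _ : ℝ => c) a b := fun c =>
    ((LipschitzWith.const c).lipschitzOnWith (s := Set.uIcc a b)).absolutelyContinuousOnInterval
  have h1 := (hre.absolutelyContinuousOnInterval_intervalIntegral
    (Set.left_mem_uIcc (a := a) (b := b))).fun_smul (hconst 1)
  have h2 := (him.absolutelyContinuousOnInterval_intervalIntegral
    (Set.left_mem_uIcc (a := a) (b := b))).fun_smul (hconst Complex.I)
  have h3 := (hconst c).fun_add (h1.fun_add h2)
  unfold AbsolutelyContinuousOnInterval at h3 ⊢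
  refine h3.congr' ?_
  have hmem : ∀ᶠ E in AbsolutelyContinuousOnInterval.totalLengthFilter ⊓
      Filter.principal (AbsolutelyContinuousOnInterval.disjWithin a b),
      E ∈ AbsolutelyContinuousOnInterval.disjWithin a b :=
    Filter.mem_inf_of_right (Filter.mem_principal_self _)
  have key : ∀ x ∈ Set.uIcc a b, c + ((∫ t in a..x, (p t).re) • (1 : ℂ) +
      (∫ t in a..x, (p t).im) • Complex.I) = c + ∫ t in a..x, p t := by
    intro x hx
    have hpx : IntervalIntegrable p volume a x := hp.mono_set (Set.uIcc_subset_uIcc_left hx)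
    have e : ∀ t, p t = ((p t).re : ℂ) + ((p t).im : ℂ) * Complex.I := fun t =>
      (Complex.re_add_im _).symm
    have hrex : IntervalIntegrable (fun t => ((p t).re : ℂ)) volume a x :=
      ⟨hpx.1.re.ofReal, hpx.2.re.ofReal⟩
    have himx : IntervalIntegrable (fun t => ((p t).im : ℂ)) volume a x :=
      ⟨hpx.1.im.ofReal, hpx.2.im.ofReal⟩
    rw [intervalIntegral.integral_congr (g := fun t => ((p t).re : ℂ) + ((p t).im : ℂ) * Complex.I)
      (fun t _ => e t), intervalIntegral.integral_add hrex (himx.mul_const _),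
      intervalIntegral.integral_mul_const, intervalIntegral.integral_ofReal,
      intervalIntegral.integral_ofReal]
    simp
  filter_upwards [hmem] with E hE
  refine Finset.sum_congr rfl fun i hi => ?_
  have := hE.1 i hi
  rw [key _ this.1, key _ this.2]

namespace IsPrim

variable {a b : ℝ} {u p v q : ℝ → ℂ}

lemma continuousOn (hab : a ≤ b) (h : IsPrim a b u p) : ContinuousOn u (Set.Icc a b) := by
  have h1 : ContinuousOn (fun x => u a + ∫ t in a..x, p t) (Set.Icc a b) := by
    have := intervalIntegral.continuousOn_primitive_interval' h.1 Set.left_mem_uIcc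
    rw [Set.uIcc_of_le hab] at this
    exact continuousOn_const.add this
  exact h1.congr h.2

lemma congr (h : IsPrim a b u p) {u' p' : ℝ → ℂ} (hab : a ≤ b) (hu : ∀ x ∈ Set.Icc a b, u x = u' x)
    (hp : ∀ᵐ x, x ∈ Set.Icc a b → p x = p' x) : IsPrim a b u' p' := by
  refine ⟨h.1.congr_ae ?_, fun x hx => ?_⟩
  · rw [Set.uIoc_of_le hab]
    refine (ae_restrict_iff' measurableSet_Ioc).2 ?_
    filter_upwards [hp] with x hx hx' using hx (Set.Ioc_subset_Icc_self hx')
  · rw [← hu x hx, ← hu a (Set.left_mem_Icc.2 hab), h.2 x hx]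
    congr 1
    refine intervalIntegral.integral_congr_ae ?_
    filter_upwards [hp] with t ht ht'
    rw [Set.uIoc_of_le hx.1] at ht'
    exact ht ⟨ht'.1.le, ht'.2.trans hx.2⟩

lemma of_hasDerivAt (h : ∀ x, HasDerivAt u (p x) x) (hp : Continuous p) : IsPrim a b u p := by
  refine ⟨hp.intervalIntegrable _ _, fun x _ => ?_⟩
  rw [intervalIntegral.integral_eq_sub_of_hasDerivAt (fun x _ => h x) (hp.intervalIntegrable _ _)]
  ring

lemma of_integral (hp : IntervalIntegrable p volume a b) (c : ℂ) :
    IsPrim a b (fun x => c + ∫ t in a..x, p t) p :=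
  ⟨hp, fun x _ => by simp⟩

lemma add (h : IsPrim a b u p) (h' : IsPrim a b v q) :
    IsPrim a b (fun x => u x + v x) (fun x => p x + q x) := by
  refine ⟨h.1.add h'.1, fun x hx => ?_⟩
  have hsub : Set.uIcc a x ⊆ Set.uIcc a b := by
    rw [Set.uIcc_of_le hx.1, Set.uIcc_of_le (hx.1.trans hx.2)]
    exact Set.Icc_subset_Icc_right hx.2
  beta_reduce
  rw [intervalIntegral.integral_add (h.1.mono_set hsub) (h'.1.mono_set hsub), h.2 x hx, h'.2 x hx]
  ring

lemma const_mul (c : ℂ) (h : IsPrim a b u p) : IsPrim a b (fun x => c * u x) (fun x => c * p x) := by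
  refine ⟨h.1.const_mul c, fun x hx => ?_⟩
  beta_reduce
  rw [intervalIntegral.integral_const_mul, h.2 x hx]
  ring

lemma conj (h : IsPrim a b u p) :
    IsPrim a b (fun x => starRingEnd ℂ (u x)) (fun x => starRingEnd ℂ (p x)) := by
  have hi : IntervalIntegrable (fun x => starRingEnd ℂ (p x)) volume a b :=
    ⟨(LinearIsometryEquiv.integrable_comp_iff Complex.conjLIE).2 h.1.1,
      (LinearIsometryEquiv.integrable_comp_iff Complex.conjLIE).2 h.1.2⟩
  refine ⟨hi, fun x hx => ?_⟩
  beta_reduce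
  rw [h.2 x hx, map_add]
  congr 1
  rw [intervalIntegral.integral_of_le hx.1, intervalIntegral.integral_of_le hx.1, integral_conj]

/-- The product rule. -/
lemma mul (hab : a ≤ b) (h : IsPrim a b u p) (h' : IsPrim a b v q) :
    IsPrim a b (fun x => u x * v x) (fun x => p x * v x + u x * q x) := by
  have hcu := h.continuousOn hab
  have hcv := h'.continuousOn hab
  rw [← Set.uIcc_of_le hab] at hcu hcv
  have hi : IntervalIntegrable (fun x => p x * v x + u x * q x) volume a b :=
    (h.1.mul_continuousOn hcv).add (h'.1.continuousOn_mul hcu)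
  refine ⟨hi, ?_⟩
  have hU := absolutelyContinuousOnInterval_primitive h.1 (u a)
  have hV := absolutelyContinuousOnInterval_primitive h'.1 (v a)
  have hD := absolutelyContinuousOnInterval_primitive hi 0
  -- The product minus the candidate primitive is absolutely continuous with derivative zero almost
  -- everywhere, hence constant.
  have hW := (hU.smul hV).sub hD
  obtain ⟨C, hC⟩ := hW.const_of_ae_hasDerivAt_zero (by
    filter_upwards [h.1.ae_hasDerivAt_integral, h'.1.ae_hasDerivAt_integral,
      hi.ae_hasDerivAt_integral] with x h1 h2 h3 hx
    have e1 := (h1 hx a Set.left_mem_uIcc).const_add (u a)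
    have e2 := (h2 hx a Set.left_mem_uIcc).const_add (v a)
    have e3 := (h3 hx a Set.left_mem_uIcc).const_add 0
    have hx' : x ∈ Set.Icc a b := by rwa [Set.uIcc_of_le hab] at hx
    have e4 := (e1.mul e2).sub e3
    rw [← h.2 x hx', ← h'.2 x hx'] at e4
    rw [sub_self] at e4
    exact e4)
  rw [Set.uIcc_of_le hab] at hC
  intro x hx
  have h1 := hC x hx
  have h2 := hC a (Set.left_mem_Icc.2 hab)
  simp only [Pi.sub_apply, Pi.mul_apply, smul_eq_mul, intervalIntegral.integral_same, add_zero,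
    sub_zero, zero_add] at h1 h2
  rw [← h.2 x hx, ← h'.2 x hx, ← h2] at h1
  linear_combination h1

lemma integral_eq (hab : a ≤ b) (h : IsPrim a b u p) : ∫ t in a..b, p t = u b - u a := by
  rw [h.2 b (Set.right_mem_Icc.2 hab)]
  ring

end IsPrim

/-- The gauge transformation removes the magnetic potential. -/
lemma hasQuasiDerivOn_iff {A a b : ℝ} (hab : a ≤ b) {u p : ℝ → ℂ} :
    HasQuasiDerivOn A a b u p ↔ IsPrim a b (fun x => Complex.exp (Complex.I * A * x) * u x)
      (fun x => Complex.exp (Complex.I * A * x) * p x) := by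
  have hexp : ∀ B : ℂ, IsPrim a b (fun x => Complex.exp (Complex.I * B * x))
      (fun x => Complex.I * B * Complex.exp (Complex.I * B * x)) := by
    intro B
    refine IsPrim.of_hasDerivAt (fun x => ?_) (by fun_prop)
    have h1 := ((hasDerivAt_id (x : ℂ)).const_mul (Complex.I * B)).cexp.comp_ofReal
    simp only [id, mul_one] at h1
    rwa [mul_comm (Complex.exp _)] at h1
  have hcancel : ∀ x : ℝ, Complex.exp (Complex.I * (-A) * x) * Complex.exp (Complex.I * A * x) = 1 := by
    intro x
    rw [← Complex.exp_add]
    ring_nf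
    exact Complex.exp_zero
  constructor
  · intro h
    have h' : IsPrim a b u (fun t => p t - Complex.I * A * u t) := h
    refine ((hexp A).mul hab h').congr hab (fun x _ => rfl) (Filter.Eventually.of_forall fun x _ => ?_)
    ring
  · intro h
    refine ((hexp (-A)).mul hab h).congr hab (fun x _ => ?_) (Filter.Eventually.of_forall fun x _ => ?_)
    · rw [← mul_assoc, hcancel, one_mul]
    · linear_combination (p x - Complex.I * A * u x) * hcancel x

/-! ### The fundamental system of `-u'' = k² u` -/

/-- The solution `x ↦ sin (k x) / k` of `-u'' = k² u`. -/
def sinK (k : ℂ) (x : ℝ) : ℂ := ∫ t in (0 : ℝ)..x, Complex.cos (k * t)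

/-- The solution `x ↦ cos (k x)` of `-u'' = k² u`. -/
def cosK (k : ℂ) (x : ℝ) : ℂ := Complex.cos (k * x)

lemma hasDerivAt_sinK (k : ℂ) (x : ℝ) : HasDerivAt (sinK k) (cosK k x) x := by
  have hc : Continuous fun t : ℝ => Complex.cos (k * t) := by fun_prop
  exact intervalIntegral.integral_hasDerivAt_right (hc.intervalIntegrable _ _)
    hc.aestronglyMeasurable.stronglyMeasurableAtFilter hc.continuousAt

@[simp] lemma sinK_zero_right (k : ℂ) : sinK k 0 = 0 := by simp [sinK]

@[simp] lemma cosK_zero_right (k : ℂ) : cosK k 0 = 1 := by simp [cosK]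

lemma hasDerivAt_sin_mul (k : ℂ) (x : ℝ) :
    HasDerivAt (fun x : ℝ => Complex.sin (k * x)) (k * Complex.cos (k * x)) x := by
  have h1 := ((hasDerivAt_id (x : ℂ)).const_mul k).csin.comp_ofReal
  simp only [id, mul_one] at h1
  rwa [mul_comm (Complex.cos _)] at h1

/-- The definition of `sinK` as an integral keeps `k = 0` regular; this identity recovers the sine
without dividing by `k`. -/
lemma mul_sinK (k : ℂ) (x : ℝ) : k * sinK k x = Complex.sin (k * x) := by
  have hc : Continuous fun t : ℝ => k * Complex.cos (k * t) := by fun_prop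
  rw [sinK, ← intervalIntegral.integral_const_mul,
    intervalIntegral.integral_eq_sub_of_hasDerivAt (fun x _ => hasDerivAt_sin_mul k x)
      (hc.intervalIntegrable _ _)]
  simp

lemma sinK_zero_left (x : ℝ) : sinK 0 x = x := by simp [sinK]

lemma sinK_eq_div {k : ℂ} (hk : k ≠ 0) (x : ℝ) : sinK k x = Complex.sin (k * x) / k := by
  rw [← mul_sinK]; field_simp

lemma hasDerivAt_cosK (k : ℂ) (x : ℝ) : HasDerivAt (cosK k) (-(k ^ 2 * sinK k x)) x := by
  have h1 := ((hasDerivAt_id (x : ℂ)).const_mul k).ccos.comp_ofReal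
  simp only [id, mul_one] at h1
  have h2 : -(k ^ 2 * sinK k x) = -Complex.sin (k * x) * k := by rw [← mul_sinK]; ring
  rw [h2]
  exact h1

lemma continuous_sinK (k : ℂ) : Continuous (sinK k) :=
  continuous_iff_continuousAt.2 fun x => (hasDerivAt_sinK k x).continuousAt

lemma continuous_cosK (k : ℂ) : Continuous (cosK k) := by unfold cosK; fun_prop

lemma cosK_sq_add (k : ℂ) (x : ℝ) : cosK k x ^ 2 + k ^ 2 * sinK k x ^ 2 = 1 := by
  rw [← mul_pow, mul_sinK, cosK]
  exact Complex.cos_sq_add_sin_sq _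

lemma norm_cosK_le (k : ℂ) (x : ℝ) : ‖cosK k x‖ ≤ Real.exp (‖k‖ * |x|) := by
  rw [cosK, Complex.cos]
  have h1 : ∀ w : ℂ, ‖Complex.exp w‖ ≤ Real.exp ‖w‖ := fun w => by
    rw [Complex.norm_exp]
    exact Real.exp_le_exp.2 (Complex.re_le_norm w)
  have e : ‖k * (x : ℂ) * Complex.I‖ = ‖k‖ * |x| := by simp
  have e' : ‖-(k * (x : ℂ)) * Complex.I‖ = ‖k‖ * |x| := by simp
  have h2 := h1 (k * x * Complex.I)
  have h3 := h1 (-(k * x) * Complex.I)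
  rw [e] at h2
  rw [e'] at h3
  rw [norm_div, Complex.norm_ofNat, div_le_iff₀ (by norm_num)]
  linarith [norm_add_le (Complex.exp (k * x * Complex.I)) (Complex.exp (-(k * x) * Complex.I))]

lemma norm_sinK_le (k : ℂ) (x : ℝ) : ‖sinK k x‖ ≤ Real.exp (‖k‖ * |x|) * |x| := by
  have := intervalIntegral.norm_integral_le_of_norm_le_const (a := 0) (b := x)
    (f := fun t => Complex.cos (k * t)) (C := Real.exp (‖k‖ * |x|)) (fun t ht => by
      refine (norm_cosK_le k t).trans (Real.exp_le_exp.2 ?_)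
      refine mul_le_mul_of_nonneg_left ?_ (norm_nonneg k)
      rcases le_total 0 x with h | h
      · rw [Set.uIoc_of_le h] at ht
        rw [abs_of_pos ht.1, abs_of_nonneg h]; exact ht.2
      · rw [Set.uIoc_of_ge h] at ht
        rw [abs_of_nonpos ht.2, abs_of_nonpos h]; linarith [ht.1])
  simpa [sinK] using this

lemma conj_cosK (k : ℂ) (x : ℝ) : starRingEnd ℂ (cosK k x) = cosK (starRingEnd ℂ k) x := by
  rw [cosK, cosK, ← Complex.cos_conj, map_mul, Complex.conj_ofReal]

lemma cosK_neg (k : ℂ) (x : ℝ) : cosK (-k) x = cosK k x := by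
  rw [cosK, cosK, neg_mul, Complex.cos_neg]

lemma conj_sinK (k : ℂ) (x : ℝ) : starRingEnd ℂ (sinK k x) = sinK (starRingEnd ℂ k) x := by
  have e : ∀ t : ℝ, Complex.cos (starRingEnd ℂ k * t) = starRingEnd ℂ (Complex.cos (k * t)) :=
    fun t => (conj_cosK k t).symm
  simp only [sinK, e]
  rw [intervalIntegral, intervalIntegral, integral_conj, integral_conj, map_sub]

lemma sinK_neg (k : ℂ) (x : ℝ) : sinK (-k) x = sinK k x := by
  simp [sinK, Complex.cos_neg]

lemma isPrim_sinK (k : ℂ) (a b c : ℝ) : IsPrim a b (fun x => sinK k (x - c)) (fun x => cosK k (x - c)) :=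
  IsPrim.of_hasDerivAt (fun x => (hasDerivAt_sinK k (x - c)).comp_sub_const x c)
    ((continuous_cosK k).comp (by fun_prop))

lemma isPrim_cosK (k : ℂ) (a b c : ℝ) :
    IsPrim a b (fun x => cosK k (x - c)) (fun x => -(k ^ 2 * sinK k (x - c))) :=
  IsPrim.of_hasDerivAt (fun x => (hasDerivAt_cosK k (x - c)).comp_sub_const x c)
    (((continuous_sinK k).comp (by fun_prop)).const_mul _ |>.neg)

/-! ### Variation of constants -/

/-- The solution of `-u'' - k² u = g` with `u a = x₀`, `u' a = y₀`. -/
def solU (k : ℂ) (a : ℝ) (x₀ y₀ : ℂ) (g : ℝ → ℂ) (x : ℝ) : ℂ :=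
  (x₀ + ∫ t in a..x, g t * sinK k (t - a)) * cosK k (x - a) +
    (y₀ + ∫ t in a..x, -(g t * cosK k (t - a))) * sinK k (x - a)

/-- The derivative of `solU`. -/
def solP (k : ℂ) (a : ℝ) (x₀ y₀ : ℂ) (g : ℝ → ℂ) (x : ℝ) : ℂ :=
  -(k ^ 2 * sinK k (x - a)) * (x₀ + ∫ t in a..x, g t * sinK k (t - a)) +
    cosK k (x - a) * (y₀ + ∫ t in a..x, -(g t * cosK k (t - a)))

section Variation

variable {k : ℂ} {a b : ℝ} {g : ℝ → ℂ}

lemma intervalIntegrable_mul_sinK (hg : IntervalIntegrable g volume a b) :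
    IntervalIntegrable (fun t => g t * sinK k (t - a)) volume a b :=
  hg.mul_continuousOn ((continuous_sinK k).comp (by fun_prop)).continuousOn

lemma intervalIntegrable_neg_mul_cosK (hg : IntervalIntegrable g volume a b) :
    IntervalIntegrable (fun t => -(g t * cosK k (t - a))) volume a b :=
  (hg.mul_continuousOn ((continuous_cosK k).comp (by fun_prop)).continuousOn).neg

lemma isPrim_solU (hab : a ≤ b) (hg : IntervalIntegrable g volume a b) (x₀ y₀ : ℂ) :
    IsPrim a b (solU k a x₀ y₀ g) (solP k a x₀ y₀ g) := by
  have h1 := IsPrim.of_integral (intervalIntegrable_mul_sinK (k := k) hg) x₀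
  have h2 := IsPrim.of_integral (intervalIntegrable_neg_mul_cosK (k := k) hg) y₀
  refine ((h1.mul hab (isPrim_cosK k a b a)).add (h2.mul hab (isPrim_sinK k a b a))).congr hab
    (fun x _ => rfl) (Filter.Eventually.of_forall fun x _ => ?_)
  simp only [solP]
  ring

lemma isPrim_solP (hab : a ≤ b) (hg : IntervalIntegrable g volume a b) (x₀ y₀ : ℂ) :
    IsPrim a b (solP k a x₀ y₀ g) (fun x => -(k ^ 2 * solU k a x₀ y₀ g x + g x)) := by
  have h1 := IsPrim.of_integral (intervalIntegrable_mul_sinK (k := k) hg) x₀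
  have h2 := IsPrim.of_integral (intervalIntegrable_neg_mul_cosK (k := k) hg) y₀
  refine ((((isPrim_sinK k a b a).mul hab h1).const_mul (-k ^ 2)).add
    ((isPrim_cosK k a b a).mul hab h2)).congr hab
    (fun x _ => ?_) (Filter.Eventually.of_forall fun x _ => ?_)
  · simp only [solP]
    ring
  · simp only [solU]
    linear_combination (-g x) * cosK_sq_add k (x - a)

/-- The coefficients of `u` in the fundamental system, `u cos - p sin/k` and `k² u sin/k + p cos`,
have the derivatives `g sin/k` and `-g cos`. Integrating these and inverting with `cosK_sq_add`
gives the formulas. -/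
lemma eq_sol (hab : a ≤ b) {u p : ℝ → ℂ} (hu : IsPrim a b u p)
    (hp : IsPrim a b p (fun x => -(k ^ 2 * u x + g x))) :
    ∀ x ∈ Set.Icc a b, u x = solU k a (u a) (p a) g x ∧ p x = solP k a (u a) (p a) g x := by
  have h1 : IsPrim a b (fun x => u x * cosK k (x - a) + (-1) * (p x * sinK k (x - a)))
      (fun x => g x * sinK k (x - a)) := by
    refine ((hu.mul hab (isPrim_cosK k a b a)).add
      ((hp.mul hab (isPrim_sinK k a b a)).const_mul (-1))).congr hab (fun x _ => rfl)
      (Filter.Eventually.of_forall fun x _ => ?_)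
    ring
  have h2 : IsPrim a b (fun x => k ^ 2 * (u x * sinK k (x - a)) + p x * cosK k (x - a))
      (fun x => -(g x * cosK k (x - a))) := by
    refine (((hu.mul hab (isPrim_sinK k a b a)).const_mul (k ^ 2)).add
      (hp.mul hab (isPrim_cosK k a b a))).congr hab (fun x _ => rfl)
      (Filter.Eventually.of_forall fun x _ => ?_)
    ring
  intro x hx
  have e1 := h1.2 x hx
  have e2 := h2.2 x hx
  have e := cosK_sq_add k (x - a)
  simp only [sub_self, sinK_zero_right, cosK_zero_right, mul_zero, mul_one, add_zero,
    zero_add] at e1 e2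
  constructor
  · rw [solU, ← e1, ← e2]
    linear_combination (-u x) * e
  · rw [solP, ← e1, ← e2]
    linear_combination (-p x) * e

end Variation
end

noncomputable section

/-! ### Sequences -/

/-- A bounded-type recursion has no nonzero solution tending to zero. -/
lemma eq_zero_of_recursion_of_tendsto {F : ℝ} (hF : |F| ≤ 1) {y : ℕ → ℂ}
    (hrec : ∀ n, y (n + 2) + y n = 2 * F * y (n + 1))
    (hy : Filter.Tendsto y Filter.atTop (nhds 0)) (n : ℕ) : y n = 0 := by
  set ζ : ℂ := Complex.exp (Real.arccos F * Complex.I)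
  have hζ : ‖ζ‖ = 1 := Complex.norm_exp_ofReal_mul_I _
  have hζ0 : ζ ≠ 0 := Complex.exp_ne_zero _
  have hsum : ζ + ζ⁻¹ = 2 * F := by
    have h1 : Complex.cos (Real.arccos F) = F := by
      rw [← Complex.ofReal_cos, Real.cos_arccos (by linarith [abs_le.1 hF]) (abs_le.1 hF).2]
    rw [← h1, Complex.cos, ← Complex.exp_neg]
    simp only [ζ]
    ring_nf
  -- This quadratic form is conserved by the recursion. It tends to zero, so it vanishes; one factor
  -- is then zero at each step and `‖y n‖` is constant because `ζ` is unimodular. The argument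
  -- includes the degenerate case `ζ = ±1`.
  have hQ : ∀ n, (y (n + 1) - ζ * y n) * (y (n + 1) - ζ⁻¹ * y n) =
      (y 1 - ζ * y 0) * (y 1 - ζ⁻¹ * y 0) := by
    intro n
    induction n with
    | zero => rfl
    | succ n ih =>
      rw [← ih, show y (n + 1 + 1) = 2 * F * y (n + 1) - y n from by rw [← hrec n]; ring, ← hsum]
      linear_combination (y (n + 1) ^ 2 - y n ^ 2) * mul_inv_cancel₀ hζ0
  have hlim : Filter.Tendsto (fun n => (y (n + 1) - ζ * y n) * (y (n + 1) - ζ⁻¹ * y n))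
      Filter.atTop (nhds ((0 - ζ * 0) * (0 - ζ⁻¹ * 0))) :=
    ((hy.comp (Filter.tendsto_add_atTop_nat 1)).sub (hy.const_mul ζ)).mul
      ((hy.comp (Filter.tendsto_add_atTop_nat 1)).sub (hy.const_mul ζ⁻¹))
  have h0 : (y 1 - ζ * y 0) * (y 1 - ζ⁻¹ * y 0) = 0 := by
    simp only [hQ] at hlim
    simpa using tendsto_nhds_unique tendsto_const_nhds hlim
  have hnorm : ∀ n, ‖y (n + 1)‖ = ‖y n‖ := by
    intro n
    have h1 := hQ n
    rw [h0] at h1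
    rcases mul_eq_zero.1 h1 with h | h
    · rw [sub_eq_zero.1 h, norm_mul, hζ, one_mul]
    · rw [sub_eq_zero.1 h, norm_mul, norm_inv, hζ, inv_one, one_mul]
  have hconst : ∀ m, ‖y (n + m)‖ = ‖y n‖ := by
    intro m
    induction m with
    | zero => rfl
    | succ m ih => rw [← add_assoc, hnorm, ih]
  have hl2 : Filter.Tendsto (fun m => ‖y (n + m)‖) Filter.atTop (nhds 0) := by
    have := (hy.comp (Filter.tendsto_add_atTop_nat n)).norm
    simpa [Function.comp_def, add_comm] using this
  simp only [hconst] at hl2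
  exact norm_eq_zero.1 (tendsto_nhds_unique tendsto_const_nhds hl2)

/-- The roots `F ± w` of `ζ² - 2Fζ + 1` have product `1`. If both were unimodular, they would be
conjugate to each other and `F` would be their common real part, a number in `[-1, 1]`. -/
lemma exists_root_norm_lt_one {F : ℂ} (hF : ∀ t : ℝ, |t| ≤ 1 → F ≠ t) :
    ∃ ζ : ℂ, ζ ≠ 0 ∧ ‖ζ‖ < 1 ∧ ζ + ζ⁻¹ = 2 * F := by
  obtain ⟨w, hw⟩ := IsAlgClosed.exists_pow_nat_eq (F ^ 2 - 1) (n := 2) (by norm_num)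
  have hprod : (F + w) * (F - w) = 1 := by linear_combination -hw
  have h1 : F + w ≠ 0 := left_ne_zero_of_mul_eq_one hprod
  have h2 : F - w ≠ 0 := right_ne_zero_of_mul_eq_one hprod
  have hinv : (F + w)⁻¹ = F - w := inv_eq_of_mul_eq_one_right hprod
  have hinv' : (F - w)⁻¹ = F + w := inv_eq_of_mul_eq_one_left hprod
  have hn : ‖F + w‖ * ‖F - w‖ = 1 := by rw [← norm_mul, hprod, norm_one]
  rcases lt_trichotomy ‖F + w‖ 1 with h | h | h
  · exact ⟨F + w, h1, h, by rw [hinv]; ring⟩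
  · exfalso
    have hc : (F + w)⁻¹ = starRingEnd ℂ (F + w) := by
      rw [Complex.inv_def, Complex.normSq_eq_norm_sq, h]; simp
    refine hF (F + w).re (h ▸ Complex.abs_re_le_norm _) ?_
    have h3 := Complex.add_conj (F + w)
    rw [← hc, hinv] at h3
    push_cast at h3
    linear_combination h3 / 2
  · refine ⟨F - w, h2, ?_, by rw [hinv']; ring⟩
    by_contra h'
    push Not at h'
    nlinarith

/-- The two-sided square-summable sequences. -/
abbrev L2Seq : Type := lp (fun _ : ℤ => ℂ) 2

lemma memℓp_two_iff {y : ℤ → ℂ} : Memℓp y 2 ↔ Summable fun i => ‖y i‖ ^ 2 := by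
  rw [memℓp_gen_iff (by norm_num)]
  simp

/-- The shift is an isometry of `ℓ²`, so `a ↦ y + ζ (shifted a)` is a contraction and its fixed
point is the solution. -/
lemma exists_sq_summable_first_order {ζ : ℂ} (hζ : ‖ζ‖ < 1) {y : ℤ → ℂ}
    (hy : Summable fun i => ‖y i‖ ^ 2) (s : ℤ) :
    ∃ a : ℤ → ℂ, (Summable fun i => ‖a i‖ ^ 2) ∧ ∀ i, a i - ζ * a (i + s) = y i := by
  have hshift : ∀ a : L2Seq, Memℓp (fun i => a (i + s)) 2 := fun a =>
    memℓp_two_iff.2 ((Equiv.addRight s).summable_iff.2 (memℓp_two_iff.1 (lp.memℓp a)))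
  let Y : L2Seq := ⟨y, memℓp_two_iff.2 hy⟩
  let S : L2Seq → L2Seq := fun a => ⟨fun i => a (i + s), hshift a⟩
  have hS : ∀ a b, ‖S a - S b‖ = ‖a - b‖ := by
    intro a b
    rw [lp.norm_eq_tsum_rpow (by norm_num), lp.norm_eq_tsum_rpow (by norm_num)]
    congr 1
    exact (Equiv.addRight s).tsum_eq (fun i => ‖(a - b) i‖ ^ (2 : ENNReal).toReal)
  let Φ : L2Seq → L2Seq := fun a => Y + ζ • S a
  have hΦ : ContractingWith ⟨‖ζ‖, norm_nonneg ζ⟩ Φ := by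
    refine ⟨hζ, LipschitzWith.of_dist_le_mul fun a b => ?_⟩
    rw [dist_eq_norm, dist_eq_norm, ← hS a b]
    have : Φ a - Φ b = ζ • (S a - S b) := by simp only [Φ]; module
    rw [this, norm_smul]
    rfl
  have hfix := hΦ.fixedPoint_isFixedPt
  set a := hΦ.fixedPoint Φ
  refine ⟨a, memℓp_two_iff.1 (lp.memℓp a), fun i => ?_⟩
  have h1 : (Φ a) i = a i := by rw [hfix]
  rw [← h1]
  change y i + ζ * a (i + s) - ζ * a (i + s) = y i
  ring

/-- The discrete Laplacian minus `2 F` is onto if `F ∉ [-1, 1]`. -/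
lemma exists_sq_summable_second_order {F : ℂ} (hF : ∀ t : ℝ, |t| ≤ 1 → F ≠ t) {y : ℤ → ℂ}
    (hy : Summable fun i => ‖y i‖ ^ 2) :
    ∃ w : ℤ → ℂ, (Summable fun i => ‖w i‖ ^ 2) ∧
      ∀ i, w (i + 1) + w (i - 1) - 2 * F * w i = y i := by
  obtain ⟨ζ, h0, h1, h2⟩ := exists_root_norm_lt_one hF
  have hy' : Summable fun i => ‖-ζ * y i‖ ^ 2 := by
    simp only [norm_mul, mul_pow]
    exact hy.mul_left _
  -- With the shift `S` and `2F = ζ + ζ⁻¹`, one has `-ζ (S + S⁻¹ - 2F) = (1 - ζ S)(1 - ζ S⁻¹)`; the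
  -- two factors are inverted in turn.
  obtain ⟨a, ha, ha'⟩ := exists_sq_summable_first_order h1 hy' 1
  obtain ⟨w, hw, hw'⟩ := exists_sq_summable_first_order h1 ha (-1)
  refine ⟨w, hw, fun i => ?_⟩
  have e1 := hw' i
  have e2 := hw' (i + 1)
  have e3 := ha' i
  rw [add_neg_cancel_right] at e2
  rw [← sub_eq_add_neg] at e1
  have hinv := mul_inv_cancel₀ h0
  have : -ζ * (w (i + 1) + w (i - 1) - 2 * F * w i) = -ζ * y i := by
    rw [← e3, ← e1, ← e2, ← h2]
    linear_combination w i * hinv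
  exact mul_left_cancel₀ (neg_ne_zero.2 h0) this

end

noncomputable section

/-! ### Square integrable functions on the subdivided line -/

/-- The position of the vertex `v_j` on the line. -/
def vx (j : ℤ) : ℝ := j * Real.pi

lemma vx_succ (j : ℤ) : vx (j + 1) = vx j + Real.pi := by
  simp only [vx]; push_cast; ring

lemma vx_lt_succ (j : ℤ) : vx j < vx (j + 1) := by
  rw [vx_succ]; linarith [Real.pi_pos]

lemma vx_le_succ (j : ℤ) : vx j ≤ vx (j + 1) := (vx_lt_succ j).le

lemma iUnion_Ioc_vx : ⋃ j : ℤ, Set.Ioc (vx j) (vx (j + 1)) = Set.univ := by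
  have := iUnion_Ioc_zsmul Real.pi_pos
  simpa [vx] using this

lemma pairwise_disjoint_Ioc_vx :
    Pairwise (Function.onFun Disjoint fun j : ℤ => Set.Ioc (vx j) (vx (j + 1))) := by
  have h : Monotone vx := by
    intro i j hij
    have : (i : ℝ) ≤ j := by exact_mod_cast hij
    exact mul_le_mul_of_nonneg_right this Real.pi_pos.le
  simpa using h.pairwise_disjoint_on_Ioc_succ

lemma hasSum_integral_edges {G : Type*} [NormedAddCommGroup G] [NormedSpace ℝ G] {h : ℝ → G}
    (hh : Integrable h) : HasSum (fun j : ℤ => ∫ x in vx j..vx (j + 1), h x) (∫ x, h x) := by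
  have h1 := hasSum_integral_iUnion (μ := volume) (f := h) (fun j : ℤ => measurableSet_Ioc)
    pairwise_disjoint_Ioc_vx (by rw [iUnion_Ioc_vx]; exact hh.integrableOn)
  rw [iUnion_Ioc_vx, setIntegral_univ] at h1
  refine h1.congr_fun ?_
  intro j
  rw [intervalIntegral.integral_of_le (vx_le_succ j)]

/-- The Hilbert space `L²(ℝ)`. -/
abbrev L2R : Type := Lp ℂ 2 (volume : Measure ℝ)

lemma L2R.intervalIntegrable (ψ : L2R) (a b : ℝ) : IntervalIntegrable ψ volume a b := by
  rw [intervalIntegrable_iff]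
  have : IsFiniteMeasure (volume.restrict (Set.uIoc a b)) := by
    rw [Set.uIoc]
    infer_instance
  exact ((Lp.memLp ψ).restrict (Set.uIoc a b)).integrable one_le_two

/-- The `L¹`-norm of `ψ` on the `j`-th edge. -/
def edgeL1 (ψ : ℝ → ℂ) (j : ℤ) : ℝ := ∫ x in vx j..vx (j + 1), ‖ψ x‖

lemma edgeL1_nonneg (ψ : ℝ → ℂ) (j : ℤ) : 0 ≤ edgeL1 ψ j :=
  intervalIntegral.integral_nonneg (vx_le_succ j) fun _ _ => norm_nonneg _

lemma L2R.integrable_sq (ψ : L2R) : Integrable (fun x => ‖ψ x‖ ^ 2) :=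
  (memLp_two_iff_integrable_sq_norm (Lp.aestronglyMeasurable ψ)).1 (Lp.memLp ψ)

/-- Cauchy–Schwarz on an edge of length `π`, obtained by expanding the nonnegative integral of `(‖ψ‖
- mean)²`. -/
lemma edgeL1_sq_le (ψ : L2R) (j : ℤ) :
    edgeL1 ψ j ^ 2 ≤ Real.pi * ∫ x in vx j..vx (j + 1), ‖ψ x‖ ^ 2 := by
  set I := edgeL1 ψ j with hI
  set S := ∫ x in vx j..vx (j + 1), ‖ψ x‖ ^ 2
  have hint_norm : IntervalIntegrable (fun x => ‖ψ x‖) volume (vx j) (vx (j + 1)) :=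
    (L2R.intervalIntegrable ψ _ _).norm
  have hint_sq : IntervalIntegrable (fun x => ‖ψ x‖ ^ 2) volume (vx j) (vx (j + 1)) :=
    (L2R.integrable_sq ψ).intervalIntegrable
  have h1 : 0 ≤ ∫ x in vx j..vx (j + 1),
      (‖ψ x‖ ^ 2 - 2 * (I / Real.pi) * ‖ψ x‖ + (I / Real.pi) ^ 2) :=
    intervalIntegral.integral_nonneg (vx_le_succ j) fun x _ => by
      nlinarith [sq_nonneg (‖ψ x‖ - I / Real.pi)]
  rw [intervalIntegral.integral_add (hint_sq.sub (hint_norm.const_mul _)) (by simp),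
    intervalIntegral.integral_sub hint_sq (hint_norm.const_mul _), intervalIntegral.integral_const_mul,
    intervalIntegral.integral_const, vx_succ, add_sub_cancel_left, smul_eq_mul] at h1
  change 0 ≤ (∫ x in vx j..vx j + Real.pi, ‖ψ x‖ ^ 2) -
    2 * (I / Real.pi) * (∫ x in vx j..vx j + Real.pi, ‖ψ x‖) + _ at h1
  rw [← vx_succ] at h1
  change 0 ≤ S - 2 * (I / Real.pi) * I + Real.pi * (I / Real.pi) ^ 2 at h1
  have h2 : S - 2 * (I / Real.pi) * I + Real.pi * (I / Real.pi) ^ 2 = S - I ^ 2 / Real.pi := by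
    field_simp
    ring
  rw [h2, sub_nonneg, div_le_iff₀ Real.pi_pos] at h1
  linarith

lemma summable_edgeL1_sq (ψ : L2R) : Summable fun j => edgeL1 ψ j ^ 2 := by
  refine Summable.of_nonneg_of_le (fun j => sq_nonneg _) (edgeL1_sq_le ψ) ?_
  exact ((hasSum_integral_edges (L2R.integrable_sq ψ)).summable).mul_left _

lemma sq_summable_of_le {B C : ℤ → ℝ} (hC : Summable fun j => C j ^ 2) (hB : ∀ j, 0 ≤ B j)
    (h : ∀ j, B j ≤ C j) : Summable fun j => B j ^ 2 :=
  Summable.of_nonneg_of_le (fun _ => sq_nonneg _) (fun j => pow_le_pow_left₀ (hB j) (h j) 2) hC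

lemma sq_summable_add {B C : ℤ → ℝ} (hB : Summable fun j => B j ^ 2)
    (hC : Summable fun j => C j ^ 2) : Summable fun j => (B j + C j) ^ 2 := by
  refine Summable.of_nonneg_of_le (fun j => sq_nonneg _) (fun j => ?_)
    ((hB.add hC).mul_left 2)
  nlinarith [sq_nonneg (B j - C j)]

lemma sq_summable_const_mul {B : ℤ → ℝ} (c : ℝ) (hB : Summable fun j => B j ^ 2) :
    Summable fun j => (c * B j) ^ 2 := by
  simp only [mul_pow]
  exact hB.mul_left _

/-- Functions on the edges with square summable bounds define an element of `L²(ℝ)`. -/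
lemma exists_L2R_of_edges {u : ℤ → ℝ → ℂ} {B : ℤ → ℝ}
    (hc : ∀ j, ContinuousOn (u j) (Set.Icc (vx j) (vx (j + 1))))
    (hb : ∀ j, ∀ x ∈ Set.Icc (vx j) (vx (j + 1)), ‖u j x‖ ≤ B j)
    (hB : Summable fun j => B j ^ 2) :
    ∃ ψ : L2R, ∀ j, ∀ᵐ x, x ∈ Set.Icc (vx j) (vx (j + 1)) → ψ x = u j x := by
  -- Half-open edges partition the line, so the pieces can be glued without ambiguity at the
  -- vertices; the left endpoints excluded in this way form a null set.
  have hex : ∀ x : ℝ, ∃ j : ℤ, x ∈ Set.Ioc (vx j) (vx (j + 1)) := fun x => by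
    have : x ∈ ⋃ j : ℤ, Set.Ioc (vx j) (vx (j + 1)) := by rw [iUnion_Ioc_vx]; trivial
    simpa using this
  choose idx hidx using hex
  have huniq : ∀ j x, x ∈ Set.Ioc (vx j) (vx (j + 1)) → idx x = j := by
    intro j x hx
    by_contra h
    exact Set.disjoint_left.1 (pairwise_disjoint_Ioc_vx h) (hidx x) hx
  set Φ : ℝ → ℂ := fun x => u (idx x) x with hΦ
  have heq : ∀ j, ∀ x ∈ Set.Ioc (vx j) (vx (j + 1)), Φ x = u j x := fun j x hx => by
    simp only [hΦ, huniq j x hx]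
  have hmeas : AEStronglyMeasurable Φ volume := by
    rw [← Measure.restrict_univ (μ := volume), ← iUnion_Ioc_vx, aestronglyMeasurable_iUnion_iff]
    intro j
    refine AEStronglyMeasurable.congr (f := u j) ?_ ?_
    · exact ((hc j).mono Set.Ioc_subset_Icc_self).aestronglyMeasurable measurableSet_Ioc
    · exact (ae_restrict_iff' measurableSet_Ioc).2
        (Filter.Eventually.of_forall fun x hx => (heq j x hx).symm)
  have hb' : ∀ j, ∀ x ∈ Set.Ioc (vx j) (vx (j + 1)), ‖‖Φ x‖ ^ 2‖ ≤ B j ^ 2 := by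
    intro j x hx
    rw [heq j x hx, Real.norm_of_nonneg (sq_nonneg _)]
    exact pow_le_pow_left₀ (norm_nonneg _) (hb j x (Set.Ioc_subset_Icc_self hx)) 2
  have hmem : MemLp Φ 2 volume := by
    rw [memLp_two_iff_integrable_sq_norm hmeas, ← integrableOn_univ, ← iUnion_Ioc_vx]
    refine integrableOn_iUnion_of_summable_integral_norm (fun j => ?_) ?_
    · exact Measure.integrableOn_of_bounded (by simp) (hmeas.norm.pow 2)
        (ae_restrict_of_forall_mem measurableSet_Ioc (hb' j))
    · refine Summable.of_nonneg_of_le (fun j => integral_nonneg fun _ => norm_nonneg _)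
        (fun j => ?_) (hB.mul_left Real.pi)
      have := norm_setIntegral_le_of_norm_le_const (μ := volume) (s := Set.Ioc (vx j) (vx (j + 1)))
        (f := fun x => ‖‖Φ x‖ ^ 2‖) (C := B j ^ 2) (by simp) (fun x hx => by
          rw [norm_norm]; exact hb' j x hx)
      refine (le_abs_self _).trans (this.trans_eq ?_)
      simp [Measure.real, vx_succ, Real.pi_pos.le]
      ring
  refine ⟨hmem.toLp Φ, fun j => ?_⟩
  have hne : ∀ᵐ x : ℝ, x ≠ vx j := by simp [ae_iff]
  filter_upwards [hmem.coeFn_toLp, hne] with x h1 h2 h3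
  rw [h1, heq j x ⟨lt_of_le_of_ne h3.1 h2.symm, h3.2⟩]

lemma L2R.ext_edges {ψ φ : L2R}
    (h : ∀ j, ∀ᵐ x, x ∈ Set.Icc (vx j) (vx (j + 1)) → ψ x = φ x) : ψ = φ := by
  refine Lp.ext ?_
  filter_upwards [ae_all_iff.2 h] with x hx
  have : x ∈ ⋃ j : ℤ, Set.Ioc (vx j) (vx (j + 1)) := by rw [iUnion_Ioc_vx]; trivial
  obtain ⟨j, hj⟩ := Set.mem_iUnion.1 this
  exact hx j (Set.Ioc_subset_Icc_self hj)

lemma hasSum_inner_edges (ψ φ : L2R) :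
    HasSum (fun j : ℤ => ∫ x in vx j..vx (j + 1), starRingEnd ℂ (ψ x) * φ x) (inner ℂ ψ φ) := by
  have h1 := hasSum_integral_edges (L2.integrable_inner (𝕜 := ℂ) ψ φ)
  rw [← L2.inner_def] at h1
  refine h1.congr_fun fun j => ?_
  refine intervalIntegral.integral_congr fun x _ => ?_
  simp [RCLike.inner_apply, mul_comm]

/-- On the `j`-th edge `ψ` has the `H²`-representative `u` with derivative `p`, and `-u'' = f`. -/
structure LineEdge (j : ℤ) (ψ f u p : ℝ → ℂ) : Prop where
  ae_eq : ∀ᵐ x, x ∈ Set.Icc (vx j) (vx (j + 1)) → ψ x = u x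
  prim_u : IsPrim (vx j) (vx (j + 1)) u p
  prim_p : IsPrim (vx j) (vx (j + 1)) p (fun x => -f x)

lemma norm_integral_mul_le {j : ℤ} (ψ : L2R) {τ : ℝ → ℂ} {C : ℝ}
    (hτ : ∀ x ∈ Set.Icc (vx j) (vx (j + 1)), ‖τ x‖ ≤ C) :
    ‖∫ x in vx j..vx (j + 1), τ x * ψ x‖ ≤ C * edgeL1 ψ j := by
  rw [edgeL1, ← intervalIntegral.integral_const_mul]
  refine intervalIntegral.norm_integral_le_of_norm_le (vx_le_succ j) ?_
    ((L2R.intervalIntegrable ψ _ _).norm.const_mul C)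
  refine Filter.Eventually.of_forall fun x hx => ?_
  rw [norm_mul]
  exact mul_le_mul_of_nonneg_right (hτ x (Set.Ioc_subset_Icc_self hx)) (norm_nonneg _)

/-- Green's identity with a test function `τ` that vanishes to first order at the right end leaves
only boundary terms at the left end. They equal, up to sign, the integral of `τ'' ψ + τ f`, so the
edge `L¹`-norms control them. -/
lemma exists_boundary_bound {τ τ' τ'' : ℝ → ℝ} (h1 : ∀ x, HasDerivAt τ (τ' x) x)
    (h2 : ∀ x, HasDerivAt τ' (τ'' x) x) (h3 : Continuous τ'') (h4 : τ Real.pi = 0)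
    (h5 : τ' Real.pi = 0) : ∃ C : ℝ, 0 ≤ C ∧ ∀ (j : ℤ) (ψ f : L2R) (u p : ℝ → ℂ), LineEdge j ψ f u p →
      ‖u (vx j) * τ' 0 - p (vx j) * τ 0‖ ≤ C * (edgeL1 ψ j + edgeL1 f j) := by
  have hcτ : Continuous τ := continuous_iff_continuousAt.2 fun x => (h1 x).continuousAt
  have hcτ' : Continuous τ' := continuous_iff_continuousAt.2 fun x => (h2 x).continuousAt
  obtain ⟨C1, hC1⟩ := (isCompact_Icc (a := (0 : ℝ)) (b := Real.pi)).exists_bound_of_continuousOn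
    hcτ.continuousOn
  obtain ⟨C2, hC2⟩ := (isCompact_Icc (a := (0 : ℝ)) (b := Real.pi)).exists_bound_of_continuousOn
    h3.continuousOn
  refine ⟨max 0 (max C1 C2), le_max_left _ _, fun j ψ f u p h => ?_⟩
  set a := vx j with ha
  set b := vx (j + 1) with hb
  have hab : a ≤ b := vx_le_succ j
  have p1 : IsPrim a b (fun x => ((τ (x - a) : ℝ) : ℂ)) (fun x => ((τ' (x - a) : ℝ) : ℂ)) :=
    IsPrim.of_hasDerivAt (fun x => ((h1 (x - a)).comp_sub_const x a).ofReal_comp) (by fun_prop)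
  have p2 : IsPrim a b (fun x => ((τ' (x - a) : ℝ) : ℂ)) (fun x => ((τ'' (x - a) : ℝ) : ℂ)) :=
    IsPrim.of_hasDerivAt (fun x => ((h2 (x - a)).comp_sub_const x a).ofReal_comp) (by fun_prop)
  have p3 : IsPrim a b (fun x => u x * ((τ' (x - a) : ℝ) : ℂ) + (-1) * (p x * ((τ (x - a) : ℝ) : ℂ)))
      (fun x => ((τ'' (x - a) : ℝ) : ℂ) * ψ x + ((τ (x - a) : ℝ) : ℂ) * f x) := by
    refine ((h.prim_u.mul hab p2).add ((h.prim_p.mul hab p1).const_mul (-1))).congr hab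
      (fun x _ => rfl) ?_
    filter_upwards [h.ae_eq] with x hx hx'
    rw [hx hx']
    ring
  have e := p3.integral_eq hab
  have hba : b - a = Real.pi := by rw [hb, vx_succ]; ring
  rw [hba, h4, h5, sub_self] at e
  have c1 : Continuous fun x : ℝ => ((τ'' (x - a) : ℝ) : ℂ) := by fun_prop
  have c2 : Continuous fun x : ℝ => ((τ (x - a) : ℝ) : ℂ) := by fun_prop
  rw [intervalIntegral.integral_add
    ((L2R.intervalIntegrable ψ a b).continuousOn_mul c1.continuousOn)
    ((L2R.intervalIntegrable f a b).continuousOn_mul c2.continuousOn)] at e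
  have hmem : ∀ x ∈ Set.Icc a b, x - a ∈ Set.Icc 0 Real.pi := fun x hx =>
    ⟨by linarith [hx.1], by linarith [hx.2]⟩
  have n1 := norm_integral_mul_le (j := j) ψ (τ := fun x => ((τ'' (x - a) : ℝ) : ℂ))
    (C := max 0 (max C1 C2)) (fun x hx => by
      rw [Complex.norm_real]
      exact (hC2 _ (hmem x hx)).trans ((le_max_right _ _).trans (le_max_right _ _)))
  have n2 := norm_integral_mul_le (j := j) f (τ := fun x => ((τ (x - a) : ℝ) : ℂ))
    (C := max 0 (max C1 C2)) (fun x hx => by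
      rw [Complex.norm_real]
      exact (hC1 _ (hmem x hx)).trans ((le_max_left _ _).trans (le_max_right _ _)))
  have e' : u a * τ' 0 - p a * τ 0 =
      -((∫ x in a..b, ((τ'' (x - a) : ℝ) : ℂ) * ψ x) + ∫ x in a..b, ((τ (x - a) : ℝ) : ℂ) * f x) := by
    rw [e]; push_cast; ring
  rw [e', norm_neg, mul_add]
  exact (norm_add_le _ _).trans (add_le_add n1 n2)

lemma hasDerivAt_cubic (a b c d x : ℝ) :
    HasDerivAt (fun y : ℝ => a + b * y + c * y ^ 2 + d * y ^ 3) (b + 2 * c * x + 3 * d * x ^ 2) x := by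
  have h := (((hasDerivAt_const x a).fun_add ((hasDerivAt_id x).const_mul b)).fun_add
    ((hasDerivAt_pow 2 x).const_mul c)).fun_add ((hasDerivAt_pow 3 x).const_mul d)
  refine h.congr_deriv ?_
  norm_num
  ring

/-- The boundary values of a function of class `H²` are controlled on every edge. -/
lemma exists_trace_bound : ∃ C : ℝ, 0 ≤ C ∧ ∀ (j : ℤ) (ψ f : L2R) (u p : ℝ → ℂ),
    LineEdge j ψ f u p → ‖u (vx j)‖ ≤ C * (edgeL1 ψ j + edgeL1 f j) ∧
      ‖p (vx j)‖ ≤ C * (edgeL1 ψ j + edgeL1 f j) := by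
  have hpi := Real.pi_ne_zero
  have hd : ∀ b c d x : ℝ, HasDerivAt (fun y : ℝ => b + 2 * c * y + 3 * d * y ^ 2)
      (2 * c + 6 * d * x) x := by
    intro b c d x
    refine ((hasDerivAt_cubic b (2 * c) (3 * d) 0 x).congr_deriv (by ring)).congr_of_eventuallyEq ?_
    exact Filter.Eventually.of_forall fun y => by ring
  -- Both cubics are the Hermite polynomials with a double zero at `π`. The first, `y (1 - y/π)²`,
  -- has value `0` and slope `1` at `0` and isolates `u (vx j)`; the second has value `1` and slope
  -- `0` and isolates `p (vx j)`.
  obtain ⟨C1, hC1, h1⟩ := exists_boundary_bound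
    (hasDerivAt_cubic 0 1 (-2 / Real.pi) (1 / Real.pi ^ 2))
    (hd 1 (-2 / Real.pi) (1 / Real.pi ^ 2))
    (by fun_prop) (by field_simp; ring) (by field_simp; ring)
  obtain ⟨C2, hC2, h2⟩ := exists_boundary_bound
    (hasDerivAt_cubic 1 0 (-3 / Real.pi ^ 2) (2 / Real.pi ^ 3))
    (hd 0 (-3 / Real.pi ^ 2) (2 / Real.pi ^ 3))
    (by fun_prop) (by field_simp; ring) (by field_simp; ring)
  refine ⟨C1 + C2, by positivity, fun j ψ f u p h => ?_⟩
  have n : 0 ≤ edgeL1 ψ j + edgeL1 f j := add_nonneg (edgeL1_nonneg _ _) (edgeL1_nonneg _ _)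
  have e1 := h1 j ψ f u p h
  have e2 := h2 j ψ f u p h
  norm_num at e1 e2
  constructor <;> nlinarith

end

noncomputable section

/-! ### The two parts of the operator on the line -/

/-- The graph of `-d²/dx²` on the line with `δ`-couplings of strength `β` at all vertices. -/
def KPGraph (β : ℝ) (ψ f : L2R) : Prop :=
  ∃ u p : ℤ → ℝ → ℂ, (∀ j, LineEdge j ψ f (u j) (p j)) ∧
    (∀ j, u (j + 1) (vx (j + 1)) = u j (vx (j + 1))) ∧
    (∀ j, p (j + 1) (vx (j + 1)) = p j (vx (j + 1)) + β * u j (vx (j + 1)))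

/-- The graph of `-d²/dx²` on the line with Dirichlet conditions at all vertices. -/
def DirGraph (ψ f : L2R) : Prop :=
  ∃ u p : ℤ → ℝ → ℂ, (∀ j, LineEdge j ψ f (u j) (p j)) ∧
    (∀ j, u j (vx j) = 0 ∧ u j (vx (j + 1)) = 0)

/-- The Wronskian of two edge functions. -/
def edgeW (u p v q : ℝ → ℂ) (x : ℝ) : ℂ :=
  starRingEnd ℂ (u x) * q x - starRingEnd ℂ (p x) * v x

lemma LineEdge.green {j : ℤ} {ψ f φ g : L2R} {u p v q : ℝ → ℂ} (h : LineEdge j ψ f u p)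
    (h' : LineEdge j φ g v q) :
    (∫ x in vx j..vx (j + 1), starRingEnd ℂ (f x) * φ x) -
      (∫ x in vx j..vx (j + 1), starRingEnd ℂ (ψ x) * g x) =
      edgeW u p v q (vx (j + 1)) - edgeW u p v q (vx j) := by
  have hab := vx_le_succ j
  have hi : ∀ a b : L2R,
      IntervalIntegrable (fun x => starRingEnd ℂ (a x) * b x) volume (vx j) (vx (j + 1)) := by
    intro a b
    have h1 := (L2.integrable_inner (𝕜 := ℂ) a b).intervalIntegrable (a := vx j) (b := vx (j + 1))
    simpa only [RCLike.inner_apply, mul_comm] using h1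
  rw [← intervalIntegral.integral_sub (hi f φ) (hi ψ g)]
  have h1 : IsPrim (vx j) (vx (j + 1)) (edgeW u p v q)
      (fun x => starRingEnd ℂ (f x) * φ x - starRingEnd ℂ (ψ x) * g x) := by
    refine ((h.prim_u.conj.mul hab h'.prim_p).add
      ((h.prim_p.conj.mul hab h'.prim_u).const_mul (-1))).congr hab (fun x _ => ?_) ?_
    · simp only [edgeW]; ring
    · filter_upwards [h.ae_eq, h'.ae_eq] with x hx hx' hm
      rw [hx hm, hx' hm, map_neg]
      ring
  exact h1.integral_eq hab

/-- On each edge Green's identity leaves a difference of Wronskians. The jump terms cancel at the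
vertices because `β` is real, so the sum over the edges telescopes; the trace bound makes the
Wronskians summable, and the total is zero. -/
lemma KPGraph.symm {β : ℝ} {ψ f φ g : L2R} (h : KPGraph β ψ f) (h' : KPGraph β φ g) :
    inner ℂ f φ = inner ℂ ψ g := by
  obtain ⟨u, p, h1, h2, h3⟩ := h
  obtain ⟨v, q, h1', h2', h3'⟩ := h'
  set w : ℤ → ℂ := fun j => edgeW (u j) (p j) (v j) (q j) (vx j) with hw
  have hD : ∀ j, (∫ x in vx j..vx (j + 1), starRingEnd ℂ (f x) * φ x) -
      (∫ x in vx j..vx (j + 1), starRingEnd ℂ (ψ x) * g x) = w (j + 1) - w j := by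
    intro j
    rw [(h1 j).green (h1' j)]
    congr 1
    simp only [hw, edgeW, h2, h2', h3, h3', map_add, map_mul, Complex.conj_ofReal]
    ring
  obtain ⟨C, hC, ht⟩ := exists_trace_bound
  set B : ℤ → ℝ := fun j => C * (edgeL1 ψ j + edgeL1 f j)
  set B' : ℤ → ℝ := fun j => C * (edgeL1 φ j + edgeL1 g j)
  have hB : Summable fun j => B j ^ 2 :=
    sq_summable_const_mul C (sq_summable_add (summable_edgeL1_sq ψ) (summable_edgeL1_sq f))
  have hB' : Summable fun j => B' j ^ 2 :=
    sq_summable_const_mul C (sq_summable_add (summable_edgeL1_sq φ) (summable_edgeL1_sq g))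
  have hws : Summable w := by
    refine Summable.of_norm_bounded (hB.add hB') fun j => ?_
    obtain ⟨a1, a2⟩ := ht j ψ f _ _ (h1 j)
    obtain ⟨b1, b2⟩ := ht j φ g _ _ (h1' j)
    calc ‖w j‖ ≤ ‖u j (vx j)‖ * ‖q j (vx j)‖ + ‖p j (vx j)‖ * ‖v j (vx j)‖ := by
          refine (norm_sub_le _ _).trans (le_of_eq ?_)
          rw [norm_mul, norm_mul, RCLike.norm_conj, RCLike.norm_conj]
      _ ≤ B j * B' j + B j * B' j := by
          have n1 := norm_nonneg (u j (vx j))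
          have n2 := norm_nonneg (p j (vx j))
          exact add_le_add (mul_le_mul a1 b2 (norm_nonneg _) (n1.trans a1))
            (mul_le_mul a2 b1 (norm_nonneg _) (n2.trans a2))
      _ ≤ B j ^ 2 + B' j ^ 2 := by nlinarith [sq_nonneg (B j - B' j)]
  have hs := (hasSum_inner_edges f φ).sub (hasSum_inner_edges ψ g)
  simp only [hD] at hs
  have hs2 : HasSum (fun j => w (j + 1) - w j) (∑' j, w j - ∑' j, w j) :=
    ((Equiv.addRight (1 : ℤ)).hasSum_iff.2 hws.hasSum).sub hws.hasSum
  rw [sub_self] at hs2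
  exact sub_eq_zero.1 (hs.unique hs2)

lemma DirGraph.symm {ψ f φ g : L2R} (h : DirGraph ψ f) (h' : DirGraph φ g) :
    inner ℂ f φ = inner ℂ ψ g := by
  obtain ⟨u, p, h1, h2⟩ := h
  obtain ⟨v, q, h1', h2'⟩ := h'
  have hs := (hasSum_inner_edges f φ).sub (hasSum_inner_edges ψ g)
  have hD : ∀ j, (∫ x in vx j..vx (j + 1), starRingEnd ℂ (f x) * φ x) -
      (∫ x in vx j..vx (j + 1), starRingEnd ℂ (ψ x) * g x) = 0 := by
    intro j
    rw [(h1 j).green (h1' j)]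
    simp [edgeW, h2, h2']
  simp only [hD] at hs
  exact sub_eq_zero.1 (hs.unique hasSum_zero)

/-! ### Solving the edge equations -/

/-- A bound for the fundamental system on an edge. -/
def solBound (k : ℂ) : ℝ := Real.exp (‖k‖ * Real.pi) * (1 + Real.pi)

lemma solBound_pos (k : ℂ) : 0 < solBound k := by
  have := Real.pi_pos
  unfold solBound; positivity

lemma norm_cosK_le_solBound (k : ℂ) {x : ℝ} (hx : x ∈ Set.Icc 0 Real.pi) :
    ‖cosK k x‖ ≤ solBound k := by
  refine (norm_cosK_le k x).trans ?_
  rw [abs_of_nonneg hx.1]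
  have h1 : Real.exp (‖k‖ * x) ≤ Real.exp (‖k‖ * Real.pi) :=
    Real.exp_le_exp.2 (mul_le_mul_of_nonneg_left hx.2 (norm_nonneg k))
  unfold solBound
  nlinarith [Real.exp_pos (‖k‖ * Real.pi), Real.pi_pos]

lemma norm_sinK_le_solBound (k : ℂ) {x : ℝ} (hx : x ∈ Set.Icc 0 Real.pi) :
    ‖sinK k x‖ ≤ solBound k := by
  refine (norm_sinK_le k x).trans ?_
  rw [abs_of_nonneg hx.1]
  have h1 : Real.exp (‖k‖ * x) ≤ Real.exp (‖k‖ * Real.pi) :=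
    Real.exp_le_exp.2 (mul_le_mul_of_nonneg_left hx.2 (norm_nonneg k))
  unfold solBound
  have h2 := mul_le_mul h1 hx.2 hx.1 (Real.exp_pos _).le
  nlinarith [Real.exp_pos (‖k‖ * Real.pi)]

lemma sub_vx_mem {j : ℤ} {x : ℝ} (hx : x ∈ Set.Icc (vx j) (vx (j + 1))) :
    x - vx j ∈ Set.Icc 0 Real.pi := by
  rw [vx_succ] at hx
  exact ⟨by linarith [hx.1], by linarith [hx.2]⟩

lemma norm_integral_edge_part_le {j : ℤ} {g : ℝ → ℂ}
    (hg : IntervalIntegrable g volume (vx j) (vx (j + 1))) {τ : ℝ → ℂ} {C : ℝ}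
    (hτ : ∀ x ∈ Set.Icc (vx j) (vx (j + 1)), ‖τ x‖ ≤ C) {x : ℝ}
    (hx : x ∈ Set.Icc (vx j) (vx (j + 1))) :
    ‖∫ t in vx j..x, g t * τ t‖ ≤ C * edgeL1 g j := by
  have hC : 0 ≤ C := (norm_nonneg _).trans (hτ x hx)
  have hsub : Set.uIcc (vx j) x ⊆ Set.uIcc (vx j) (vx (j + 1)) := by
    rw [Set.uIcc_of_le hx.1, Set.uIcc_of_le (vx_le_succ j)]
    exact Set.Icc_subset_Icc_right hx.2
  calc ‖∫ t in vx j..x, g t * τ t‖ ≤ ∫ t in vx j..x, C * ‖g t‖ := by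
        refine intervalIntegral.norm_integral_le_of_norm_le hx.1 ?_
          ((hg.mono_set hsub).norm.const_mul C)
        refine Filter.Eventually.of_forall fun t ht => ?_
        rw [norm_mul, mul_comm]
        exact mul_le_mul_of_nonneg_right (hτ t ⟨ht.1.le, ht.2.trans hx.2⟩) (norm_nonneg _)
    _ ≤ C * edgeL1 g j := by
        rw [intervalIntegral.integral_const_mul]
        refine mul_le_mul_of_nonneg_left ?_ hC
        exact intervalIntegral.integral_mono_interval le_rfl hx.1 hx.2
          (Filter.Eventually.of_forall fun _ => norm_nonneg _) hg.norm

lemma norm_solU_le {k : ℂ} {j : ℤ} {g : ℝ → ℂ}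
    (hg : IntervalIntegrable g volume (vx j) (vx (j + 1))) (x₀ y₀ : ℂ) {x : ℝ}
    (hx : x ∈ Set.Icc (vx j) (vx (j + 1))) :
    ‖solU k (vx j) x₀ y₀ g x‖ ≤
      (solBound k + 2 * solBound k ^ 2) * (‖x₀‖ + ‖y₀‖ + edgeL1 g j) := by
  set K := solBound k with hK
  have hK0 : 0 < K := solBound_pos k
  set e := edgeL1 g j with he
  have he0 : 0 ≤ e := edgeL1_nonneg g j
  have h1 := norm_integral_edge_part_le hg (τ := fun t => sinK k (t - vx j)) (C := K)
    (fun t ht => norm_sinK_le_solBound k (sub_vx_mem ht)) hx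
  have h2 := norm_integral_edge_part_le hg (τ := fun t => cosK k (t - vx j)) (C := K)
    (fun t ht => norm_cosK_le_solBound k (sub_vx_mem ht)) hx
  have h3 := norm_cosK_le_solBound k (sub_vx_mem hx)
  have h4 := norm_sinK_le_solBound k (sub_vx_mem hx)
  rw [solU, intervalIntegral.integral_neg]
  have n1 : ‖x₀ + ∫ t in vx j..x, g t * sinK k (t - vx j)‖ ≤ ‖x₀‖ + K * e :=
    (norm_add_le _ _).trans (by gcongr)
  have n2 : ‖y₀ + -∫ t in vx j..x, g t * cosK k (t - vx j)‖ ≤ ‖y₀‖ + K * e :=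
    (norm_add_le _ _).trans (by rw [norm_neg]; gcongr)
  calc _ ≤ (‖x₀‖ + K * e) * K + (‖y₀‖ + K * e) * K := by
        refine (norm_add_le _ _).trans ?_
        rw [norm_mul, norm_mul]
        gcongr
    _ ≤ _ := by nlinarith [norm_nonneg x₀, norm_nonneg y₀, mul_nonneg hK0.le he0, sq_nonneg K,
        mul_nonneg (sq_nonneg K) (norm_nonneg x₀), mul_nonneg (sq_nonneg K) (norm_nonneg y₀)]

/-- The coefficient integrals of variation of constants over one edge. -/
def edgeS (k : ℂ) (g : ℝ → ℂ) (j : ℤ) : ℂ := ∫ t in vx j..vx (j + 1), g t * sinK k (t - vx j)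

/-- The coefficient integrals of variation of constants over one edge. -/
def edgeC (k : ℂ) (g : ℝ → ℂ) (j : ℤ) : ℂ := ∫ t in vx j..vx (j + 1), -(g t * cosK k (t - vx j))

lemma norm_edgeS_le (k : ℂ) (g : L2R) (j : ℤ) : ‖edgeS k g j‖ ≤ solBound k * edgeL1 g j :=
  norm_integral_edge_part_le (L2R.intervalIntegrable g _ _)
    (fun _ ht => norm_sinK_le_solBound k (sub_vx_mem ht)) (Set.right_mem_Icc.2 (vx_le_succ j))

lemma norm_edgeC_le (k : ℂ) (g : L2R) (j : ℤ) : ‖edgeC k g j‖ ≤ solBound k * edgeL1 g j := by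
  rw [edgeC, intervalIntegral.integral_neg, norm_neg]
  exact norm_integral_edge_part_le (L2R.intervalIntegrable g _ _)
    (fun _ ht => norm_cosK_le_solBound k (sub_vx_mem ht)) (Set.right_mem_Icc.2 (vx_le_succ j))

lemma sq_summable_norm_of_le {y : ℤ → ℂ} {C : ℤ → ℝ} (hC : Summable fun j => C j ^ 2)
    (h : ∀ j, ‖y j‖ ≤ C j) : Summable fun j => ‖y j‖ ^ 2 :=
  sq_summable_of_le hC (fun _ => norm_nonneg _) h

lemma solU_left (k : ℂ) (a : ℝ) (x₀ y₀ : ℂ) (g : ℝ → ℂ) : solU k a x₀ y₀ g a = x₀ := by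
  simp [solU]

lemma solP_left (k : ℂ) (a : ℝ) (x₀ y₀ : ℂ) (g : ℝ → ℂ) : solP k a x₀ y₀ g a = y₀ := by
  simp [solP]

lemma solU_right (k : ℂ) (j : ℤ) (x₀ y₀ : ℂ) (g : ℝ → ℂ) :
    solU k (vx j) x₀ y₀ g (vx (j + 1)) =
      (x₀ + edgeS k g j) * cosK k Real.pi + (y₀ + edgeC k g j) * sinK k Real.pi := by
  rw [solU, edgeS, edgeC, vx_succ, add_sub_cancel_left]

lemma solP_right (k : ℂ) (j : ℤ) (x₀ y₀ : ℂ) (g : ℝ → ℂ) :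
    solP k (vx j) x₀ y₀ g (vx (j + 1)) =
      -(k ^ 2 * sinK k Real.pi) * (x₀ + edgeS k g j) + cosK k Real.pi * (y₀ + edgeC k g j) := by
  rw [solP, edgeS, edgeC, vx_succ, add_sub_cancel_left]

lemma coeFn_smul_add (c : ℂ) (ψ g : L2R) : ∀ᵐ x, (c • ψ + g : L2R) x = c * ψ x + g x := by
  filter_upwards [Lp.coeFn_add (c • ψ) g, Lp.coeFn_smul c ψ] with x h1 h2
  rw [h1, Pi.add_apply, h2, Pi.smul_apply, smul_eq_mul]

/-- Square summable initial data give an `L²`-solution of the edge equations. -/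
lemma exists_lineEdge (k : ℂ) (g : L2R) {X Y : ℤ → ℂ} (hX : Summable fun j => ‖X j‖ ^ 2)
    (hY : Summable fun j => ‖Y j‖ ^ 2) :
    ∃ ψ : L2R, ∀ j, LineEdge j ψ (k ^ 2 • ψ + g : L2R) (solU k (vx j) (X j) (Y j) g)
      (solP k (vx j) (X j) (Y j) g) := by
  have hab := vx_le_succ
  have hg : ∀ j, IntervalIntegrable g volume (vx j) (vx (j + 1)) :=
    fun j => L2R.intervalIntegrable g _ _
  obtain ⟨ψ, hψ⟩ := exists_L2R_of_edges (u := fun j => solU k (vx j) (X j) (Y j) g)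
    (fun j => (isPrim_solU (hab j) (hg j) (X j) (Y j)).continuousOn (hab j))
    (fun j x hx => norm_solU_le (hg j) (X j) (Y j) hx)
    (sq_summable_const_mul _ (sq_summable_add (sq_summable_add hX hY) (summable_edgeL1_sq g)))
  refine ⟨ψ, fun j => ⟨hψ j, isPrim_solU (hab j) (hg j) _ _,
    (isPrim_solP (hab j) (hg j) _ _).congr (hab j) (fun x _ => rfl) ?_⟩⟩
  filter_upwards [coeFn_smul_add (k ^ 2) ψ g, hψ j] with x h1 h2 hx
  rw [h1, h2 hx]

lemma LineEdge.eq_sol {k : ℂ} {j : ℤ} {ψ g : L2R} {u p : ℝ → ℂ}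
    (h : LineEdge j ψ (k ^ 2 • ψ + g : L2R) u p) : ∀ x ∈ Set.Icc (vx j) (vx (j + 1)),
      u x = solU k (vx j) (u (vx j)) (p (vx j)) g x ∧
      p x = solP k (vx j) (u (vx j)) (p (vx j)) g x := by
  refine _root_.eq_sol (vx_le_succ j) h.prim_u (h.prim_p.congr (vx_le_succ j) (fun x _ => rfl) ?_)
  filter_upwards [coeFn_smul_add (k ^ 2) ψ g, h.ae_eq] with x h1 h2 hx
  rw [h1, h2 hx]

lemma LineEdge.right_eq {k : ℂ} {j : ℤ} {ψ g : L2R} {u p : ℝ → ℂ}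
    (h : LineEdge j ψ (k ^ 2 • ψ + g : L2R) u p) :
    u (vx (j + 1)) = (u (vx j) + edgeS k g j) * cosK k Real.pi +
      (p (vx j) + edgeC k g j) * sinK k Real.pi ∧
    p (vx (j + 1)) = -(k ^ 2 * sinK k Real.pi) * (u (vx j) + edgeS k g j) +
      cosK k Real.pi * (p (vx j) + edgeC k g j) := by
  obtain ⟨h1, h2⟩ := h.eq_sol (vx (j + 1)) (Set.right_mem_Icc.2 (vx_le_succ j))
  rw [solU_right] at h1
  rw [solP_right] at h2
  exact ⟨h1, h2⟩

/-- The discriminant of the periodic problem: half the trace of the monodromy matrix. -/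
def discr (β : ℝ) (k : ℂ) : ℂ := cosK k Real.pi + β / 2 * sinK k Real.pi

/-- The data `(X, Y)` to the right of the vertices must satisfy `(X, Y)_{j+1} = M ((X, Y)_j + (S,
C)_j)`, where `M` has rows `(c, s)` and `(-k² s + β c, c + β s)`, determinant `1` and trace `2 *
discr β k`. By Cayley–Hamilton `M + M⁻¹ = tr M`, which reduces the first-order system to the scalar
second-order equation for each component. -/
theorem KPGraph.exists_of_discr {β : ℝ} {k : ℂ} (hF : ∀ t : ℝ, |t| ≤ 1 → discr β k ≠ t) (g : L2R) :
    ∃ ψ : L2R, KPGraph β ψ (k ^ 2 • ψ + g) := by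
  set c := cosK k Real.pi with hc
  set s := sinK k Real.pi with hs
  have hcs : c ^ 2 + k ^ 2 * s ^ 2 = 1 := cosK_sq_add k Real.pi
  have hFd : 2 * discr β k = 2 * c + β * s := by simp only [discr]; ring
  set S := edgeS k g with hS
  set C := edgeC k g with hC
  have hSs : Summable fun j => ‖S j‖ ^ 2 :=
    sq_summable_norm_of_le (sq_summable_const_mul (solBound k) (summable_edgeL1_sq g))
      (norm_edgeS_le k g)
  have hCs : Summable fun j => ‖C j‖ ^ 2 :=
    sq_summable_norm_of_le (sq_summable_const_mul (solBound k) (summable_edgeL1_sq g))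
      (norm_edgeC_le k g)
  have hlin : ∀ (x y : ℤ → ℂ) (a b : ℂ), (Summable fun j => ‖x j‖ ^ 2) →
      (Summable fun j => ‖y j‖ ^ 2) → Summable fun j => ‖a * x j + b * y j‖ ^ 2 := by
    intro x y a b hx hy
    refine sq_summable_norm_of_le (C := fun j => ‖a‖ * ‖x j‖ + ‖b‖ * ‖y j‖)
      (sq_summable_add (sq_summable_const_mul _ hx) (sq_summable_const_mul _ hy)) fun j => ?_
    rw [← norm_mul, ← norm_mul]
    exact norm_add_le _ _
  obtain ⟨w₁, hw₁, e₁⟩ := exists_sq_summable_second_order hF (hlin S C c s hSs hCs)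
  obtain ⟨w₂, hw₂, e₂⟩ := exists_sq_summable_second_order hF
    (hlin S C (-(k ^ 2 * s) + β * c) (c + β * s) hSs hCs)
  have hshift : ∀ w : ℤ → ℂ, (Summable fun j => ‖w j‖ ^ 2) → Summable fun j => ‖w (j - 1)‖ ^ 2 :=
    fun w hw => (Equiv.subRight (1 : ℤ)).summable_iff.2 hw
  -- The data are `w_j - M⁻¹ w_{j-1}`: if `w_{j+1} + w_{j-1} - (tr M) w_j = M (S, C)_j`, this
  -- sequence solves the first-order system.
  set X : ℤ → ℂ := fun j => 1 * w₁ j + (-1) * ((c + β * s) * w₁ (j - 1) + (-s) * w₂ (j - 1)) with hX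
  set Y : ℤ → ℂ := fun j => 1 * w₂ j + (-1) * ((k ^ 2 * s - β * c) * w₁ (j - 1) + c * w₂ (j - 1))
    with hY
  have hXs : Summable fun j => ‖X j‖ ^ 2 :=
    hlin _ _ _ _ hw₁ (hlin _ _ _ _ (hshift _ hw₁) (hshift _ hw₂))
  have hYs : Summable fun j => ‖Y j‖ ^ 2 :=
    hlin _ _ _ _ hw₂ (hlin _ _ _ _ (hshift _ hw₁) (hshift _ hw₂))
  have r1 : ∀ j, X (j + 1) = (X j + S j) * c + (Y j + C j) * s := by
    intro j
    have h1 := e₁ j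
    rw [hFd] at h1
    simp only [hX, hY, add_sub_cancel_right]
    linear_combination h1 + w₁ (j - 1) * hcs
  have r2 : ∀ j, Y (j + 1) = (-(k ^ 2 * s) * (X j + S j) + c * (Y j + C j)) + β * X (j + 1) := by
    intro j
    have h2 := e₂ j
    rw [hFd] at h2
    rw [r1]
    simp only [hX, hY, add_sub_cancel_right]
    linear_combination h2 + w₂ (j - 1) * hcs
  obtain ⟨ψ, hψ⟩ := exists_lineEdge k g hXs hYs
  refine ⟨ψ, _, _, hψ, fun j => ?_, fun j => ?_⟩
  · rw [solU_left, solU_right, r1]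
  · rw [solP_left, solP_right, solU_right, r2, r1]

theorem DirGraph.exists_of_sinK_ne_zero {k : ℂ} (hk : sinK k Real.pi ≠ 0) (g : L2R) :
    ∃ ψ : L2R, DirGraph ψ (k ^ 2 • ψ + g) := by
  set c := cosK k Real.pi with hc
  set s := sinK k Real.pi with hs
  set Y : ℤ → ℂ := fun j => -(edgeS k g j * c + edgeC k g j * s) / s with hY
  have hYs : Summable fun j => ‖Y j‖ ^ 2 := by
    refine sq_summable_norm_of_le
      (C := fun j => ((solBound k * ‖c‖ + solBound k * ‖s‖) / ‖s‖) * edgeL1 g j)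
      (sq_summable_const_mul _ (summable_edgeL1_sq g)) fun j => ?_
    have h1 := norm_edgeS_le k g j
    have h2 := norm_edgeC_le k g j
    simp only [hY]
    rw [norm_div, norm_neg, div_mul_eq_mul_div]
    gcongr
    refine (norm_add_le _ _).trans ?_
    rw [norm_mul, norm_mul]
    nlinarith [norm_nonneg c, norm_nonneg s]
  obtain ⟨ψ, hψ⟩ := exists_lineEdge k g (X := fun _ => 0) (Y := Y) (by simp) hYs
  refine ⟨ψ, _, _, hψ, fun j => ⟨solU_left _ _ _ _ _, ?_⟩⟩
  rw [solU_right]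
  simp only [hY, ← hc, ← hs]
  field_simp
  ring

end

noncomputable section

/-! ### The discriminant in `[-1, 1]` -/

/-- Cayley–Hamilton for the transfer matrix: its determinant is `1` by `cosK_sq_add`, and its trace
is `2 * discr β k`. -/
lemma recursion_of_transfer {β : ℝ} {k : ℂ} {a b : ℤ → ℂ} {j : ℤ}
    (h : ∀ i, i = j ∨ i = j + 1 → a (i + 1) = a i * cosK k Real.pi + b i * sinK k Real.pi ∧
      b (i + 1) = -(k ^ 2 * sinK k Real.pi) * a i + cosK k Real.pi * b i + β * a (i + 1)) :
    a (j + 2) + a j = 2 * discr β k * a (j + 1) ∧ b (j + 2) + b j = 2 * discr β k * b (j + 1) := by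
  have hcs := cosK_sq_add k Real.pi
  obtain ⟨h1, h2⟩ := h j (Or.inl rfl)
  obtain ⟨h3, h4⟩ := h (j + 1) (Or.inr rfl)
  rw [add_assoc, one_add_one_eq_two] at h3 h4
  simp only [discr]
  set c := cosK k Real.pi
  set s := sinK k Real.pi
  constructor
  · rw [h3, h2, h1]
    linear_combination (-a j) * hcs
  · rw [h4, h3, h2, h1]
    linear_combination (-b j) * hcs

lemma tendsto_norm_of_sq_summable {y : ℤ → ℂ} (hy : Summable fun j => ‖y j‖ ^ 2) :
    Filter.Tendsto y Filter.cofinite (nhds 0) := by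
  have h1 := hy.tendsto_cofinite_zero
  have h2 := h1.sqrt
  simp only [Real.sqrt_sq (norm_nonneg _), Real.sqrt_zero] at h2
  exact tendsto_zero_iff_norm_tendsto_zero.2 h2

lemma tendsto_int_atTop_of_sq_summable {y : ℤ → ℂ} (hy : Summable fun j => ‖y j‖ ^ 2) {φ : ℕ → ℤ}
    (hφ : Function.Injective φ) :
    Filter.Tendsto (fun n => y (φ n)) Filter.atTop (nhds 0) := by
  have := (tendsto_norm_of_sq_summable hy).comp hφ.tendsto_cofinite
  rwa [Nat.cofinite_eq_atTop] at this

/-- The vertex data of an `L²`-solution vanish outside of the support of the right-hand side. -/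
lemma vertex_data_eq_zero {β : ℝ} {k : ℂ} {F : ℝ} (hF : |F| ≤ 1) (hk : discr β k = F) {a b : ℤ → ℂ}
    (ha : Summable fun j => ‖a j‖ ^ 2) (hb : Summable fun j => ‖b j‖ ^ 2)
    (h : ∀ i, i ≠ 0 → a (i + 1) = a i * cosK k Real.pi + b i * sinK k Real.pi ∧
      b (i + 1) = -(k ^ 2 * sinK k Real.pi) * a i + cosK k Real.pi * b i + β * a (i + 1)) (j : ℤ) :
    a j = 0 ∧ b j = 0 := by
  have i1 : Function.Injective (fun n : ℕ => (n : ℤ) + 1) := fun m n hmn => by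
    simpa using hmn
  have i2 : Function.Injective (fun n : ℕ => -(n : ℤ)) := fun m n hmn => by
    simpa using hmn
  -- The recursion at `i` uses the edges `i` and `i + 1`, and only edge `0` is excluded. The
  -- half-line sequences starting at the vertices `1` and `0` together cover all vertices.
  have hrec : ∀ i : ℤ, 1 ≤ i ∨ i ≤ -2 → a (i + 2) + a i = 2 * F * a (i + 1) ∧
      b (i + 2) + b i = 2 * F * b (i + 1) := by
    intro i hi
    rw [← hk]
    refine recursion_of_transfer fun m hm => h m ?_
    omega
  have right : ∀ n : ℕ, a (n + 1) = 0 ∧ b (n + 1) = 0 := by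
    intro n
    constructor
    · refine eq_zero_of_recursion_of_tendsto hF (y := fun n : ℕ => a (n + 1)) (fun m => ?_)
        (tendsto_int_atTop_of_sq_summable ha i1) n
      have := (hrec (m + 1) (Or.inl (by omega))).1
      push_cast
      rwa [add_right_comm] at this
    · refine eq_zero_of_recursion_of_tendsto hF (y := fun n : ℕ => b (n + 1)) (fun m => ?_)
        (tendsto_int_atTop_of_sq_summable hb i1) n
      have := (hrec (m + 1) (Or.inl (by omega))).2
      push_cast
      rwa [add_right_comm] at this
  have left : ∀ n : ℕ, a (-n) = 0 ∧ b (-n) = 0 := by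
    intro n
    constructor
    · refine eq_zero_of_recursion_of_tendsto hF (y := fun n : ℕ => a (-n)) (fun m => ?_)
        (tendsto_int_atTop_of_sq_summable ha i2) n
      have := (hrec (-m - 2) (Or.inr (by omega))).1
      push_cast
      rw [show -(m : ℤ) - 2 + 2 = -m by ring, show -(m : ℤ) - 2 + 1 = -(m + 1) by ring,
        show -(m : ℤ) - 2 = -(m + 2) by ring, add_comm] at this
      exact this
    · refine eq_zero_of_recursion_of_tendsto hF (y := fun n : ℕ => b (-n)) (fun m => ?_)
        (tendsto_int_atTop_of_sq_summable hb i2) n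
      have := (hrec (-m - 2) (Or.inr (by omega))).2
      push_cast
      rw [show -(m : ℤ) - 2 + 2 = -m by ring, show -(m : ℤ) - 2 + 1 = -(m + 1) by ring,
        show -(m : ℤ) - 2 = -(m + 2) by ring, add_comm] at this
      exact this
  rcases le_or_gt j 0 with hj | hj
  · obtain ⟨n, hn⟩ := Int.eq_ofNat_of_zero_le (neg_nonneg.2 hj)
    have := left n
    rwa [← hn, neg_neg] at this
  · obtain ⟨n, hn⟩ := Int.eq_ofNat_of_zero_le (show 0 ≤ j - 1 by omega)
    have := right n
    rwa [← hn, sub_add_cancel] at this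

lemma edge_data_sq_summable {ψ f : L2R} {u p : ℤ → ℝ → ℂ} (h : ∀ j, LineEdge j ψ f (u j) (p j)) :
    (Summable fun j => ‖u j (vx j)‖ ^ 2) ∧ Summable fun j => ‖p j (vx j)‖ ^ 2 := by
  obtain ⟨C, -, ht⟩ := exists_trace_bound
  have hB : Summable fun j => (C * (edgeL1 ψ j + edgeL1 f j)) ^ 2 :=
    sq_summable_const_mul C (sq_summable_add (summable_edgeL1_sq ψ) (summable_edgeL1_sq f))
  exact ⟨sq_summable_norm_of_le hB fun j => (ht j ψ f _ _ (h j)).1,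
    sq_summable_norm_of_le hB fun j => (ht j ψ f _ _ (h j)).2⟩

lemma edgeS_eq_zero {k : ℂ} {g : ℝ → ℂ} {j : ℤ}
    (hg : ∀ᵐ x, x ∈ Set.Icc (vx j) (vx (j + 1)) → g x = 0) : edgeS k g j = 0 := by
  rw [edgeS, intervalIntegral.integral_congr_ae (g := fun _ => 0)]
  · simp
  · filter_upwards [hg] with x hx hx'
    rw [Set.uIoc_of_le (vx_le_succ j)] at hx'
    rw [hx (Set.Ioc_subset_Icc_self hx'), zero_mul]

lemma edgeC_eq_zero {k : ℂ} {g : ℝ → ℂ} {j : ℤ}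
    (hg : ∀ᵐ x, x ∈ Set.Icc (vx j) (vx (j + 1)) → g x = 0) : edgeC k g j = 0 := by
  rw [edgeC, intervalIntegral.integral_congr_ae (g := fun _ => 0)]
  · simp
  · filter_upwards [hg] with x hx hx'
    rw [Set.uIoc_of_le (vx_le_succ j)] at hx'
    rw [hx (Set.Ioc_subset_Icc_self hx'), zero_mul, neg_zero]

/-- If the right-hand side is supported on a single edge, it satisfies two solvability
conditions. -/
lemma KPGraph.data_eq_zero {β : ℝ} {k : ℂ} {F : ℝ} (hF : |F| ≤ 1) (hk : discr β k = F) {ψ g : L2R}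
    {u p : ℤ → ℝ → ℂ} (h1 : ∀ j, LineEdge j ψ (k ^ 2 • ψ + g : L2R) (u j) (p j))
    (h2 : ∀ j, u (j + 1) (vx (j + 1)) = u j (vx (j + 1)))
    (h3 : ∀ j, p (j + 1) (vx (j + 1)) = p j (vx (j + 1)) + β * u j (vx (j + 1)))
    (hg : ∀ j, j ≠ 0 → ∀ᵐ x, x ∈ Set.Icc (vx j) (vx (j + 1)) → g x = 0) (j : ℤ) :
    u j (vx j) = 0 ∧ p j (vx j) = 0 := by
  obtain ⟨ha, hb⟩ := edge_data_sq_summable h1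
  refine vertex_data_eq_zero hF hk (a := fun j => u j (vx j)) (b := fun j => p j (vx j)) ha hb
    (fun i hi => ?_) j
  obtain ⟨e1, e2⟩ := (h1 i).right_eq
  rw [edgeS_eq_zero (hg i hi), edgeC_eq_zero (hg i hi), add_zero, add_zero] at e1 e2
  rw [h3, h2, e2, e1]
  exact ⟨rfl, rfl⟩

/-- The right-hand side is the conjugate of `cosK` on edge `0` and zero elsewhere. All vertex data
of a solution vanish, so the invertible transfer over edge `0` forces both `edgeS k g 0` and `edgeC
k g 0` to be zero. But the latter equals `-∫ ‖cosK‖² ≠ 0`. -/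
theorem KPGraph.not_surjective {β : ℝ} {k : ℂ} {F : ℝ} (hF : |F| ≤ 1) (hk : discr β k = F) :
    ¬ ∀ g : L2R, ∃ ψ : L2R, KPGraph β ψ (k ^ 2 • ψ + g) := by
  intro hsurj
  obtain ⟨g, hg⟩ := exists_L2R_of_edges
    (u := fun j x => if j = 0 then starRingEnd ℂ (cosK k (x - vx 0)) else 0)
    (B := fun j => if j = 0 then solBound k else 0) (fun j => by
      have hc := continuous_cosK k
      by_cases hj : j = 0
      · simp only [hj, if_true]
        exact (Complex.continuous_conj.comp (hc.comp (by fun_prop))).continuousOn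
      · simp only [hj, if_false]
        exact continuousOn_const) (fun j x hx => by
      by_cases hj : j = 0
      · subst hj
        simp only [if_true, RCLike.norm_conj]
        exact norm_cosK_le_solBound k (sub_vx_mem hx)
      · simp [hj]) (summable_of_ne_finset_zero (s := {0}) fun j hj => by
        have : j ≠ 0 := by simpa using hj
        simp [this])
  obtain ⟨ψ, u, p, h1, h2, h3⟩ := hsurj g
  have hdata := KPGraph.data_eq_zero hF hk h1 h2 h3 (fun j hj => by
    filter_upwards [hg j] with x hx hx'
    rw [hx hx', if_neg hj])
  obtain ⟨e1, e2⟩ := (h1 0).right_eq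
  have h20 := h2 0
  have h30 := h3 0
  rw [(hdata (0 + 1)).1] at h20
  rw [(hdata (0 + 1)).2, ← h20, mul_zero, add_zero] at h30
  rw [← h20, (hdata 0).1, (hdata 0).2] at e1
  rw [← h30, (hdata 0).1, (hdata 0).2] at e2
  have hC : edgeC k g 0 = 0 := by
    linear_combination (-(k ^ 2 * sinK k Real.pi)) * e1 - cosK k Real.pi * e2 -
      edgeC k g 0 * cosK_sq_add k Real.pi
  have hcalc : edgeC k g 0 = -((∫ t in vx 0..vx (0 + 1), ‖cosK k (t - vx 0)‖ ^ 2 : ℝ) : ℂ) := by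
    rw [edgeC, intervalIntegral.integral_neg, ← intervalIntegral.integral_ofReal]
    congr 1
    refine intervalIntegral.integral_congr_ae ?_
    filter_upwards [hg 0] with x hx hx'
    rw [Set.uIoc_of_le (vx_le_succ 0)] at hx'
    rw [hx (Set.Ioc_subset_Icc_self hx'), if_pos rfl, mul_comm, Complex.mul_conj,
      Complex.normSq_eq_norm_sq]
  rw [hcalc, neg_eq_zero, Complex.ofReal_eq_zero] at hC
  have hcont : Continuous fun t => ‖cosK k (t - vx 0)‖ ^ 2 :=
    (((continuous_cosK k).comp (by fun_prop : Continuous fun t => t - vx 0)).norm).pow 2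
  have hpos : 0 < ∫ t in vx 0..vx (0 + 1), ‖cosK k (t - vx 0)‖ ^ 2 :=
    intervalIntegral.integral_pos (vx_lt_succ 0) hcont.continuousOn (fun x _ => sq_nonneg _)
      ⟨vx 0, Set.left_mem_Icc.2 (vx_le_succ 0), by simp⟩
  exact hpos.ne' hC

lemma L2R.eq_zero_of_data {k : ℂ} {ψ : L2R} {u p : ℤ → ℝ → ℂ}
    (h1 : ∀ j, LineEdge j ψ (k ^ 2 • ψ + 0 : L2R) (u j) (p j))
    (h : ∀ j, u j (vx j) = 0 ∧ p j (vx j) = 0) : ψ = 0 := by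
  refine L2R.ext_edges fun j => ?_
  filter_upwards [(h1 j).ae_eq, Lp.coeFn_zero ℂ 2 (volume : Measure ℝ)] with x hx h0 hx'
  have h2 := ((h1 j).eq_sol x hx').1
  rw [(h j).1, (h j).2] at h2
  have hz : ∀ τ : ℝ → ℂ, ∫ t in vx j..x, (0 : L2R) t * τ t = 0 := by
    intro τ
    rw [intervalIntegral.integral_congr_ae (g := fun _ => 0), intervalIntegral.integral_zero]
    filter_upwards [Lp.coeFn_zero ℂ 2 (volume : Measure ℝ)] with t ht _
    rw [ht, Pi.zero_apply, zero_mul]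
  rw [hx hx', h2, h0, solU, intervalIntegral.integral_neg, hz, hz]
  simp

theorem KPGraph.eq_zero_of_discr_mem {β : ℝ} {k : ℂ} {F : ℝ} (hF : |F| ≤ 1) (hk : discr β k = F)
    {ψ : L2R} (h : KPGraph β ψ (k ^ 2 • ψ)) : ψ = 0 := by
  rw [← add_zero (k ^ 2 • ψ)] at h
  obtain ⟨u, p, h1, h2, h3⟩ := h
  refine L2R.eq_zero_of_data h1 (KPGraph.data_eq_zero hF hk h1 h2 h3 fun j _ => ?_)
  filter_upwards [Lp.coeFn_zero ℂ 2 (volume : Measure ℝ)] with x hx _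
  rw [hx]; rfl

theorem DirGraph.eq_zero {k : ℂ} (hk : sinK k Real.pi ≠ 0) {ψ : L2R}
    (h : DirGraph ψ (k ^ 2 • ψ)) : ψ = 0 := by
  rw [← add_zero (k ^ 2 • ψ)] at h
  obtain ⟨u, p, h1, h2⟩ := h
  refine L2R.eq_zero_of_data h1 fun j => ⟨(h2 j).1, ?_⟩
  have e := (h1 j).right_eq.1
  have hz : ∀ᵐ x, x ∈ Set.Icc (vx j) (vx (j + 1)) → (0 : L2R) x = 0 := by
    filter_upwards [Lp.coeFn_zero ℂ 2 (volume : Measure ℝ)] with x hx _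
    rw [hx]; rfl
  rw [edgeS_eq_zero hz, edgeC_eq_zero hz, (h2 j).1, (h2 j).2] at e
  simp only [add_zero, zero_mul, zero_add] at e
  exact (mul_eq_zero.1 e.symm).resolve_right hk

lemma sinK_pi_eq_zero_iff {k : ℂ} : sinK k Real.pi = 0 ↔ ∃ n : ℕ, 1 ≤ n ∧ k ^ 2 = (n : ℂ) ^ 2 := by
  have hpi : (Real.pi : ℂ) ≠ 0 := by exact_mod_cast Real.pi_ne_zero
  constructor
  · intro h
    have hk : k ≠ 0 := by
      rintro rfl
      rw [sinK_zero_left] at h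
      exact hpi h
    have h1 : Complex.sin (k * Real.pi) = 0 := by rw [← mul_sinK, h, mul_zero]
    obtain ⟨m, hm⟩ := Complex.sin_eq_zero_iff.1 h1
    have hkm : k = m := mul_right_cancel₀ hpi hm
    refine ⟨m.natAbs, ?_, ?_⟩
    · rw [Nat.one_le_iff_ne_zero, Int.natAbs_ne_zero]
      rintro rfl
      exact hk (by simpa using hkm)
    · rw [hkm]
      have h2 : ((m.natAbs : ℤ) : ℂ) ^ 2 = (m : ℂ) ^ 2 := by
        rw [← Int.cast_pow, Int.natAbs_sq, Int.cast_pow]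
      rw [← h2, Int.cast_natCast]
  · rintro ⟨n, hn, h⟩
    have hn0 : (n : ℂ) ≠ 0 := by exact_mod_cast (by omega : n ≠ 0)
    have hs : sinK (n : ℂ) Real.pi = 0 := by
      rw [sinK_eq_div hn0, Complex.sin_nat_mul_pi, zero_div]
    rcases sq_eq_sq_iff_eq_or_eq_neg.1 h with h | h
    · rw [h, hs]
    · rw [h, sinK_neg, hs]

end

noncomputable section

/-! ### Homogeneous solutions with square summable data -/

/-- The solution of `-u'' = k² u` with `u a = x₀`, `u' a = y₀`. -/
def homU (k : ℂ) (a : ℝ) (x₀ y₀ : ℂ) (x : ℝ) : ℂ := x₀ * cosK k (x - a) + y₀ * sinK k (x - a)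

/-- The derivative of `homU`. -/
def homP (k : ℂ) (a : ℝ) (x₀ y₀ : ℂ) (x : ℝ) : ℂ :=
  -(k ^ 2 * sinK k (x - a)) * x₀ + cosK k (x - a) * y₀

lemma L2R.integral_zero_mul (a x : ℝ) (τ : ℝ → ℂ) : ∫ t in a..x, (0 : L2R) t * τ t = 0 := by
  rw [intervalIntegral.integral_congr_ae (g := fun _ => 0), intervalIntegral.integral_zero]
  filter_upwards [Lp.coeFn_zero ℂ 2 (volume : Measure ℝ)] with t ht _
  rw [ht, Pi.zero_apply, zero_mul]

lemma solU_zero (k : ℂ) (a : ℝ) (x₀ y₀ : ℂ) : solU k a x₀ y₀ (0 : L2R) = homU k a x₀ y₀ := by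
  ext x
  rw [solU, homU, intervalIntegral.integral_neg, L2R.integral_zero_mul, L2R.integral_zero_mul,
    neg_zero, add_zero, add_zero]

lemma solP_zero (k : ℂ) (a : ℝ) (x₀ y₀ : ℂ) : solP k a x₀ y₀ (0 : L2R) = homP k a x₀ y₀ := by
  ext x
  rw [solP, homP, intervalIntegral.integral_neg, L2R.integral_zero_mul, L2R.integral_zero_mul,
    neg_zero, add_zero, add_zero]

lemma exists_homogeneous (k : ℂ) {X Y : ℤ → ℂ} (hX : Summable fun j => ‖X j‖ ^ 2)
    (hY : Summable fun j => ‖Y j‖ ^ 2) :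
    ∃ ψ : L2R, ∀ j, LineEdge j ψ (k ^ 2 • ψ : L2R) (homU k (vx j) (X j) (Y j))
      (homP k (vx j) (X j) (Y j)) := by
  obtain ⟨ψ, h⟩ := exists_lineEdge k 0 hX hY
  refine ⟨ψ, fun j => ?_⟩
  have := h j
  rwa [add_zero, solU_zero, solP_zero] at this

lemma norm_homU_le (k : ℂ) {j : ℤ} (x₀ y₀ : ℂ) {x : ℝ} (hx : x ∈ Set.Icc (vx j) (vx (j + 1))) :
    ‖homU k (vx j) x₀ y₀ x‖ ≤ solBound k * (‖x₀‖ + ‖y₀‖) := by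
  have h3 := norm_cosK_le_solBound k (sub_vx_mem hx)
  have h4 := norm_sinK_le_solBound k (sub_vx_mem hx)
  rw [homU]
  refine (norm_add_le _ _).trans ?_
  rw [norm_mul, norm_mul, mul_add, mul_comm (solBound k), mul_comm (solBound k)]
  gcongr

/-- `ψ` is the continuous function which solves `-u'' = k² u` on every edge and whose value at the
vertex `v_j` is `d j * sin (k π) / k`. -/
def IsGam (k : ℂ) (d : ℤ → ℂ) (ψ : L2R) : Prop :=
  ∀ j, LineEdge j ψ (k ^ 2 • ψ : L2R)
    (homU k (vx j) (d j * sinK k Real.pi) (d (j + 1) - d j * cosK k Real.pi))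
    (homP k (vx j) (d j * sinK k Real.pi) (d (j + 1) - d j * cosK k Real.pi))

lemma exists_isGam (k : ℂ) {d : ℤ → ℂ} (hd : Summable fun j => ‖d j‖ ^ 2) :
    ∃ ψ, IsGam k d ψ := by
  have hd1 : Summable fun j => ‖d (j + 1)‖ ^ 2 := (Equiv.addRight (1 : ℤ)).summable_iff.2 hd
  refine exists_homogeneous k (X := fun j => d j * sinK k Real.pi)
    (Y := fun j => d (j + 1) - d j * cosK k Real.pi) ?_ ?_
  · simp only [norm_mul, mul_pow]
    exact hd.mul_right _
  · refine sq_summable_norm_of_le (C := fun j => ‖d (j + 1)‖ + ‖cosK k Real.pi‖ * ‖d j‖)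
      (sq_summable_add hd1 (sq_summable_const_mul _ hd)) fun j => ?_
    refine (norm_sub_le _ _).trans ?_
    rw [norm_mul, mul_comm]

lemma LineEdge.smul_sub {j : ℤ} {ψ f ψ' f' : L2R} {u p u' p' : ℝ → ℂ} (c : ℂ)
    (h : LineEdge j ψ f u p) (h' : LineEdge j ψ' f' u' p') :
    LineEdge j (c • (ψ - ψ') : L2R) (c • (f - f') : L2R) (fun x => c * (u x - u' x))
      (fun x => c * (p x - p' x)) := by
  have hco : ∀ a b : L2R, ∀ᵐ x, (c • (a - b) : L2R) x = c * (a x - b x) := by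
    intro a b
    filter_upwards [Lp.coeFn_sub a b, Lp.coeFn_smul c (a - b)] with x h1 h2
    rw [h2, Pi.smul_apply, h1, Pi.sub_apply, smul_eq_mul]
  have hab := vx_le_succ j
  refine ⟨?_, ?_, ?_⟩
  · filter_upwards [hco ψ ψ', h.ae_eq, h'.ae_eq] with x h1 h2 h3 hx
    rw [h1, h2 hx, h3 hx]
  · refine ((h.prim_u.add (h'.prim_u.const_mul (-1))).const_mul c).congr hab (fun x _ => by ring)
      (Filter.Eventually.of_forall fun x _ => by ring)
  · refine ((h.prim_p.add (h'.prim_p.const_mul (-1))).const_mul c).congr hab (fun x _ => by ring) ?_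
    filter_upwards [hco f f'] with x h1 _
    rw [h1]
    ring

/-- On the edges, `ψ = (f - h) / (κ² - k²)` satisfies `-ψ'' = k² ψ + f` automatically. Each of `f`
and `h` is continuous, and the defect of the `δ`-condition at `v_j` is `e (j + 1) + e (j - 1) - 2 *
discr β κ * e j` for `f`, and likewise for `h`; the hypothesis says that the defects cancel. -/
lemma kpGraph_of_isGam {β : ℝ} {κ k : ℂ} (hκ : κ ^ 2 ≠ k ^ 2) {e d : ℤ → ℂ} {f h : L2R}
    (hf : IsGam κ e f) (hh : IsGam k d h)
    (hed : ∀ j, e (j + 1) + e (j - 1) - 2 * discr β κ * e j =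
      d (j + 1) + d (j - 1) - 2 * discr β k * d j) :
    KPGraph β ((κ ^ 2 - k ^ 2)⁻¹ • (f - h)) (k ^ 2 • ((κ ^ 2 - k ^ 2)⁻¹ • (f - h)) + f) := by
  have hne := sub_ne_zero.2 hκ
  have e1 : k ^ 2 • ((κ ^ 2 - k ^ 2)⁻¹ • (f - h)) + f =
      (κ ^ 2 - k ^ 2)⁻¹ • (κ ^ 2 • f - k ^ 2 • h) := by
    have : f = (κ ^ 2 - k ^ 2)⁻¹ • ((κ ^ 2 - k ^ 2) • f) := by
      rw [smul_smul, inv_mul_cancel₀ hne, one_smul]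
    nth_rewrite 2 [this]
    module
  rw [e1]
  refine ⟨_, _, fun j => (hf j).smul_sub _ (hh j), fun j => ?_, fun j => ?_⟩
  · simp only [homU, vx_succ, add_sub_cancel_left, sub_self, cosK_zero_right, sinK_zero_right]
    ring
  · have h1 := hed (j + 1)
    rw [add_sub_cancel_right] at h1
    simp only [discr] at h1
    simp only [homU, homP, vx_succ, add_sub_cancel_left, sub_self, cosK_zero_right, sinK_zero_right]
    have c1 := cosK_sq_add κ Real.pi
    have c2 := cosK_sq_add k Real.pi
    linear_combination (κ ^ 2 - k ^ 2)⁻¹ * (h1 + e j * c1 - d j * c2)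

/-! ### Dipole data and a resolvent bound uniform up to the real axis -/

/-- The sequence `δ_{m+1} - δ_{m-1}`. -/
def dipole (m j : ℤ) : ℂ := (if j = m + 1 then 1 else 0) - (if j = m - 1 then 1 else 0)

lemma norm_dipole_le (m j : ℤ) : ‖dipole m j‖ ≤ 1 := by
  unfold dipole
  split_ifs with h1 h2
  · omega
  · simp
  · simp
  · simp

lemma dipole_eq_zero {m j : ℤ} (h : j ∉ Finset.Icc (m - 1) (m + 1)) : dipole m j = 0 := by
  rw [Finset.mem_Icc] at h
  unfold dipole
  rw [if_neg (by omega), if_neg (by omega), sub_zero]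

lemma summable_dipole_sq (m : ℤ) : Summable fun j => ‖dipole m j‖ ^ 2 :=
  summable_of_ne_finset_zero (s := Finset.Icc (m - 1) (m + 1)) fun j hj => by
    rw [dipole_eq_zero hj]; simp

/-- The potential of a single source is `ζ^|n| / (ζ - ζ⁻¹)`, which blows up at the band edges `ζ =
±1`. For a dipole the denominator cancels: the potential is the odd sequence `sign n * ζ^|n|` around
`m`, bounded by `1` for all `ζ` considered. This is why dipoles are used. -/
lemma exists_dipole_potential {ζ : ℂ} (h0 : ζ ≠ 0) (h1 : ‖ζ‖ < 1) (m : ℤ) :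
    ∃ U : ℤ → ℂ, (Summable fun j => ‖U j‖ ^ 2) ∧ (∀ j, ‖U j‖ ≤ 1) ∧
      ∀ j, U (j + 1) + U (j - 1) - (ζ + ζ⁻¹) * U j = -dipole m j := by
  set V : ℤ → ℂ := fun n => if 0 < n then ζ ^ n else if n < 0 then -ζ ^ (-n) else 0 with hV
  have hVn : ∀ n, ‖V n‖ ≤ ‖ζ‖ ^ n.natAbs := by
    intro n
    simp only [hV]
    rcases lt_trichotomy n 0 with h | h | h
    · rw [if_neg (by omega), if_pos h, norm_neg, norm_zpow, ← zpow_natCast,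
        show ((n.natAbs : ℕ) : ℤ) = -n by omega]
    · subst h; simp
    · rw [if_pos h, norm_zpow, ← zpow_natCast, show ((n.natAbs : ℕ) : ℤ) = n by omega]
  have hsum : Summable fun n : ℤ => ‖V n‖ ^ 2 := by
    have hg : Summable fun n : ℕ => (‖ζ‖ ^ n) ^ 2 := by
      simp only [← pow_mul, mul_comm _ 2]
      simp only [pow_mul]
      exact summable_geometric_of_lt_one (by positivity) (by nlinarith [norm_nonneg ζ])
    refine Summable.of_nat_of_neg ?_ ?_
    · refine Summable.of_nonneg_of_le (fun n => sq_nonneg _) (fun n => ?_) hg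
      simpa using pow_le_pow_left₀ (norm_nonneg _) (hVn n) 2
    · refine Summable.of_nonneg_of_le (fun n => sq_nonneg _) (fun n => ?_) hg
      simpa using pow_le_pow_left₀ (norm_nonneg _) (hVn (-n)) 2
  refine ⟨fun j => V (j - m), (Equiv.subRight m).summable_iff.2 hsum, fun j => ?_, fun j => ?_⟩
  · exact (hVn _).trans (pow_le_one₀ (norm_nonneg _) h1.le)
  · obtain ⟨n, rfl⟩ : ∃ n, j = n + m := ⟨j - m, by ring⟩
    have e1 : n + m + 1 - m = n + 1 := by ring
    have e2 : n + m - 1 - m = n - 1 := by ring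
    have e3 : n + m - m = n := by ring
    simp only [e1, e2, e3, dipole]
    have hi := mul_inv_cancel₀ h0
    simp only [hV]
    rcases lt_trichotomy n 0 with h | h | h
    · rcases eq_or_lt_of_le (Int.le_sub_one_of_lt h) with h' | h'
      · have : n = -1 := by omega
        subst this
        rw [if_neg (c := (-1 + m = m + 1)) (by omega), if_pos (c := (-1 + m = m - 1)) (by omega)]
        norm_num
        linear_combination hi
      · rw [if_neg (by omega), if_pos (by omega), if_neg (by omega), if_pos (by omega),
          if_neg (by omega), if_pos (by omega), if_neg (by omega), if_neg (by omega)]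
        have a1 : ζ ^ (-(n - 1)) = ζ ^ (-n) * ζ := by rw [← zpow_add_one₀ h0]; congr 1; ring
        have a2 : ζ ^ (-n) = ζ ^ (-(n + 1)) * ζ := by rw [← zpow_add_one₀ h0]; congr 1; ring
        rw [a1, a2]
        linear_combination ζ ^ (-(n + 1)) * hi
    · subst h
      rw [if_neg (c := (0 + m = m + 1)) (by omega), if_neg (c := (0 + m = m - 1)) (by omega)]
      norm_num
    · rcases eq_or_lt_of_le (Int.add_one_le_of_lt h) with h' | h'
      · have : n = 1 := by omega
        subst this
        rw [if_pos (c := (1 + m = m + 1)) (by omega), if_neg (c := (1 + m = m - 1)) (by omega)]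
        norm_num
        linear_combination -hi
      · rw [if_pos (by omega), if_pos (by omega), if_pos (by omega), if_neg (by omega),
          if_neg (by omega)]
        have a1 : ζ ^ (n + 1) = ζ ^ n * ζ := zpow_add_one₀ h0 n
        have a2 : ζ ^ n = ζ ^ (n - 1) * ζ := by rw [← zpow_add_one₀ h0]; congr 1; ring
        rw [a1, a2]
        linear_combination -ζ ^ (n - 1) * hi

lemma norm_discr_le (β : ℝ) (k : ℂ) : ‖discr β k‖ ≤ (1 + |β| / 2) * solBound k := by
  have hp : Real.pi ∈ Set.Icc 0 Real.pi := ⟨Real.pi_pos.le, le_rfl⟩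
  have h1 := norm_cosK_le_solBound k hp
  have h2 := norm_sinK_le_solBound k hp
  rw [discr]
  refine (norm_add_le _ _).trans ?_
  rw [norm_mul, norm_div, Complex.norm_real, Complex.norm_ofNat, Real.norm_eq_abs, add_mul, one_mul]
  gcongr

lemma IsGam.norm_inner_le {k κ : ℂ} {d e : ℤ → ℂ} {f h : L2R} (hf : IsGam κ e f) (hh : IsGam k d h)
    {s : Finset ℤ} (he : ∀ j ∉ s, e j = 0 ∧ e (j + 1) = 0) {D : ℝ} (hd : ∀ j, ‖d j‖ ≤ D) :
    ‖inner ℂ f h‖ ≤ (solBound k * (D * solBound k + (D + D * solBound k))) * ∑ j ∈ s, edgeL1 f j := by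
  have hp : Real.pi ∈ Set.Icc 0 Real.pi := ⟨Real.pi_pos.le, le_rfl⟩
  have c1 := norm_cosK_le_solBound k hp
  have c2 := norm_sinK_le_solBound k hp
  have hD : 0 ≤ D := (norm_nonneg _).trans (hd 0)
  have hK := solBound_pos k
  set B := solBound k * (D * solBound k + (D + D * solBound k)) with hB
  have hbound : ∀ j, ∀ᵐ x, x ∈ Set.Icc (vx j) (vx (j + 1)) → ‖h x‖ ≤ B := by
    intro j
    filter_upwards [(hh j).ae_eq] with x hx hx'
    rw [hx hx']
    refine (norm_homU_le k _ _ hx').trans ?_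
    rw [hB]
    have n1 : ‖d j * sinK k Real.pi‖ ≤ D * solBound k := by
      rw [norm_mul]; exact mul_le_mul (hd j) c2 (norm_nonneg _) hD
    have n2 : ‖d (j + 1) - d j * cosK k Real.pi‖ ≤ D + D * solBound k := by
      refine (norm_sub_le _ _).trans ?_
      rw [norm_mul]
      exact add_le_add (hd _) (mul_le_mul (hd j) c1 (norm_nonneg _) hD)
    gcongr
  have hterm : ∀ j, ‖∫ x in vx j..vx (j + 1), starRingEnd ℂ (f x) * h x‖ ≤ B * edgeL1 f j := by
    intro j
    rw [edgeL1, ← intervalIntegral.integral_const_mul]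
    refine intervalIntegral.norm_integral_le_of_norm_le (vx_le_succ j) ?_
      ((L2R.intervalIntegrable f _ _).norm.const_mul B)
    filter_upwards [hbound j] with x hx hx'
    rw [norm_mul, RCLike.norm_conj, mul_comm]
    exact mul_le_mul_of_nonneg_right (hx (Set.Ioc_subset_Icc_self hx')) (norm_nonneg _)
  have hzero : ∀ j ∉ s, ∫ x in vx j..vx (j + 1), starRingEnd ℂ (f x) * h x = 0 := by
    intro j hj
    rw [intervalIntegral.integral_congr_ae (g := fun _ => 0), intervalIntegral.integral_zero]
    filter_upwards [(hf j).ae_eq] with x hx hx'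
    rw [Set.uIoc_of_le (vx_le_succ j)] at hx'
    rw [hx (Set.Ioc_subset_Icc_self hx'), (he j hj).1, (he j hj).2]
    simp [homU]
  have hs := (hasSum_inner_edges f h).unique (hasSum_sum_of_ne_finset_zero hzero)
  rw [hs, Finset.mul_sum]
  exact norm_sum_le_of_le _ fun j _ => hterm j

lemma solBound_mono {k : ℂ} {R : ℝ} (hk : ‖k‖ ≤ R) :
    solBound k ≤ Real.exp (R * Real.pi) * (1 + Real.pi) := by
  have := Real.pi_pos
  unfold solBound
  gcongr

/-- The resolvent form of a dipole vector is bounded on bounded sets. -/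
lemma exists_resolvent_bound (β : ℝ) (κ : ℂ) (m : ℤ) {f : L2R} (hf : IsGam κ (dipole m) f)
    (R : ℝ) {η : ℝ} (hη : 0 < η) :
    ∃ C : ℝ, ∀ k : ℂ, ‖k‖ ≤ R → η ≤ ‖κ ^ 2 - k ^ 2‖ → (∀ t : ℝ, |t| ≤ 1 → discr β k ≠ t) →
      ∃ ψ : L2R, KPGraph β ψ (k ^ 2 • ψ + f) ∧ ‖inner ℂ f ψ‖ ≤ C := by
  set K := Real.exp (R * Real.pi) * (1 + Real.pi) with hK
  set G := (1 + |β| / 2) * K + (1 + |β| / 2) * solBound κ with hG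
  set D := 1 + 2 * G with hD
  set L := ∑ j ∈ Finset.Icc (m - 2) (m + 1), edgeL1 f j with hL
  have hpi := Real.pi_pos
  have hK0 : 0 < K := by positivity
  have hG0 : 0 ≤ G := by have := solBound_pos κ; positivity
  have hL0 : 0 ≤ L := Finset.sum_nonneg fun j _ => edgeL1_nonneg _ _
  refine ⟨η⁻¹ * (‖f‖ ^ 2 + (K * (D * K + (D + D * K))) * L), fun k hk hκ hF => ?_⟩
  obtain ⟨ζ, hζ0, hζ1, hζ⟩ := exists_root_norm_lt_one hF
  obtain ⟨U, hU1, hU2, hU3⟩ := exists_dipole_potential hζ0 hζ1 m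
  -- The multiple of `U` is chosen so that the vertex defect of `d` at `k` equals that of the dipole
  -- at `κ`, as `kpGraph_of_isGam` requires.
  set d : ℤ → ℂ := fun j => dipole m j - 2 * (discr β k - discr β κ) * U j with hd
  have hkK : solBound k ≤ K := solBound_mono hk
  have hkpos := solBound_pos k
  have hFF : ‖discr β k - discr β κ‖ ≤ G := by
    refine (norm_sub_le _ _).trans (add_le_add ((norm_discr_le β k).trans ?_) (norm_discr_le β κ))
    gcongr
  have hdn : ∀ j, ‖d j‖ ≤ D := by
    intro j
    refine (norm_sub_le _ _).trans (add_le_add (norm_dipole_le m j) ?_)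
    rw [norm_mul, norm_mul, Complex.norm_ofNat]
    calc 2 * ‖discr β k - discr β κ‖ * ‖U j‖ ≤ 2 * G * 1 := by
          gcongr
          exact hU2 j
      _ = 2 * G := mul_one _
  have hds : Summable fun j => ‖d j‖ ^ 2 := by
    refine sq_summable_norm_of_le (C := fun j => ‖dipole m j‖ +
      ‖2 * (discr β k - discr β κ)‖ * ‖U j‖)
      (sq_summable_add (summable_dipole_sq m) (sq_summable_const_mul _ hU1)) fun j => ?_
    rw [← norm_mul]
    exact norm_sub_le _ _
  obtain ⟨h, hh⟩ := exists_isGam k hds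
  have hne : κ ^ 2 ≠ k ^ 2 := by
    intro h
    rw [h, sub_self, norm_zero] at hκ
    linarith
  refine ⟨_, kpGraph_of_isGam hne hf hh (fun j => ?_), ?_⟩
  · have h1 := hU3 j
    rw [hζ] at h1
    simp only [hd]
    linear_combination 2 * (discr β k - discr β κ) * h1
  · have hin := hf.norm_inner_le hh (s := Finset.Icc (m - 2) (m + 1)) (fun j hj => by
      rw [Finset.mem_Icc] at hj
      constructor <;> apply dipole_eq_zero <;> rw [Finset.mem_Icc] <;> omega) hdn
    rw [inner_smul_right, norm_mul, norm_inv, inner_sub_right]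
    have hD0 : 0 ≤ D := by positivity
    have h2 : ‖(inner ℂ f f : ℂ) - inner ℂ f h‖ ≤ ‖f‖ ^ 2 + (K * (D * K + (D + D * K))) * L := by
      refine (norm_sub_le _ _).trans (add_le_add ?_ (hin.trans ?_))
      · rw [inner_self_eq_norm_sq_to_K]; simp
      · gcongr
    gcongr

end

noncomputable section

/-! ### Completeness -/

/-- The odd extension `H` to `(-π, π]` has vanishing Fourier coefficients, since they are multiples
of the sine coefficients. Parseval's identity then gives `H = 0`. -/
lemma ae_eq_zero_of_sine_coeff {g : ℝ → ℂ} (hg : MemLp g 2 volume)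
    (h : ∀ n : ℕ, 1 ≤ n → ∫ y in (0 : ℝ)..Real.pi, Complex.sin (n * y) * g y = 0) :
    ∀ᵐ y, y ∈ Set.Ioc 0 Real.pi → g y = 0 := by
  have hpi := Real.pi_pos
  set g0 : ℝ → ℂ := (Set.Ioc 0 Real.pi).indicator g with hg0
  have hm0 : MemLp g0 2 volume := hg.indicator measurableSet_Ioc
  have hm1 : MemLp (fun y => g0 (-y)) 2 volume :=
    hm0.comp_measurePreserving (Measure.measurePreserving_neg volume)
  set H : ℝ → ℂ := fun y => g0 y - g0 (-y) with hH
  have hmH : MemLp H 2 volume := hm0.sub hm1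
  have hab : -Real.pi < Real.pi := by linarith
  have hinterval : ∀ f : ℝ → ℂ, MemLp f 2 volume → IntervalIntegrable f volume (-Real.pi) Real.pi := by
    intro f hf
    rw [intervalIntegrable_iff, Set.uIoc_of_le hab.le]
    exact (hf.restrict _).integrable one_le_two
  have hsin : ∀ n : ℤ, ∫ y in (-Real.pi)..Real.pi, Complex.sin (n * y) * g0 y = 0 := by
    have hnat : ∀ n : ℕ, ∫ y in (-Real.pi)..Real.pi, Complex.sin (n * y) * g0 y = 0 := by
      intro n
      rcases Nat.eq_zero_or_pos n with rfl | hn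
      · simp
      rw [← h n hn, intervalIntegral.integral_of_le hab.le, intervalIntegral.integral_of_le hpi.le]
      have e : (fun y : ℝ => Complex.sin (n * y) * g0 y) =
          (Set.Ioc 0 Real.pi).indicator (fun y : ℝ => Complex.sin (n * y) * g y) := by
        ext y
        by_cases hy : y ∈ Set.Ioc 0 Real.pi
        · simp only [hg0, Set.indicator_of_mem hy]
        · simp only [hg0, Set.indicator_of_notMem hy, mul_zero]
      rw [e, setIntegral_indicator measurableSet_Ioc,
        Set.inter_eq_self_of_subset_right (Set.Ioc_subset_Ioc_left (by linarith))]
    intro n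
    obtain ⟨m, rfl | rfl⟩ := n.eq_nat_or_neg
    · simpa using hnat m
    · have : ∀ y : ℝ, Complex.sin (((-(m : ℤ) : ℤ) : ℂ) * y) * g0 y =
          -(Complex.sin (m * y) * g0 y) := by
        intro y; push_cast; rw [neg_mul, Complex.sin_neg, neg_mul]
      simp only [this]
      rw [intervalIntegral.integral_neg, hnat m, neg_zero]
  have hcoef : ∀ n : ℤ, fourierCoeffOn hab H n = 0 := by
    intro n
    rw [fourierCoeffOn_eq_integral]
    have e0 : ∀ y : ℝ, (fourier (-n) (y : AddCircle (Real.pi - -Real.pi)) : ℂ) =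
        Complex.exp (-(n * y * Complex.I)) := by
      intro y
      rw [fourier_coe_apply]
      congr 1
      have : (Real.pi : ℂ) ≠ 0 := by exact_mod_cast Real.pi_ne_zero
      push_cast
      field_simp
      ring
    have hc : ∀ σ : ℂ, Continuous fun y : ℝ => Complex.exp (σ * (n * y * Complex.I)) := by
      intro σ; fun_prop
    have e1 : ∫ y in (-Real.pi)..Real.pi, Complex.exp (-(n * y * Complex.I)) * g0 (-y) =
        ∫ y in (-Real.pi)..Real.pi, Complex.exp (n * y * Complex.I) * g0 y := by
      have := intervalIntegral.integral_comp_neg (a := -Real.pi) (b := Real.pi)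
        (fun y : ℝ => Complex.exp (n * y * Complex.I) * g0 y)
      rw [neg_neg] at this
      rw [← this]
      refine intervalIntegral.integral_congr fun y _ => ?_
      push_cast
      ring_nf
    have e2 : ∫ y in (-Real.pi)..Real.pi, Complex.exp (-(n * y * Complex.I)) * H y = 0 := by
      have i1 : IntervalIntegrable (fun y : ℝ => Complex.exp (-(n * y * Complex.I)) * g0 y) volume
          (-Real.pi) Real.pi := (hinterval _ hm0).continuousOn_mul (by
            have := hc (-1); simp only [neg_one_mul] at this; exact this.continuousOn)
      have i2 : IntervalIntegrable (fun y : ℝ => Complex.exp (-(n * y * Complex.I)) * g0 (-y)) volume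
          (-Real.pi) Real.pi := (hinterval _ hm1).continuousOn_mul (by
            have := hc (-1); simp only [neg_one_mul] at this; exact this.continuousOn)
      have i3 : IntervalIntegrable (fun y : ℝ => Complex.exp (n * y * Complex.I) * g0 y) volume
          (-Real.pi) Real.pi := (hinterval _ hm0).continuousOn_mul (by
            have := hc 1; simp only [one_mul] at this; exact this.continuousOn)
      simp only [hH, mul_sub]
      rw [intervalIntegral.integral_sub i1 i2, e1, ← intervalIntegral.integral_sub i1 i3]
      have e3 : ∀ y : ℝ, Complex.exp (-(n * y * Complex.I)) * g0 y -
          Complex.exp (n * y * Complex.I) * g0 y =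
          -2 * Complex.I * (Complex.sin (n * y) * g0 y) := by
        intro y
        rw [Complex.sin, ← neg_mul]
        linear_combination (Complex.exp (-(n * y) * Complex.I) - Complex.exp (n * y * Complex.I)) *
          g0 y * Complex.I_sq
      simp only [e3]
      rw [intervalIntegral.integral_const_mul, hsin n, mul_zero]
    simp only [e0, smul_eq_mul, e2, smul_zero]
  have hsum := hasSum_sq_fourierCoeffOn hab (hmH.restrict _)
  simp only [hcoef, norm_zero] at hsum
  have h0 : ∫ x in (-Real.pi)..Real.pi, ‖H x‖ ^ 2 = 0 := by
    have hz : HasSum (fun _ : ℤ => (0 : ℝ) ^ 2) 0 := by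
      rw [zero_pow two_ne_zero]
      exact hasSum_zero
    have := hsum.unique hz
    rw [smul_eq_mul, mul_eq_zero] at this
    refine this.resolve_left (inv_ne_zero (by linarith))
  rw [intervalIntegral.integral_of_le hab.le, setIntegral_eq_zero_iff_of_nonneg_ae
    (Filter.Eventually.of_forall fun x => sq_nonneg _)
    ((memLp_two_iff_integrable_sq_norm hmH.1).1 hmH).integrableOn, Filter.EventuallyEq,
    ae_restrict_iff' measurableSet_Ioc] at h0
  filter_upwards [h0] with y hy hy'
  have h1 := hy ⟨by linarith [hy'.1], hy'.2⟩
  have h2 : H y = 0 := by simpa using h1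
  simp only [hH, hg0] at h2
  rw [Set.indicator_of_mem hy', Set.indicator_of_notMem (by
    intro h3; linarith [h3.1, hy'.1]), sub_zero] at h2
  exact h2

theorem L2R.eq_zero_of_edgeS {h : L2R} (hS : ∀ n : ℕ, 1 ≤ n → ∀ j, edgeS n h j = 0) : h = 0 := by
  refine L2R.ext_edges fun j => ?_
  have hmp : MeasurePreserving (fun y : ℝ => vx j + y) volume volume :=
    measurePreserving_add_left volume (vx j)
  have hm : MemLp (fun y => h (vx j + y)) 2 volume := (Lp.memLp h).comp_measurePreserving hmp
  have h1 := ae_eq_zero_of_sine_coeff hm fun n hn => by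
    have hn0 : (n : ℂ) ≠ 0 := by exact_mod_cast (by omega : n ≠ 0)
    have e := hS n hn j
    rw [edgeS, vx_succ] at e
    have e2 := intervalIntegral.integral_comp_add_left (a := 0) (b := Real.pi)
      (fun t => h t * sinK n (t - vx j)) (vx j)
    rw [add_zero, e] at e2
    simp only [add_sub_cancel_left, sinK_eq_div hn0] at e2
    have e3 : ∀ y : ℝ, Complex.sin (n * y) * h (vx j + y) =
        n * (h (vx j + y) * (Complex.sin (n * y) / n)) := by
      intro y; field_simp
    simp only [e3]
    rw [intervalIntegral.integral_const_mul, e2, mul_zero]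
  have hmp' : MeasurePreserving (fun y : ℝ => y - vx j) volume volume :=
    measurePreserving_sub_right volume (vx j)
  have hne : ∀ᵐ x : ℝ, x ≠ vx j := by
    simp [ae_iff]
  filter_upwards [hmp'.quasiMeasurePreserving.ae h1, Lp.coeFn_zero ℂ 2 (volume : Measure ℝ), hne]
    with x hx h0 hxne hx'
  rw [h0, Pi.zero_apply]
  have := sub_vx_mem hx'
  have h3 := hx ⟨lt_of_le_of_ne this.1 (by intro h; apply hxne; linarith), this.2⟩
  rwa [add_sub_cancel] at h3

lemma continuous_integral_mul {τ : ℂ → ℝ → ℂ} (hτ : Continuous (Function.uncurry τ)) (h : L2R)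
    (a b : ℝ) : Continuous fun k => ∫ t in a..b, h t * τ k t := by
  refine continuous_iff_continuousAt.2 fun k => ?_
  obtain ⟨C, hC⟩ := ((isCompact_closedBall k 1).prod (isCompact_uIcc (a := a) (b := b))).exists_bound_of_continuousOn
    hτ.continuousOn
  refine intervalIntegral.continuousAt_of_dominated_interval (bound := fun t => C * ‖h t‖) ?_ ?_ ?_ ?_
  · refine Filter.Eventually.of_forall fun k' => ?_
    exact ((Lp.aestronglyMeasurable h).mul
      (hτ.comp (by fun_prop : Continuous fun t : ℝ => (k', t))).aestronglyMeasurable).restrict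
  · filter_upwards [Metric.closedBall_mem_nhds k one_pos] with k' hk'
    refine Filter.Eventually.of_forall fun t ht => ?_
    rw [norm_mul, mul_comm]
    exact mul_le_mul_of_nonneg_right (hC (k', t) ⟨hk', Set.uIoc_subset_uIcc ht⟩) (norm_nonneg _)
  · exact (L2R.intervalIntegrable h a b).norm.const_mul C
  · refine Filter.Eventually.of_forall fun t _ => ?_
    exact (continuous_const.mul
      (hτ.comp (by fun_prop : Continuous fun k' : ℂ => (k', t)))).continuousAt

lemma continuous_cosK_uncurry (a : ℝ) :
    Continuous (Function.uncurry fun (k : ℂ) (t : ℝ) => cosK k (t - a)) := by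
  unfold cosK Function.uncurry; fun_prop

lemma continuous_sinK_uncurry (a : ℝ) :
    Continuous (Function.uncurry fun (k : ℂ) (t : ℝ) => sinK k (t - a)) := by
  unfold sinK Function.uncurry
  exact intervalIntegral.continuous_parametric_intervalIntegral_of_continuous
    (f := fun (q : ℂ × ℝ) (t : ℝ) => Complex.cos (q.1 * t)) (by unfold Function.uncurry; fun_prop)
    (s := fun q : ℂ × ℝ => q.2 - a) (by fun_prop)

lemma continuous_edgeS (h : L2R) (j : ℤ) : Continuous fun k => edgeS k h j :=
  continuous_integral_mul (continuous_sinK_uncurry _) h _ _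

lemma continuous_edgeC (h : L2R) (j : ℤ) : Continuous fun k => edgeC k h j := by
  simp only [edgeC, intervalIntegral.integral_neg]
  exact (continuous_integral_mul (continuous_cosK_uncurry _) h _ _).neg

lemma continuous_sinK_left (x : ℝ) : Continuous fun k => sinK k x := by
  have := (continuous_sinK_uncurry 0).comp (by fun_prop : Continuous fun k : ℂ => (k, x))
  simpa [Function.comp_def, Function.uncurry] using this

lemma IsGam.integral_edge {κ : ℂ} {d : ℤ → ℂ} {f : L2R} (hf : IsGam κ d f) (h : L2R) (j : ℤ) :
    ∫ x in vx j..vx (j + 1), starRingEnd ℂ (f x) * h x =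
      starRingEnd ℂ (d (j + 1)) * edgeS (starRingEnd ℂ κ) h j -
      starRingEnd ℂ (d j) * (sinK (starRingEnd ℂ κ) Real.pi * edgeC (starRingEnd ℂ κ) h j +
        cosK (starRingEnd ℂ κ) Real.pi * edgeS (starRingEnd ℂ κ) h j) := by
  set k := starRingEnd ℂ κ with hk
  have hh := L2R.intervalIntegrable h (vx j) (vx (j + 1))
  have h1 : ∫ x in vx j..vx (j + 1), starRingEnd ℂ (f x) * h x = ∫ x in vx j..vx (j + 1),
      ((starRingEnd ℂ (d (j + 1)) - starRingEnd ℂ (d j) * cosK k Real.pi) *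
        (h x * sinK k (x - vx j)) +
      (-(starRingEnd ℂ (d j) * sinK k Real.pi)) * -(h x * cosK k (x - vx j))) := by
    refine intervalIntegral.integral_congr_ae ?_
    filter_upwards [(hf j).ae_eq] with x hx hx'
    rw [Set.uIoc_of_le (vx_le_succ j)] at hx'
    rw [hx (Set.Ioc_subset_Icc_self hx'), homU]
    simp only [map_add, map_mul, map_sub, conj_cosK, conj_sinK, ← hk]
    ring
  rw [h1, intervalIntegral.integral_add ((intervalIntegrable_mul_sinK hh).const_mul _)
    ((intervalIntegrable_neg_mul_cosK hh).const_mul _), intervalIntegral.integral_const_mul,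
    intervalIntegral.integral_const_mul, ← edgeS, ← edgeC]
  ring

/-- The functional of `h` conjugate to a unit value at the vertex `v_j`. -/
def vertexFun (k : ℂ) (h : ℝ → ℂ) (j : ℤ) : ℂ :=
  edgeS k h (j - 1) - (sinK k Real.pi * edgeC k h j + cosK k Real.pi * edgeS k h j)

lemma IsGam.inner_dipole {κ : ℂ} {m : ℤ} {f : L2R} (hf : IsGam κ (dipole m) f) (h : L2R) :
    inner ℂ f h =
      vertexFun (starRingEnd ℂ κ) h (m + 1) - vertexFun (starRingEnd ℂ κ) h (m - 1) := by
  have hs := (hasSum_inner_edges f h).unique (hasSum_sum_of_ne_finset_zero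
    (s := {m - 2, m - 1, m, m + 1}) fun j hj => by
      simp only [Finset.mem_insert, Finset.mem_singleton, not_or] at hj
      rw [hf.integral_edge, dipole_eq_zero (j := j + 1), dipole_eq_zero]
      · simp
      · rw [Finset.mem_Icc]; omega
      · rw [Finset.mem_Icc]; omega)
  rw [hs]
  rw [Finset.sum_insert (by simp; omega), Finset.sum_insert (by simp; omega), Finset.sum_insert (by simp),
    Finset.sum_singleton]
  simp only [hf.integral_edge]
  have d1 : dipole m (m + 1) = 1 := by
    unfold dipole; rw [if_pos rfl, if_neg (by omega)]; simp
  have d2 : dipole m (m - 1) = -1 := by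
    unfold dipole; rw [if_neg (by omega), if_pos rfl]; simp
  have d3 : dipole m m = 0 := by
    unfold dipole; rw [if_neg (by omega), if_neg (by omega)]; simp
  have d4 : dipole m (m + 1 + 1) = 0 := by
    unfold dipole; rw [if_neg (by omega), if_neg (by omega)]; simp
  have d5 : dipole m (m - 2) = 0 := by
    unfold dipole; rw [if_neg (by omega), if_neg (by omega)]; simp
  have e1 : m - 2 + 1 = m - 1 := by ring
  have e2 : m - 1 - 1 = m - 2 := by ring
  simp only [vertexFun, e1, e2, sub_add_cancel, add_sub_cancel_right, d1, d2, d3, d4, d5, map_zero,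
    map_one, map_neg]
  ring

lemma vertexFun_sq_summable (k : ℂ) (h : L2R) : Summable fun j => ‖vertexFun k h j‖ ^ 2 := by
  have h1 := summable_edgeL1_sq h
  have hs : Summable fun j => ‖edgeS k h j‖ ^ 2 :=
    sq_summable_norm_of_le (sq_summable_const_mul _ h1) (norm_edgeS_le k h)
  have hc : Summable fun j => ‖edgeC k h j‖ ^ 2 :=
    sq_summable_norm_of_le (sq_summable_const_mul _ h1) (norm_edgeC_le k h)
  have hs' : Summable fun j => ‖edgeS k h (j - 1)‖ ^ 2 := 
    (Equiv.subRight (1 : ℤ)).summable_iff (f := fun j => ‖edgeS k h j‖ ^ 2) |>.2 hs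
  have hsum := sq_summable_add hs' (sq_summable_add
    (sq_summable_const_mul ‖sinK k Real.pi‖ hc) (sq_summable_const_mul ‖cosK k Real.pi‖ hs))
  refine sq_summable_norm_of_le hsum fun j => ?_
  refine (norm_sub_le _ _).trans (add_le_add le_rfl ((norm_add_le _ _).trans ?_))
  rw [norm_mul, norm_mul]

/-- The dipole vectors span a dense subspace. -/
theorem L2R.eq_zero_of_inner_dipole {h : L2R}
    (hh : ∀ (κ : ℂ) (m : ℤ) (f : L2R), (κ ^ 2).im ≠ 0 → IsGam κ (dipole m) f → inner ℂ f h = 0) :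
    h = 0 := by
  -- Orthogonality to all dipoles makes `vertexFun` periodic with period two in the vertex. Being
  -- square summable, it vanishes.
  have hA : ∀ k : ℂ, (k ^ 2).im ≠ 0 → ∀ j, vertexFun k h j = 0 := by
    intro k hk j
    have hstep : ∀ m, vertexFun k h (m + 1) = vertexFun k h (m - 1) := by
      intro m
      obtain ⟨f, hf⟩ := exists_isGam (starRingEnd ℂ k) (summable_dipole_sq m)
      have h1 := hf.inner_dipole h
      rw [hh _ m f (by rw [← map_pow, Complex.conj_im]; exact neg_ne_zero.2 hk) hf,
        Complex.conj_conj] at h1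
      exact (sub_eq_zero.1 h1.symm)
    have hconst : ∀ i : ℕ, vertexFun k h (j + 2 * i) = vertexFun k h j := by
      intro i
      induction i with
      | zero => simp
      | succ i ih =>
        rw [← ih]
        have := hstep (j + 2 * i + 1)
        rw [add_sub_cancel_right] at this
        rw [← this]
        congr 1
        push_cast
        ring
    have hlim := tendsto_int_atTop_of_sq_summable (vertexFun_sq_summable k h)
      (φ := fun i : ℕ => j + 2 * i) (fun a b hab => by simpa using hab)
    simp only [hconst] at hlim
    exact tendsto_nhds_unique tendsto_const_nhds hlim
  have hcont : ∀ j, Continuous fun k => vertexFun k h j := by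
    intro j
    unfold vertexFun
    have h1 := continuous_edgeS h j
    have h2 := continuous_edgeS h (j - 1)
    have h3 := continuous_edgeC h j
    have h4 := continuous_sinK_left Real.pi
    have h5 : Continuous fun k => cosK k Real.pi := by unfold cosK; fun_prop
    fun_prop
  -- By continuity in `k`, along `n + it` with `t → 0`, the vanishing extends to `k = n`. There
  -- `sinK` is zero at `π` and `cosK` is unimodular, so `‖edgeS n h j‖` does not depend on `j`;
  -- square summability makes it zero.
  refine L2R.eq_zero_of_edgeS fun n hn j => ?_
  have hn0 : (n : ℝ) ≠ 0 := by exact_mod_cast (by omega : n ≠ 0)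
  have hz : ∀ j, vertexFun n h j = 0 := by
    intro j
    have e := Continuous.ext_on (f := fun t : ℝ => vertexFun (n + t * Complex.I) h j)
      (g := fun _ => 0) (dense_compl_singleton (0 : ℝ))
      ((hcont j).comp (by fun_prop)) continuous_const (fun t ht => hA _ (by
        have : ((n + t * Complex.I : ℂ) ^ 2).im = 2 * n * t := by
          simp [sq]; ring
        rw [this]
        exact mul_ne_zero (mul_ne_zero two_ne_zero hn0) ht) j)
    simpa using congrFun e 0
  have hs0 : sinK n Real.pi = 0 := sinK_pi_eq_zero_iff.2 ⟨n, hn, rfl⟩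
  have hnorm : ∀ j, ‖edgeS n h (j - 1)‖ = ‖edgeS n h j‖ := by
    intro j
    have h1 := hz j
    have hc := cosK_sq_add (n : ℂ) Real.pi
    rw [hs0] at hc
    have hc1 : ‖cosK n Real.pi‖ = 1 := by
      have h2 : ‖cosK n Real.pi‖ ^ 2 = 1 := by
        rw [← norm_pow, show cosK n Real.pi ^ 2 = 1 by simpa using hc, norm_one]
      exact (pow_eq_one_iff_of_nonneg (norm_nonneg _) two_ne_zero).1 h2
    rw [vertexFun, hs0, zero_mul, zero_add, sub_eq_zero] at h1
    rw [h1, norm_mul, hc1, one_mul]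
  have hconst : ∀ i : ℕ, ‖edgeS n h (j + i)‖ = ‖edgeS n h j‖ := by
    intro i
    induction i with
    | zero => simp
    | succ i ih =>
      rw [← ih, ← hnorm (j + (i + 1 : ℕ))]
      congr 2
      push_cast
      ring
  have hs : Summable fun j => ‖edgeS n h j‖ ^ 2 :=
    sq_summable_norm_of_le (sq_summable_const_mul _ (summable_edgeL1_sq h)) (norm_edgeS_le n h)
  have hlim := (tendsto_int_atTop_of_sq_summable hs (φ := fun i : ℕ => j + i)
    (fun a b hab => by simpa using hab)).norm
  simp only [hconst, norm_zero] at hlim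
  exact norm_eq_zero.1 (tendsto_nhds_unique tendsto_const_nhds hlim)

/-- The eigenfunction `sin (n (x - v_j)) / n` on the `j`-th edge. -/
lemma DirGraph.exists_eigenvector {n : ℕ} (hn : 1 ≤ n) (j : ℤ) :
    ∃ ψ : L2R, DirGraph ψ ((n : ℂ) ^ 2 • ψ) ∧ (∀ h : L2R, inner ℂ ψ h = edgeS n h j) ∧
      (∀ i, i ≠ j → edgeS n ψ i = 0) ∧ ψ ≠ 0 := by
  obtain ⟨ψ, hψ⟩ := exists_homogeneous (n : ℂ) (X := fun _ => 0)
    (Y := fun i => if i = j then 1 else 0) (by simp)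
    (summable_of_ne_finset_zero (s := {j}) fun i hi => by
      rw [Finset.mem_singleton] at hi; simp [hi])
  have hs0 : sinK n Real.pi = 0 := sinK_pi_eq_zero_iff.2 ⟨n, hn, rfl⟩
  refine ⟨ψ, ⟨_, _, hψ, fun i => ?_⟩, fun h => ?_, fun i hi => edgeS_eq_zero ?_, ?_⟩
  · simp [homU, vx_succ, hs0, sinK_zero_right]
  · have hs := (hasSum_inner_edges ψ h).unique (hasSum_single j fun i hi => by
      rw [intervalIntegral.integral_congr_ae (g := fun _ => 0), intervalIntegral.integral_zero]
      filter_upwards [(hψ i).ae_eq] with x hx hx'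
      rw [Set.uIoc_of_le (vx_le_succ i)] at hx'
      rw [hx (Set.Ioc_subset_Icc_self hx'), if_neg hi]
      simp [homU])
    rw [hs, edgeS]
    refine intervalIntegral.integral_congr_ae ?_
    filter_upwards [(hψ j).ae_eq] with x hx hx'
    rw [Set.uIoc_of_le (vx_le_succ j)] at hx'
    rw [hx (Set.Ioc_subset_Icc_self hx'), if_pos rfl, homU, zero_mul, zero_add, one_mul, conj_sinK,
      Complex.conj_natCast, mul_comm]
  · filter_upwards [(hψ i).ae_eq] with x hx hx'
    rw [hx hx', if_neg hi]
    simp [homU]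
  -- The derivative at the left vertex of edge `j` is `1`, while the trace bound for the zero
  -- function would make it vanish.
  · rintro rfl
    obtain ⟨C, -, hC⟩ := exists_trace_bound
    have h1 := (hC j _ _ _ _ (hψ j)).2
    have h2 : edgeL1 (0 : L2R) j = 0 := by
      rw [edgeL1, intervalIntegral.integral_congr_ae (g := fun _ => 0),
        intervalIntegral.integral_zero]
      filter_upwards [Lp.coeFn_zero ℂ 2 (volume : Measure ℝ)] with x hx _
      rw [hx, Pi.zero_apply, norm_zero]
    rw [smul_zero, h2, if_pos rfl, homP, sub_self, cosK_zero_right] at h1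
    norm_num at h1

end

noncomputable section

/-! ### Removal of the magnetic potential -/

lemma norm_exp_I_mul (A x : ℝ) : ‖Complex.exp (Complex.I * A * x)‖ = 1 := by
  rw [show Complex.I * A * x = ((A * x : ℝ) : ℂ) * Complex.I by push_cast; ring,
    Complex.norm_exp_ofReal_mul_I]

lemma memLp_phaseMul (A : ℝ) (ψ : L2R) :
    MemLp (fun x : ℝ => Complex.exp (Complex.I * A * x) * ψ x) 2 volume := by
  refine (Lp.memLp ψ).congr_norm (f := ψ) ?_ (Filter.Eventually.of_forall fun x => ?_)
  · exact (by fun_prop : Continuous fun x : ℝ =>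
      Complex.exp (Complex.I * A * x)).aestronglyMeasurable.mul (Lp.aestronglyMeasurable ψ)
  · rw [norm_mul, norm_exp_I_mul, one_mul]

/-- Multiplication by `exp (i A x)`. -/
def phaseMul (A : ℝ) : L2R →ₗ[ℂ] L2R where
  toFun ψ := (memLp_phaseMul A ψ).toLp _
  map_add' ψ φ := by
    refine Lp.ext ?_
    filter_upwards [(memLp_phaseMul A (ψ + φ)).coeFn_toLp, (memLp_phaseMul A ψ).coeFn_toLp,
      (memLp_phaseMul A φ).coeFn_toLp, Lp.coeFn_add ψ φ,
      Lp.coeFn_add ((memLp_phaseMul A ψ).toLp _) ((memLp_phaseMul A φ).toLp _)] with x h1 h2 h3 h4 h5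
    rw [h1, h5, Pi.add_apply, h2, h3, h4, Pi.add_apply, mul_add]
  map_smul' c ψ := by
    refine Lp.ext ?_
    filter_upwards [(memLp_phaseMul A (c • ψ)).coeFn_toLp, (memLp_phaseMul A ψ).coeFn_toLp,
      Lp.coeFn_smul c ψ, Lp.coeFn_smul c ((memLp_phaseMul A ψ).toLp _)] with x h1 h2 h3 h4
    rw [h1, RingHom.id_apply, h4, Pi.smul_apply, h2, h3, Pi.smul_apply, smul_eq_mul, smul_eq_mul]
    ring

lemma coeFn_phaseMul (A : ℝ) (ψ : L2R) :
    ∀ᵐ x : ℝ, phaseMul A ψ x = Complex.exp (Complex.I * A * x) * ψ x :=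
  (memLp_phaseMul A ψ).coeFn_toLp

lemma phaseMul_neg_phaseMul (A : ℝ) (ψ : L2R) : phaseMul (-A) (phaseMul A ψ) = ψ := by
  refine Lp.ext ?_
  filter_upwards [coeFn_phaseMul (-A) (phaseMul A ψ), coeFn_phaseMul A ψ] with x h1 h2
  rw [h1, h2, ← mul_assoc, ← Complex.exp_add]
  push_cast
  ring_nf
  simp

lemma phaseMul_phaseMul_neg (A : ℝ) (ψ : L2R) : phaseMul A (phaseMul (-A) ψ) = ψ := by
  have := phaseMul_neg_phaseMul (-A) ψ
  rwa [neg_neg] at this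

lemma inner_phaseMul (A : ℝ) (ψ φ : L2R) : inner ℂ (phaseMul A ψ) (phaseMul A φ) = inner ℂ ψ φ := by
  rw [L2.inner_def, L2.inner_def]
  refine integral_congr_ae ?_
  filter_upwards [coeFn_phaseMul A ψ, coeFn_phaseMul A φ] with x h1 h2
  rw [h1, h2, RCLike.inner_apply, RCLike.inner_apply, map_mul]
  have h3 : Complex.exp (Complex.I * A * x) * starRingEnd ℂ (Complex.exp (Complex.I * A * x)) = 1 := by
    rw [Complex.mul_conj, Complex.normSq_eq_norm_sq, norm_exp_I_mul]
    simp
  linear_combination φ x * starRingEnd ℂ (ψ x) * h3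

lemma edgeEquation_iff {A : ℝ} {j : ℤ} {ψ f : L2R} {u p : ℝ → ℂ} :
    EdgeEquation A j ψ f u p ↔ LineEdge j (phaseMul A ψ) (phaseMul A f)
      (fun x => Complex.exp (Complex.I * A * x) * u x)
      (fun x => Complex.exp (Complex.I * A * x) * p x) := by
  have hab := vx_le_succ j
  have hv : ((j : ℝ) + 1) * Real.pi = vx (j + 1) := by simp [vx]
  have hv0 : (j : ℝ) * Real.pi = vx j := rfl
  have hf : ∀ᵐ x : ℝ, x ∈ Set.Icc (vx j) (vx (j + 1)) →
      Complex.exp (Complex.I * A * x) * -f x = -phaseMul A f x := by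
    filter_upwards [coeFn_phaseMul A f] with x hx _
    rw [hx]; ring
  constructor
  · rintro ⟨h1, h2, h3⟩
    rw [hv, hv0] at h1 h2 h3
    rw [hasQuasiDerivOn_iff hab] at h2 h3
    rw [ae_restrict_iff' measurableSet_Icc] at h1
    refine ⟨?_, h2, h3.congr hab (fun _ _ => rfl) hf⟩
    filter_upwards [h1, coeFn_phaseMul A ψ] with x hx h hx'
    rw [h, hx hx']
  · rintro ⟨h1, h2, h3⟩
    refine ⟨?_, ?_, ?_⟩
    · rw [hv, hv0, ae_restrict_iff' measurableSet_Icc]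
      filter_upwards [h1, coeFn_phaseMul A ψ] with x hx h hx'
      have := hx hx'
      rw [h] at this
      exact mul_left_cancel₀ (Complex.exp_ne_zero _) this
    · rw [hv, hv0, hasQuasiDerivOn_iff hab]
      exact h2
    · rw [hv, hv0, hasQuasiDerivOn_iff hab]
      refine h3.congr hab (fun _ _ => rfl) ?_
      filter_upwards [hf] with x hx hx'
      rw [hx hx']

lemma LineEdge.combo {j : ℤ} {ψ f ψ' f' : L2R} {u p u' p' : ℝ → ℂ} (a b : ℂ)
    (h : LineEdge j ψ f u p) (h' : LineEdge j ψ' f' u' p') :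
    LineEdge j (a • ψ + b • ψ' : L2R) (a • f + b • f' : L2R) (fun x => a * u x + b * u' x)
      (fun x => a * p x + b * p' x) := by
  have hco : ∀ φ φ' : L2R, ∀ᵐ x, (a • φ + b • φ' : L2R) x = a * φ x + b * φ' x := by
    intro φ φ'
    filter_upwards [coeFn_smul_add a φ (b • φ'), Lp.coeFn_smul b φ'] with x h1 h2
    rw [h1, h2, Pi.smul_apply, smul_eq_mul]
  have hab := vx_le_succ j
  refine ⟨?_, (h.prim_u.const_mul a).add (h'.prim_u.const_mul b), ?_⟩
  · filter_upwards [hco ψ ψ', h.ae_eq, h'.ae_eq] with x h1 h2 h3 hx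
    rw [h1, h2 hx, h3 hx]
  · refine ((h.prim_p.const_mul a).add (h'.prim_p.const_mul b)).congr hab (fun x _ => rfl) ?_
    filter_upwards [hco f f'] with x h1 _
    rw [h1]
    ring

/-! ### The symmetric and the antisymmetric component -/

/-- The symmetric component of a function on the chain. -/
def chainS (A : ℝ) : L2Chain →ₗ[ℂ] L2R :=
  (phaseMul A ∘ₗ LinearMap.fst ℂ L2R L2R + phaseMul (-A) ∘ₗ LinearMap.snd ℂ L2R L2R) ∘ₗ
    (WithLp.linearEquiv 2 ℂ (L2R × L2R)).toLinearMap

/-- The antisymmetric component of a function on the chain. -/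
def chainD (A : ℝ) : L2Chain →ₗ[ℂ] L2R :=
  (phaseMul A ∘ₗ LinearMap.fst ℂ L2R L2R - phaseMul (-A) ∘ₗ LinearMap.snd ℂ L2R L2R) ∘ₗ
    (WithLp.linearEquiv 2 ℂ (L2R × L2R)).toLinearMap

lemma chainS_apply (A : ℝ) (Ψ : L2Chain) :
    chainS A Ψ = phaseMul A Ψ.fst + phaseMul (-A) Ψ.snd := rfl

lemma chainD_apply (A : ℝ) (Ψ : L2Chain) :
    chainD A Ψ = phaseMul A Ψ.fst - phaseMul (-A) Ψ.snd := rfl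

/-- The function on the chain with given symmetric and antisymmetric component. -/
def chainMk (A : ℝ) (s d : L2R) : L2Chain :=
  WithLp.toLp 2 (phaseMul (-A) ((2⁻¹ : ℂ) • (s + d)), phaseMul A ((2⁻¹ : ℂ) • (s - d)))

lemma chainS_mk (A : ℝ) (s d : L2R) : chainS A (chainMk A s d) = s := by
  change phaseMul A (phaseMul (-A) _) + phaseMul (-A) (phaseMul A _) = s
  rw [phaseMul_phaseMul_neg, phaseMul_neg_phaseMul]
  module

lemma chainD_mk (A : ℝ) (s d : L2R) : chainD A (chainMk A s d) = d := by
  change phaseMul A (phaseMul (-A) _) - phaseMul (-A) (phaseMul A _) = d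
  rw [phaseMul_phaseMul_neg, phaseMul_neg_phaseMul]
  module

/-- The sum and difference map is `√2` times a unitary one, whence the factor `1/2`. -/
lemma chain_inner (A : ℝ) (Ψ Φ : L2Chain) : inner ℂ Ψ Φ =
    2⁻¹ * (inner ℂ (chainS A Ψ) (chainS A Φ) + inner ℂ (chainD A Ψ) (chainD A Φ)) := by
  rw [WithLp.prod_inner_apply]
  change inner ℂ Ψ.fst Φ.fst + inner ℂ Ψ.snd Φ.snd = _
  rw [chainS_apply, chainS_apply, chainD_apply, chainD_apply]
  simp only [inner_add_left, inner_add_right, inner_sub_left, inner_sub_right, inner_phaseMul]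
  ring

lemma chain_eq_zero {A : ℝ} {Ψ : L2Chain} (hs : chainS A Ψ = 0) (hd : chainD A Ψ = 0) : Ψ = 0 := by
  have := chain_inner A Ψ Ψ
  rw [hs, hd] at this
  simpa using this

/-- Integrality of `A` enters here: the exponents differ by `2πi` times the integer `A j`, so both
gauge factors agree at the vertices. -/
lemma exp_vertex (A j : ℤ) :
    Complex.exp (Complex.I * ((-(A : ℝ) : ℝ) : ℂ) * ((j * Real.pi : ℝ) : ℂ)) =
      Complex.exp (Complex.I * ((A : ℝ) : ℂ) * ((j * Real.pi : ℝ) : ℂ)) := by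
  rw [Complex.exp_eq_exp_iff_exists_int]
  exact ⟨-(A * j), by push_cast; ring⟩

/-- Equality of the upper and lower values at a vertex means that the difference vanishes there, and
nothing is imposed on its derivative. The sum inherits continuity, and its derivative jumps by `α`
times the vertex value, which is `α/2` times the value of the sum. -/
theorem inHamiltonianGraph_iff {A : ℤ} {α : ℝ} {Ψ F : L2Chain} :
    InHamiltonianGraph A α Ψ F ↔ KPGraph (α / 2) (chainS A Ψ) (chainS A F) ∧
      DirGraph (chainD A Ψ) (chainD A F) := by
  set E : ℝ → ℝ → ℂ := fun B x => Complex.exp (Complex.I * B * x) with hE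
  have hE0 : ∀ B x, E B x ≠ 0 := fun _ _ => Complex.exp_ne_zero _
  have hEv : ∀ j : ℤ, E (-(A : ℝ)) (vx j) = E A (vx j) := fun j => exp_vertex A j
  have hEc : ∀ B x, E (-B) x * E B x = 1 := by
    intro B x
    simp only [hE]
    rw [← Complex.exp_add]
    push_cast
    ring_nf
    simp
  have hv : ∀ j : ℤ, (j : ℝ) * Real.pi = vx j := fun _ => rfl
  constructor
  · rintro ⟨u, p, v, q, h1, h2, h3, h4⟩
    simp only [hv] at h3 h4
    have h1' := fun j => edgeEquation_iff.1 (h1 j)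
    have h2' := fun j => edgeEquation_iff.1 (h2 j)
    refine ⟨⟨fun j x => E A x * u j x + E (-A) x * v j x,
      fun j x => E A x * p j x + E (-A) x * q j x, fun j => ?_, fun j => ?_, fun j => ?_⟩,
      ⟨fun j x => E A x * u j x - E (-A) x * v j x,
      fun j x => E A x * p j x - E (-A) x * q j x, fun j => ?_, fun j => ⟨?_, ?_⟩⟩⟩
    · have := (h1' j).combo 1 1 (h2' j)
      simp only [one_smul, one_mul] at this
      exact this
    · obtain ⟨a1, a2, a3⟩ := h3 (j + 1)
      rw [add_sub_cancel_right] at a2 a3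
      simp only [hEv]
      linear_combination E A (vx (j + 1)) * (-a1 + a2 + a3)
    · obtain ⟨a1, a2, a3⟩ := h3 (j + 1)
      have a4 := h4 (j + 1)
      rw [add_sub_cancel_right] at a2 a3 a4
      simp only [hEv]
      push_cast
      linear_combination E A (vx (j + 1)) * (a4 + α / 2 * (a2 + a3))
    · have := (h1' j).combo 1 (-1) (h2' j)
      simp only [one_smul, one_mul, neg_smul, neg_mul, ← sub_eq_add_neg] at this
      exact this
    · obtain ⟨a1, a2, a3⟩ := h3 j
      simp only [hEv]
      linear_combination E A (vx j) * a1
    · obtain ⟨a1, a2, a3⟩ := h3 (j + 1)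
      rw [add_sub_cancel_right] at a2 a3
      simp only [hEv]
      linear_combination E A (vx (j + 1)) * (a3 - a2)
  · rintro ⟨⟨U, P, h1, h2, h3⟩, ⟨V, Q, h4, h5⟩⟩
    refine ⟨fun j x => E (-A) x * (2⁻¹ * U j x + 2⁻¹ * V j x),
      fun j x => E (-A) x * (2⁻¹ * P j x + 2⁻¹ * Q j x),
      fun j x => E A x * (2⁻¹ * U j x + (-2⁻¹) * V j x),
      fun j x => E A x * (2⁻¹ * P j x + (-2⁻¹) * Q j x), fun j => ?_, fun j => ?_, fun j => ?_,
      fun j => ?_⟩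
    · rw [edgeEquation_iff]
      have := (h1 j).combo 2⁻¹ 2⁻¹ (h4 j)
      have e : ∀ G : L2Chain, (2⁻¹ : ℂ) • chainS A G + (2⁻¹ : ℂ) • chainD A G = phaseMul A G.fst := by
        intro G
        rw [chainS_apply, chainD_apply]
        module
      rw [e, e] at this
      convert this using 2 with x x
      · rw [← mul_assoc, mul_comm (Complex.exp _)]; exact (congrArg (· * _) (hEc A x)).trans (one_mul _)
      · rw [← mul_assoc, mul_comm (Complex.exp _)]; exact (congrArg (· * _) (hEc A x)).trans (one_mul _)
    · rw [edgeEquation_iff]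
      have := (h1 j).combo 2⁻¹ (-2⁻¹) (h4 j)
      have e : ∀ G : L2Chain, (2⁻¹ : ℂ) • chainS A G + (-2⁻¹ : ℂ) • chainD A G =
          phaseMul (-A) G.snd := by
        intro G
        rw [chainS_apply, chainD_apply]
        module
      rw [e, e] at this
      convert this using 2 with x x
      · rw [← mul_assoc]; exact (congrArg (· * _) (hEc A x)).trans (one_mul _)
      · rw [← mul_assoc]; exact (congrArg (· * _) (hEc A x)).trans (one_mul _)
    · obtain ⟨i, rfl⟩ : ∃ i, j = i + 1 := ⟨j - 1, by ring⟩
      simp only [hv, add_sub_cancel_right]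
      have a1 := h2 i
      have a2 := (h5 i).2
      have a3 := (h5 (i + 1)).1
      simp only [hEv]
      refine ⟨?_, ?_, ?_⟩
      · linear_combination E A (vx (i + 1)) * a3
      · linear_combination E A (vx (i + 1)) * (2⁻¹ * a1 + 2⁻¹ * a3 - 2⁻¹ * a2)
      · linear_combination E A (vx (i + 1)) * (2⁻¹ * a1 + 2⁻¹ * a3 + 2⁻¹ * a2)
    · obtain ⟨i, rfl⟩ : ∃ i, j = i + 1 := ⟨j - 1, by ring⟩
      simp only [hv, add_sub_cancel_right]
      have a1 := h2 i
      have a2 := (h5 i).2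
      have a3 := (h5 (i + 1)).1
      have a4 := h3 i
      push_cast at a4
      simp only [hEv]
      linear_combination E A (vx (i + 1)) * (a4 - α / 2 * a1 - α / 2 * a3)

end

noncomputable section

/-! ### The discriminant as a function of the energy -/

lemma discr_congr (β : ℝ) {k k' : ℂ} (h : k ^ 2 = k' ^ 2) : discr β k = discr β k' := by
  rcases sq_eq_sq_iff_eq_or_eq_neg.1 h with rfl | rfl
  · rfl
  · rw [discr, discr, cosK_neg, sinK_neg]

lemma conj_discr (β : ℝ) (k : ℂ) : starRingEnd ℂ (discr β k) = discr β (starRingEnd ℂ k) := by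
  rw [discr, discr, map_add, map_mul, conj_cosK, conj_sinK, map_div₀, Complex.conj_ofReal, map_ofNat]

/-- A square root of the energy. -/
def energyRoot (E : ℝ) : ℂ := if 0 ≤ E then (√E : ℝ) else Complex.I * (√(-E) : ℝ)

lemma energyRoot_sq (E : ℝ) : energyRoot E ^ 2 = E := by
  unfold energyRoot
  split_ifs with h
  · rw [← Complex.ofReal_pow, Real.sq_sqrt h]
  · rw [mul_pow, Complex.I_sq, ← Complex.ofReal_pow, Real.sq_sqrt (by linarith)]
    push_cast
    ring

/-- The discriminant at the energy `E`. -/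
def energyDiscr (β E : ℝ) : ℝ := (discr β (energyRoot E)).re

/-- For real `k²`, conjugation maps `k` to `k` or `-k`, and the discriminant depends on `k²` only;
hence it is real. -/
lemma discr_eq_energyDiscr (β : ℝ) {k : ℂ} {E : ℝ} (h : k ^ 2 = E) :
    discr β k = energyDiscr β E := by
  rw [discr_congr β (h.trans (energyRoot_sq E).symm), energyDiscr, eq_comm]
  refine Complex.conj_eq_iff_re.1 ?_
  rw [conj_discr]
  refine discr_congr β ?_
  rw [← map_pow, energyRoot_sq, Complex.conj_ofReal]

/-- The energies at which the discriminant lies in `[-1, 1]`. -/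
def bandSet (β : ℝ) : Set ℝ := {E | |energyDiscr β E| ≤ 1}

lemma discr_ne_of_notMem {β E : ℝ} (hE : E ∉ bandSet β) {k : ℂ} (h : k ^ 2 = E) (t : ℝ)
    (ht : |t| ≤ 1) : discr β k ≠ t := by
  rw [discr_eq_energyDiscr β h]
  intro h1
  apply hE
  rw [bandSet, Set.mem_ofPred_eq, Complex.ofReal_injective h1]
  exact ht

lemma sinK_ne_zero_of_forall_ne {k : ℂ} {E : ℝ} (h : k ^ 2 = E)
    (hE : ∀ n : ℕ, 1 ≤ n → E ≠ (n : ℝ) ^ 2) : sinK k Real.pi ≠ 0 := by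
  rw [Ne, sinK_pi_eq_zero_iff]
  rintro ⟨n, hn, h1⟩
  apply hE n hn
  rw [h] at h1
  exact_mod_cast h1

lemma discr_I_mul (β : ℝ) {t : ℝ} (ht : t ≠ 0) : discr β (Complex.I * t) =
    ((Real.cosh (t * Real.pi) + β / 2 * (Real.sinh (t * Real.pi) / t) : ℝ) : ℂ) := by
  have ht' : Complex.I * t ≠ 0 := mul_ne_zero Complex.I_ne_zero (by exact_mod_cast ht)
  have htc : (t : ℂ) ≠ 0 := by exact_mod_cast ht
  rw [discr, sinK_eq_div ht', cosK,
    show Complex.I * t * Real.pi = ((t * Real.pi : ℝ) : ℂ) * Complex.I by push_cast; ring,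
    Complex.cos_mul_I, Complex.sin_mul_I]
  push_cast
  congr 2
  field_simp

/-- Far below zero there is no spectrum. -/
lemma exists_energy_below (β : ℝ) : ∃ c : ℝ, c ∉ bandSet β ∧ ∀ n : ℕ, 1 ≤ n → c ≠ (n : ℝ) ^ 2 := by
  -- This choice gives `|β| / (2t) ≤ 1/2`, so the discriminant at `-t²` is at least `cosh x - sinh x
  -- / 2 ≥ cosh x / 2`, with `x = tπ`. This exceeds `1` because `2 cosh x ≥ x + 1` and `x > 3.14`.
  set t := 1 + |β| with ht
  have ht1 : 1 ≤ t := by have := abs_nonneg β; linarith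
  have ht0 : 0 < t := by linarith
  refine ⟨-t ^ 2, fun h => ?_, fun n _ h => ?_⟩
  · have h1 : (Complex.I * t) ^ 2 = ((-t ^ 2 : ℝ) : ℂ) := by
      rw [mul_pow, Complex.I_sq]; push_cast; ring
    have h2 := (discr_eq_energyDiscr β h1).symm.trans (discr_I_mul β ht0.ne')
    have h3 := Complex.ofReal_injective h2
    rw [bandSet, Set.mem_ofPred_eq, h3] at h
    set x := t * Real.pi with hx
    have hx1 : 3.14 < x := by
      have := Real.pi_gt_d2
      nlinarith
    have hs0 : 0 ≤ Real.sinh x := Real.sinh_nonneg_iff.2 (by linarith)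
    have hcs : Real.sinh x ≤ Real.cosh x := Real.sinh_lt_cosh x |>.le
    have hb : |β / 2 * (Real.sinh x / t)| ≤ Real.sinh x / 2 := by
      rw [abs_mul, abs_div, abs_div, abs_of_pos ht0, abs_of_nonneg hs0, abs_two,
        div_mul_div_comm, div_le_div_iff₀ (by positivity) (by positivity)]
      nlinarith [abs_nonneg β]
    have hex : x + 1 ≤ 2 * Real.cosh x := by
      have h5 := Real.add_one_le_exp x
      have h6 := Real.exp_pos (-x)
      rw [Real.cosh_eq]
      linarith
    have h7 := abs_le.1 hb
    have h8 := abs_le.1 h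
    nlinarith
  · have : 0 ≤ (n : ℝ) ^ 2 := sq_nonneg _
    nlinarith

/-! ### Spectral decomposition of the Hamiltonian -/

lemma inGraph_hamiltonian {A : ℤ} {α : ℝ} (x : (hamiltonian A α).domain) :
    KPGraph (α / 2) (chainS A x) (chainS A (hamiltonian A α x)) ∧
      DirGraph (chainD A x) (chainD A (hamiltonian A α x)) := by
  have h := LinearPMap.mem_graph (hamiltonian A α) x
  rw [hamiltonian_graph] at h
  exact inHamiltonianGraph_iff.1 h

lemma exists_hamiltonian_eq {A : ℤ} {α : ℝ} {Ψ F : L2Chain}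
    (h1 : KPGraph (α / 2) (chainS A Ψ) (chainS A F)) (h2 : DirGraph (chainD A Ψ) (chainD A F)) :
    ∃ x : (hamiltonian A α).domain, (x : L2Chain) = Ψ ∧ hamiltonian A α x = F := by
  have h : (Ψ, F) ∈ (hamiltonian A α).graph := by
    rw [hamiltonian_graph]
    exact inHamiltonianGraph_iff.2 ⟨h1, h2⟩
  obtain ⟨x, hx1, hx2⟩ := (LinearPMap.mem_graph_iff _).1 h
  exact ⟨x, hx1, hx2⟩

lemma lineEdge_zero (j : ℤ) : LineEdge j (0 : L2R) (0 : L2R) (fun _ => 0) (fun _ => 0) := by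
  have h0 := Lp.coeFn_zero ℂ 2 (volume : Measure ℝ)
  have hp : IsPrim (vx j) (vx (j + 1)) (fun _ => 0) (fun _ => 0) := by simp [IsPrim]
  refine ⟨?_, hp, hp.congr (vx_le_succ j) (fun _ _ => rfl) ?_⟩
  · filter_upwards [h0] with x hx _ using hx
  · filter_upwards [h0] with x hx _
    rw [hx, Pi.zero_apply, neg_zero]

lemma kpGraph_zero (β : ℝ) : KPGraph β 0 0 :=
  ⟨fun _ _ => 0, fun _ _ => 0, lineEdge_zero, fun _ => rfl, fun _ => by simp⟩

lemma dirGraph_zero : DirGraph 0 0 :=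
  ⟨fun _ _ => 0, fun _ _ => 0, lineEdge_zero, fun _ => ⟨rfl, rfl⟩⟩

theorem hamiltonian_isFormalAdjoint (A : ℤ) (α : ℝ) :
    (hamiltonian A α).IsFormalAdjoint (hamiltonian A α) := by
  intro x y
  obtain ⟨h1, h2⟩ := inGraph_hamiltonian x
  obtain ⟨h3, h4⟩ := inGraph_hamiltonian y
  rw [chain_inner A, chain_inner A, h1.symm h3, h2.symm h4]

lemma surjAt_iff {A : ℤ} {α : ℝ} {z : ℂ} : SurjAt (hamiltonian A α) z ↔
    (∀ g : L2R, ∃ ψ, KPGraph (α / 2) ψ (z • ψ + g)) ∧ ∀ g : L2R, ∃ ψ, DirGraph ψ (z • ψ + g) := by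
  constructor
  · intro h
    refine ⟨fun g => ?_, fun g => ?_⟩
    · obtain ⟨x, hx⟩ := h (chainMk A g 0)
      have h1 := (inGraph_hamiltonian x).1
      rw [sub_eq_iff_eq_add'.1 hx, map_add, map_smul, chainS_mk] at h1
      exact ⟨_, h1⟩
    · obtain ⟨x, hx⟩ := h (chainMk A 0 g)
      have h1 := (inGraph_hamiltonian x).2
      rw [sub_eq_iff_eq_add'.1 hx, map_add, map_smul, chainD_mk] at h1
      exact ⟨_, h1⟩
  · rintro ⟨h1, h2⟩ f
    obtain ⟨ψ, hψ⟩ := h1 (chainS A f)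
    obtain ⟨φ, hφ⟩ := h2 (chainD A f)
    obtain ⟨x, hx1, hx2⟩ := exists_hamiltonian_eq (A := A) (α := α) (Ψ := chainMk A ψ φ)
      (F := z • chainMk A ψ φ + f)
      (by rwa [map_add, map_smul, chainS_mk]) (by rwa [map_add, map_smul, chainD_mk])
    exact ⟨x, by rw [hx1, hx2, add_sub_cancel_left]⟩

lemma surjAt_of_notMem {A : ℤ} {α E : ℝ} (h1 : E ∉ bandSet (α / 2))
    (h2 : ∀ n : ℕ, 1 ≤ n → E ≠ (n : ℝ) ^ 2) : SurjAt (hamiltonian A α) (E : ℂ) := by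
  have hk := energyRoot_sq E
  rw [surjAt_iff, ← hk]
  exact ⟨KPGraph.exists_of_discr (discr_ne_of_notMem h1 hk),
    DirGraph.exists_of_sinK_ne_zero (sinK_ne_zero_of_forall_ne hk h2)⟩

lemma exists_surjAt (A : ℤ) (α : ℝ) : ∃ c : ℝ, SurjAt (hamiltonian A α) (c : ℂ) := by
  obtain ⟨c, h1, h2⟩ := exists_energy_below (α / 2)
  exact ⟨c, surjAt_of_notMem h1 h2⟩

/-- An indirect argument: nonreal points are in the resolvent set of the symmetric operator with `A
= 0` and `α = 2β`, whereas a discriminant in `[-1, 1]` would contradict surjectivity. -/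
lemma discr_ne_of_im_ne_zero (β : ℝ) {k : ℂ} (hk : (k ^ 2).im ≠ 0) (t : ℝ) (ht : |t| ≤ 1) :
    discr β k ≠ t := by
  intro h
  obtain ⟨c, hc⟩ := exists_surjAt 0 (2 * β)
  have h1 := (inResolventSet_of_im_ne_zero (hamiltonian_isFormalAdjoint 0 (2 * β)) hc hk).surjAt
  rw [surjAt_iff, mul_div_cancel_left₀ β two_ne_zero] at h1
  exact KPGraph.not_surjective ht h h1.1

/-- The Kronig–Penney operator has no eigenvalues. -/
theorem KPGraph.eq_zero {β : ℝ} {k : ℂ} {ψ : L2R} (h : KPGraph β ψ (k ^ 2 • ψ)) : ψ = 0 := by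
  by_cases hk : ∃ t : ℝ, |t| ≤ 1 ∧ discr β k = t
  · obtain ⟨t, ht, hk⟩ := hk
    exact KPGraph.eq_zero_of_discr_mem ht hk h
  · push Not at hk
    -- Outside of `[-1, 1]` the equation at the conjugate energy is solvable with right-hand side
    -- `ψ`. Pairing its solution with the eigenvector `ψ` gives `⟪ψ, ψ⟫ = 0`.
    obtain ⟨φ, hφ⟩ := KPGraph.exists_of_discr (β := β) (k := starRingEnd ℂ k) (fun t ht h1 => by
      apply hk t ht
      rw [← conj_discr] at h1
      have := congrArg (starRingEnd ℂ) h1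
      rwa [Complex.conj_conj, Complex.conj_ofReal] at this) ψ
    have h1 := h.symm hφ
    rw [inner_smul_left, inner_add_right, inner_smul_right, map_pow, left_eq_add] at h1
    exact inner_self_eq_zero.1 h1

end

noncomputable section

/-! ### Eigenvalues -/

lemma mem_opEigenspace_iff {E : Type*} [NormedAddCommGroup E] [InnerProductSpace ℂ E]
    {T : E →ₗ.[ℂ] E} {z : ℂ} {f : E} :
    f ∈ opEigenspace T z ↔ ∃ x : T.domain, (x : E) = f ∧ T x = z • f := by
  simp only [opEigenspace, Submodule.mem_map, LinearMap.mem_ker, LinearMap.sub_apply,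
    LinearMap.smul_apply, Submodule.subtype_apply]
  constructor
  · rintro ⟨x, h1, h2⟩
    refine ⟨x, h2, ?_⟩
    rw [← h2]
    exact sub_eq_zero.1 h1
  · rintro ⟨x, h1, h2⟩
    refine ⟨x, ?_, h1⟩
    rw [← h1] at h2
    exact sub_eq_zero.2 h2

/-- The Kronig–Penney component has no eigenvectors, so every eigenfunction of the chain is
antisymmetric. -/
lemma mem_opEigenspace_hamiltonian {A : ℤ} {α : ℝ} {z : ℂ} {Ψ : L2Chain} :
    Ψ ∈ opEigenspace (hamiltonian A α) z ↔
      chainS A Ψ = 0 ∧ DirGraph (chainD A Ψ) (z • chainD A Ψ) := by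
  obtain ⟨k, rfl⟩ := IsAlgClosed.exists_pow_nat_eq z (n := 2) two_pos
  rw [mem_opEigenspace_iff]
  constructor
  · rintro ⟨x, rfl, h2⟩
    obtain ⟨h3, h4⟩ := inGraph_hamiltonian x
    rw [h2, map_smul] at h3 h4
    exact ⟨h3.eq_zero, h4⟩
  · rintro ⟨h1, h2⟩
    refine exists_hamiltonian_eq ?_ ?_
    · rw [map_smul, h1, smul_zero]
      exact kpGraph_zero _
    · rwa [map_smul]

/-- The eigenfunctions supported on a single ring. -/
lemma exists_ring_eigenvector (A : ℤ) (α : ℝ) {n : ℕ} (hn : 1 ≤ n) (j : ℤ) :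
    ∃ e ∈ opEigenspace (hamiltonian A α) ((n : ℂ) ^ 2), e ≠ 0 ∧
      (∀ Φ : L2Chain, inner ℂ e Φ = 2⁻¹ * edgeS n (chainD A Φ) j) ∧
      ∀ i, i ≠ j → edgeS n (chainD A e) i = 0 := by
  obtain ⟨ψ, h1, h2, h3, h4⟩ := DirGraph.exists_eigenvector hn j
  refine ⟨chainMk A 0 ψ, ?_, fun h => ?_, fun Φ => ?_, fun i hi => ?_⟩
  · rw [mem_opEigenspace_hamiltonian, chainS_mk, chainD_mk]
    exact ⟨rfl, h1⟩
  · apply h4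
    rw [← chainD_mk A 0 ψ, h, map_zero]
  · rw [chain_inner A, chainS_mk, chainD_mk, inner_zero_left, zero_add, h2]
  · rw [chainD_mk, h3 i hi]

theorem eigenvalues_hamiltonian (A : ℤ) (α : ℝ) :
    {z : ℂ | opEigenspace (hamiltonian A α) z ≠ ⊥} = {z | ∃ k : ℕ, 1 ≤ k ∧ z = (k : ℂ) ^ 2} := by
  ext z
  simp only [Set.mem_ofPred_eq]
  constructor
  · intro h
    by_contra hz
    apply h
    obtain ⟨k, rfl⟩ := IsAlgClosed.exists_pow_nat_eq z (n := 2) two_pos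
    rw [Submodule.eq_bot_iff]
    intro Ψ hΨ
    obtain ⟨h1, h2⟩ := mem_opEigenspace_hamiltonian.1 hΨ
    exact chain_eq_zero h1 (h2.eq_zero (by rwa [Ne, sinK_pi_eq_zero_iff]))
  · rintro ⟨n, hn, rfl⟩ h
    obtain ⟨e, h1, h2, -⟩ := exists_ring_eigenvector A α hn 0
    rw [h] at h1
    exact h2 ((Submodule.mem_bot ℂ).1 h1)

/-- The eigenfunctions supported on distinct rings are orthogonal. -/
theorem infinite_multiplicity (A : ℤ) (α : ℝ) {n : ℕ} (hn : 1 ≤ n) :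
    ¬ FiniteDimensional ℂ (opEigenspace (hamiltonian A α) ((n : ℂ) ^ 2)) := by
  intro hfin
  choose e h1 h2 h3 h4 using exists_ring_eigenvector A α hn
  have hli : LinearIndependent ℂ e := linearIndependent_of_ne_zero_of_inner_eq_zero h2
    fun i j hij => (h3 i (e j)).trans (by rw [h4 j i hij, mul_zero])
  have hli' : LinearIndependent ℂ fun j =>
      (⟨e j, h1 j⟩ : opEigenspace (hamiltonian A α) ((n : ℂ) ^ 2)) :=
    LinearIndependent.of_comp (Submodule.subtype _) hli
  exact (inferInstance : Infinite ℤ).not_finite hli'.finite_of_isNoetherian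

/-! ### The spectrum -/

theorem opSpectrum_hamiltonian (A : ℤ) (α : ℝ) : opSpectrum (hamiltonian A α) =
    Complex.ofReal '' ({e : ℝ | ∃ k : ℕ, 1 ≤ k ∧ e = (k : ℝ) ^ 2} ∪ bandSet (α / 2)) := by
  have hT := hamiltonian_isFormalAdjoint A α
  obtain ⟨c, hc⟩ := exists_surjAt A α
  ext z
  constructor
  · intro hz
    have him : z.im = 0 := by
      by_contra h
      exact hz (inResolventSet_of_im_ne_zero hT hc h)
    have hre : ((z.re : ℝ) : ℂ) = z := Complex.ext (by simp) (by simp [him])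
    refine ⟨z.re, ?_, hre⟩
    by_contra h
    simp only [Set.mem_union, Set.mem_ofPred_eq, not_or, not_exists, not_and] at h
    rw [← hre] at hz
    exact hz (inResolventSet_ofReal hT (surjAt_of_notMem h.2 h.1))
  · rintro ⟨E, hE, rfl⟩ hres
    rcases hE with ⟨n, hn, rfl⟩ | hE
    · obtain ⟨e, h1, h2, -⟩ := exists_ring_eigenvector A α hn 0
      obtain ⟨x, rfl, hx⟩ := mem_opEigenspace_iff.1 h1
      refine h2 (hres.eq_zero ?_)
      rw [hx]
      push_cast
      rfl
    · have h1 := (surjAt_iff.1 hres.surjAt).1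
      have hk := energyRoot_sq E
      rw [← hk] at h1
      exact KPGraph.not_surjective hE (discr_eq_energyDiscr _ hk) h1

/-! ### The absolutely continuous subspace -/

/-- The pairings with the ring eigenfunctions are the sine coefficients of `chainD A Φ` on the
edges, and the sines are complete. -/
lemma mem_orthogonal_eigenspaces_iff {A : ℤ} {α : ℝ} {Φ : L2Chain} :
    Φ ∈ (⨆ z : ℂ, opEigenspace (hamiltonian A α) z)ᗮ ↔ chainD A Φ = 0 := by
  rw [Submodule.mem_orthogonal]
  constructor
  · intro h
    refine L2R.eq_zero_of_edgeS fun n hn j => ?_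
    obtain ⟨e, h1, -, h2, -⟩ := exists_ring_eigenvector A α hn j
    have h3 := h e (Submodule.mem_iSup_of_mem _ h1)
    rw [h2] at h3
    simpa using h3
  · intro h u hu
    have hle : (⨆ z : ℂ, opEigenspace (hamiltonian A α) z) ≤ LinearMap.ker (chainS A) :=
      iSup_le fun z Ψ hΨ => (mem_opEigenspace_hamiltonian.1 hΨ).1
    rw [chain_inner A, h, LinearMap.mem_ker.1 (hle hu), inner_zero_left, inner_zero_right]
    simp

/-- Since `κ²` is not real, `z = k²` stays away from it as `z` approaches the real axis. The
resolvent form of the dipole vector is therefore locally bounded, uniformly down to the axis. -/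
lemma exists_ac_spectralMeasure {A : ℤ} {α : ℝ} {κ : ℂ} (hκ : (κ ^ 2).im ≠ 0) {m : ℤ} {f : L2R}
    (hf : IsGam κ (dipole m) f) :
    ∃ μ : Measure ℝ, IsSpectralMeasure (hamiltonian A α) (chainMk A f 0) μ ∧ μ ≪ volume := by
  have hT := hamiltonian_isFormalAdjoint A α
  obtain ⟨c, hc⟩ := exists_surjAt A α
  obtain ⟨μ, hμ⟩ := exists_isSpectralMeasure hT hc (chainMk A f 0)
  have := hμ.finite
  refine ⟨μ, hμ, absolutelyContinuous_of_stieltjes_bounded fun K => ?_⟩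
  -- For `0 < Im z < δ` the distance from `z` to `κ²` is at least `δ`.
  set δ := |(κ ^ 2).im| / 2 with hδ
  have hδ0 : 0 < δ := by positivity
  -- The radius comes from `‖k‖ ≤ ‖k‖² + 1` and `‖k‖² = ‖z‖ ≤ K + δ`.
  obtain ⟨C, hC⟩ := exists_resolvent_bound (α / 2) κ m hf (K + δ + 1) hδ0
  refine ⟨2⁻¹ * C, δ, hδ0, fun x hx ε h1 h2 => ?_⟩
  set z : ℂ := x + ε * Complex.I with hz
  have hzim : z.im = ε := by simp [hz]
  have hz0 : z.im ≠ 0 := by rw [hzim]; exact h1.ne'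
  obtain ⟨k, hk⟩ := IsAlgClosed.exists_pow_nat_eq z (n := 2) two_pos
  have hzn : ‖z‖ ≤ K + δ := by
    refine (norm_add_le _ _).trans (add_le_add ?_ ?_)
    · rw [Complex.norm_real, Real.norm_eq_abs]; exact abs_le.2 hx
    · rw [norm_mul, Complex.norm_I, mul_one, Complex.norm_real, Real.norm_eq_abs, abs_of_pos h1]
      exact h2.le
  have hkn : ‖k‖ ≤ K + δ + 1 := by
    have h3 : ‖k‖ ^ 2 = ‖z‖ := by rw [← norm_pow, hk]
    nlinarith [sq_nonneg (‖k‖ - 1), norm_nonneg k, sq_nonneg (‖k‖ - 1/2)]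
  have hη : δ ≤ ‖κ ^ 2 - k ^ 2‖ := by
    refine le_trans ?_ (Complex.abs_im_le_norm _)
    rw [hk, Complex.sub_im, hzim]
    have h4 := abs_sub_abs_le_abs_sub (κ ^ 2).im ε
    rw [abs_of_pos h1] at h4
    linarith
  obtain ⟨ψ, hψ, hb⟩ := hC k hkn hη (discr_ne_of_im_ne_zero _ (by rwa [hk]))
  rw [hk] at hψ
  obtain ⟨g, hg1, hg2⟩ := hμ.stieltjes z hz0
  obtain ⟨y, hy1, hy2⟩ := exists_hamiltonian_eq (A := A) (α := α) (Ψ := chainMk A ψ 0)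
    (F := z • chainMk A ψ 0 + chainMk A f 0)
    (by rwa [map_add, map_smul, chainS_mk, chainS_mk])
    (by rw [map_add, map_smul, chainD_mk, chainD_mk, smul_zero, add_zero]; exact dirGraph_zero)
  have hgy : g = y := eq_of_sub_smul_eq hT hz0 (by rw [hg1, hy1, hy2, add_sub_cancel_left])
  rw [← hg2, hgy, hy1, chain_inner A, chainS_mk, chainS_mk, chainD_mk, inner_zero_left, add_zero,
    norm_mul]
  norm_num
  exact hb

/-- Absolutely continuous vectors are orthogonal to the eigenvectors, so their antisymmetric
component vanishes. Conversely, the part of a symmetric vector orthogonal to the absolutely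
continuous subspace is again symmetric and orthogonal to all dipole vectors, hence zero. -/
theorem mem_acSubspace_iff {A : ℤ} {α : ℝ} {Φ : L2Chain} :
    Φ ∈ acSubspace (hamiltonian A α) ↔ chainD A Φ = 0 := by
  have hT := hamiltonian_isFormalAdjoint A α
  have hle : acSubspace (hamiltonian A α) ≤ (⨆ z : ℂ, opEigenspace (hamiltonian A α) z)ᗮ := by
    refine Submodule.topologicalClosure_minimal _ (Submodule.span_le.2 ?_)
      (Submodule.isClosed_orthogonal _)
    rintro f ⟨μ, hμ, hac⟩
    refine mem_orthogonal_eigenspaces_iff.2 (L2R.eq_zero_of_edgeS fun n hn j => ?_)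
    obtain ⟨e, h1, -, h2, -⟩ := exists_ring_eigenvector A α hn j
    obtain ⟨x, rfl, hx⟩ := mem_opEigenspace_iff.1 h1
    have h3 := inner_eigenvector_eq_zero hT hμ hac (l := (n : ℝ) ^ 2) (e := x) (by
      rw [hx]; push_cast; rfl)
    rw [h2] at h3
    simpa using h3
  refine ⟨fun h => mem_orthogonal_eigenspaces_iff.1 (hle h), fun h => ?_⟩
  have : CompleteSpace (acSubspace (hamiltonian A α)) := by
    unfold acSubspace
    infer_instance
  obtain ⟨y, hy, z, hz, rfl⟩ := Submodule.exists_add_mem_mem_orthogonal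
    (K := acSubspace (hamiltonian A α)) Φ
  have hzD : chainD A z = 0 := by
    have := mem_orthogonal_eigenspaces_iff.1 (hle hy)
    rwa [map_add, this, zero_add] at h
  have hz0 : z = 0 := by
    refine chain_eq_zero (A := A) (L2R.eq_zero_of_inner_dipole fun κ m f hκ hf => ?_) hzD
    have h1 : chainMk A f 0 ∈ acSubspace (hamiltonian A α) :=
      Submodule.le_topologicalClosure _ (Submodule.subset_span (exists_ac_spectralMeasure hκ hf))
    have h2 := (Submodule.mem_orthogonal _ _).1 hz _ h1
    rw [chain_inner A, chainS_mk, chainD_mk, inner_zero_left, add_zero] at h2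
    simpa using h2
  rw [hz0, add_zero]
  exact hy

theorem ppSubspace_sup_acSubspace (A : ℤ) (α : ℝ) :
    (ppSubspace (hamiltonian A α) ⊔ acSubspace (hamiltonian A α)).topologicalClosure = ⊤ := by
  rw [Submodule.topologicalClosure_eq_top_iff, Submodule.eq_bot_iff]
  intro Φ hΦ
  rw [← Submodule.inf_orthogonal, Submodule.mem_inf, ppSubspace, Submodule.orthogonal_closure,
    mem_orthogonal_eigenspaces_iff] at hΦ
  have h1 : Φ ∈ acSubspace (hamiltonian A α) := mem_acSubspace_iff.2 hΦ.1
  exact inner_self_eq_zero.1 ((Submodule.mem_orthogonal _ _).1 hΦ.2 Φ h1)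

/-! ### The absolutely continuous spectrum -/

lemma mem_opPart_graph_iff {E : Type*} [NormedAddCommGroup E] [InnerProductSpace ℂ E]
    {T : E →ₗ.[ℂ] E} {K : Submodule ℂ E} {x y : K} :
    (x, y) ∈ (opPart T K).graph ↔ ((x : E), (y : E)) ∈ T.graph := by
  rw [opPart, Submodule.toLinearPMap_graph_eq]
  · rfl
  · rintro ⟨a, b⟩ h (rfl : a = 0)
    have h1 : ((0 : E), (b : E)) ∈ T.graph := h
    exact Subtype.ext (T.graph_fst_eq_zero_snd h1 rfl)

/-- On the subspace `chainD = 0` the map `chainS` identifies the part of the Hamiltonian with the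
Kronig–Penney operator and multiplies inner products by `2`. Its resolvent set is decided by the
discriminant. -/
theorem acSpectrum_hamiltonian (A : ℤ) (α : ℝ) : acSpectrum (hamiltonian A α) = bandSet (α / 2) := by
  set K := acSubspace (hamiltonian A α) with hK
  have hcomp : CompleteSpace K := by
    rw [hK]
    unfold acSubspace
    infer_instance
  have hgr : ∀ x : (opPart (hamiltonian A α) K).domain, KPGraph (α / 2) (chainS A ((x : K) : L2Chain))
      (chainS A ((opPart (hamiltonian A α) K x : K) : L2Chain)) := by
    intro x
    have h1 := mem_opPart_graph_iff.1 (LinearPMap.mem_graph (opPart (hamiltonian A α) K) x)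
    rw [hamiltonian_graph] at h1
    exact (inHamiltonianGraph_iff.1 h1).1
  have hin : ∀ x y : K, inner ℂ x y = 2⁻¹ * inner ℂ (chainS A (x : L2Chain)) (chainS A (y : L2Chain)) := by
    intro x y
    rw [Submodule.coe_inner, chain_inner A, mem_acSubspace_iff.1 x.2, inner_zero_left, add_zero]
  have hT : (opPart (hamiltonian A α) K).IsFormalAdjoint (opPart (hamiltonian A α) K) := by
    intro x y
    rw [hin, hin, (hgr x).symm (hgr y)]
  have hmk : ∀ g : L2R, chainMk A g 0 ∈ K := fun g => mem_acSubspace_iff.2 (chainD_mk _ _ _)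
  ext E
  have hk := energyRoot_sq E
  constructor
  · intro hE
    by_contra hb
    refine hE (inResolventSet_ofReal hT fun f => ?_)
    obtain ⟨ψ, hψ⟩ := KPGraph.exists_of_discr (discr_ne_of_notMem hb hk) (chainS A (f : L2Chain))
    rw [hk] at hψ
    have h1 : ((⟨chainMk A ψ 0, hmk ψ⟩ : K), (E : ℂ) • (⟨chainMk A ψ 0, hmk ψ⟩ : K) + f) ∈
        (opPart (hamiltonian A α) K).graph := by
      rw [mem_opPart_graph_iff, hamiltonian_graph]
      refine inHamiltonianGraph_iff.2 ⟨?_, ?_⟩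
      · simp only [Submodule.coe_add, Submodule.coe_smul, map_add, map_smul, chainS_mk]
        exact hψ
      · simp only [Submodule.coe_add, Submodule.coe_smul, map_add, map_smul, chainD_mk,
          mem_acSubspace_iff.1 f.2, smul_zero, add_zero]
        exact dirGraph_zero
    obtain ⟨x, hx1, hx2⟩ := (LinearPMap.mem_graph_iff _).1 h1
    refine ⟨x, ?_⟩
    rw [hx2, hx1, add_sub_cancel_left]
  · intro hE hres
    refine KPGraph.not_surjective hE (discr_eq_energyDiscr _ hk) fun g => ?_
    obtain ⟨x, hx⟩ := hres.surjAt (⟨chainMk A g 0, hmk g⟩ : K)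
    have h1 := hgr x
    rw [sub_eq_iff_eq_add'.1 hx] at h1
    simp only [Submodule.coe_add, Submodule.coe_smul, map_add, map_smul, chainS_mk] at h1
    rw [hk]
    exact ⟨_, h1⟩

theorem sUnion_spectralBands (A : ℤ) (α : ℝ) :
    ⋃₀ {B : Set ℝ | IsSpectralBand (hamiltonian A α) B} = bandSet (α / 2) := by
  rw [← acSpectrum_hamiltonian A α]
  ext E
  constructor
  · rintro ⟨B, ⟨x, -, rfl⟩, hE⟩
    exact connectedComponentIn_subset _ _ hE
  · intro hE
    exact ⟨_, ⟨E, hE, rfl⟩, mem_connectedComponentIn hE⟩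

end

noncomputable section

/-! ### Bands above the first eigenvalue and for repulsive coupling -/

/-- Components of subsets of the line are order connected. It therefore suffices to exhibit points
outside of `S` arbitrarily close to both ends of the interval, or at least between it and any
further candidate. -/
lemma connectedComponentIn_eq_Icc {S : Set ℝ} {a b x : ℝ} (hx : x ∈ Set.Icc a b)
    (hS : Set.Icc a b ⊆ S) (hl : ∀ y < a, ∃ z ∈ Set.Ico y a, z ∉ S)
    (hr : ∀ y, b < y → ∃ z ∈ Set.Ioc b y, z ∉ S) : connectedComponentIn S x = Set.Icc a b := by
  refine Set.Subset.antisymm (fun y hy => ?_) (isPreconnected_Icc.subset_connectedComponentIn hx hS)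
  have hxS := mem_connectedComponentIn (hS hx)
  have hoc := (isPreconnected_connectedComponentIn (x := x) (F := S)).ordConnected
  have hsub := connectedComponentIn_subset S x
  refine ⟨?_, ?_⟩
  · by_contra h
    obtain ⟨z, hz, hzS⟩ := hl y (not_le.1 h)
    exact hzS (hsub (hoc.out hy hxS ⟨hz.1, hz.2.le.trans hx.1⟩))
  · by_contra h
    obtain ⟨z, hz, hzS⟩ := hr y (not_le.1 h)
    exact hzS (hsub (hoc.out hxS hy ⟨hx.2.trans hz.1.le, hz.2⟩))

lemma energyDiscr_sq (β : ℝ) {k : ℝ} (hk : k ≠ 0) : energyDiscr β (k ^ 2) =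
    Real.cos (k * Real.pi) + β / 2 * (Real.sin (k * Real.pi) / k) := by
  have hkc : (k : ℂ) ≠ 0 := by exact_mod_cast hk
  have h1 := discr_eq_energyDiscr β (k := k) (E := k ^ 2) (by push_cast; rfl)
  apply Complex.ofReal_injective
  rw [← h1, discr, sinK_eq_div hkc, cosK]
  push_cast
  rfl

/-- At this energy the discriminant is `(-1)^n (cos 2y + β/(2k) sin 2y)`. The half-angle formulas
factor one plus the bracket as `2 cos y (cos y + β/(2k) sin y)` and one minus it as `2 sin y (sin y
- β/(2k) cos y)`. Taking the product removes the sign `(-1)^n`. -/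
lemma sq_mem_bandSet_iff (β : ℝ) {k : ℝ} (hk : 0 < k) (n : ℕ) {y : ℝ}
    (hy : k * Real.pi = 2 * y + n * Real.pi) : k ^ 2 ∈ bandSet β ↔
      0 ≤ (Real.sin y * Real.cos y) * ((k * Real.cos y + β / 2 * Real.sin y) *
        (k * Real.sin y - β / 2 * Real.cos y)) := by
  have hs : ((-1 : ℝ) ^ n) ^ 2 = 1 := by rw [← pow_mul, mul_comm, pow_mul]; simp
  have h1 : 1 - energyDiscr β (k ^ 2) ^ 2 = 4 / k ^ 2 * ((Real.sin y * Real.cos y) *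
      ((k * Real.cos y + β / 2 * Real.sin y) * (k * Real.sin y - β / 2 * Real.cos y))) := by
    rw [energyDiscr_sq β hk.ne', hy, Real.cos_add_nat_mul_pi, Real.sin_add_nat_mul_pi,
      Real.cos_two_mul, Real.sin_two_mul]
    have h2 := Real.sin_sq_add_cos_sq y
    set C := Real.cos y
    set D := Real.sin y
    have h3 : ((-1 : ℝ) ^ n * (2 * C ^ 2 - 1) + β / 2 * ((-1) ^ n * (2 * D * C) / k)) ^ 2 =
        ((-1 : ℝ) ^ n) ^ 2 * ((2 * C ^ 2 - 1) + β / 2 * ((2 * D * C) / k)) ^ 2 := by ring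
    rw [h3, hs, one_mul]
    have hC : C ^ 2 = 1 - D ^ 2 := by linarith
    field_simp
    ring_nf
    have hC3 : C ^ 3 = C * (1 - D ^ 2) := by rw [← hC]; ring
    have hC4 : C ^ 4 = (1 - D ^ 2) ^ 2 := by rw [← hC]; ring
    simp only [hC3, hC4, hC]
    ring
  rw [bandSet, Set.mem_ofPred_eq, ← sq_le_one_iff_abs_le_one, ← sub_nonneg, h1]
  exact mul_nonneg_iff_of_pos_left (by positivity)

lemma half_phase_mem {n : ℕ} {k : ℝ} (h1 : (n : ℝ) < k) (h2 : k < n + 1) :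
    (k - n) * (Real.pi / 2) ∈ Set.Ioo 0 (Real.pi / 2) := by
  have := Real.pi_pos
  constructor
  · have : 0 < k - n := by linarith
    positivity
  · nlinarith

/-- For `β > 0` and `y` in `(0, π/2)` three of the four factors are positive, so the remaining one
decides. -/
lemma sq_mem_bandSet_iff_of_pos {β : ℝ} (hβ : 0 < β) {n : ℕ} {k : ℝ} (h1 : (n : ℝ) < k)
    (h2 : k < n + 1) : k ^ 2 ∈ bandSet β ↔ 0 ≤ k * Real.sin ((k - n) * (Real.pi / 2)) -
      β / 2 * Real.cos ((k - n) * (Real.pi / 2)) := by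
  have hk : 0 < k := lt_of_le_of_lt (Nat.cast_nonneg n) h1
  have hy := half_phase_mem h1 h2
  rw [sq_mem_bandSet_iff β hk n (y := (k - n) * (Real.pi / 2)) (by ring)]
  have hs := Real.sin_pos_of_pos_of_lt_pi hy.1 (by linarith [hy.2, Real.pi_pos])
  have hc := Real.cos_pos_of_mem_Ioo ⟨by linarith [hy.1, Real.pi_pos], hy.2⟩
  rw [mul_nonneg_iff_of_pos_left (by positivity), mul_nonneg_iff_of_pos_left (by positivity)]

lemma sq_mem_bandSet_iff_of_neg {β : ℝ} (hβ : β < 0) {n : ℕ} {k : ℝ} (h1 : (n : ℝ) < k)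
    (h2 : k < n + 1) : k ^ 2 ∈ bandSet β ↔ 0 ≤ k * Real.cos ((k - n) * (Real.pi / 2)) +
      β / 2 * Real.sin ((k - n) * (Real.pi / 2)) := by
  have hk : 0 < k := lt_of_le_of_lt (Nat.cast_nonneg n) h1
  have hy := half_phase_mem h1 h2
  rw [sq_mem_bandSet_iff β hk n (y := (k - n) * (Real.pi / 2)) (by ring)]
  have hs := Real.sin_pos_of_pos_of_lt_pi hy.1 (by linarith [hy.2, Real.pi_pos])
  have hc := Real.cos_pos_of_mem_Ioo ⟨by linarith [hy.1, Real.pi_pos], hy.2⟩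
  have h3 : 0 < k * Real.sin ((k - n) * (Real.pi / 2)) -
      β / 2 * Real.cos ((k - n) * (Real.pi / 2)) := by
    have : 0 < -β / 2 * Real.cos ((k - n) * (Real.pi / 2)) := by
      have : 0 < -β := by linarith
      positivity
    have := mul_pos hk hs
    linarith
  rw [mul_nonneg_iff_of_pos_left (by positivity), mul_nonneg_iff_of_pos_right h3]

lemma nat_sq_mem_bandSet (β : ℝ) {n : ℕ} (hn : 1 ≤ n) : ((n : ℝ)) ^ 2 ∈ bandSet β := by
  have hk : (0 : ℝ) < n := by exact_mod_cast hn
  rw [sq_mem_bandSet_iff β hk n (y := 0) (by ring)]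
  simp

/-- Repulsive coupling: the part of the band set between two eigenvalues. -/
theorem exists_band_of_pos {β : ℝ} (hβ : 0 < β) (n : ℕ) : ∃ a : ℝ, (n : ℝ) ^ 2 < a ∧
    a < ((n : ℝ) + 1) ^ 2 ∧ ∀ E, (n : ℝ) ^ 2 < E → E ≤ ((n : ℝ) + 1) ^ 2 →
      (E ∈ bandSet β ↔ a ≤ E) := by
  have hpi := Real.pi_pos
  have hn : (0 : ℝ) ≤ n := Nat.cast_nonneg n
  set H : ℝ → ℝ := fun k => k * Real.sin ((k - n) * (Real.pi / 2)) -
    β / 2 * Real.cos ((k - n) * (Real.pi / 2)) with hH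
  have hcont : Continuous H := by simp only [hH]; fun_prop
  have hmono : StrictMonoOn H (Set.Icc (n : ℝ) (n + 1)) := by
    intro k hk k' hk' hkk
    have m1 : (k - n) * (Real.pi / 2) ∈ Set.Icc 0 (Real.pi / 2) :=
      ⟨mul_nonneg (by linarith [hk.1]) (by positivity), by nlinarith [hk.2]⟩
    have m2 : (k' - n) * (Real.pi / 2) ∈ Set.Icc 0 (Real.pi / 2) :=
      ⟨mul_nonneg (by linarith [hk'.1]) (by positivity), by nlinarith [hk'.2]⟩
    have m3 : (k - n) * (Real.pi / 2) < (k' - n) * (Real.pi / 2) := by gcongr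
    have c1 : Real.cos ((k' - n) * (Real.pi / 2)) < Real.cos ((k - n) * (Real.pi / 2)) :=
      Real.strictAntiOn_cos ⟨m1.1, by linarith [m1.2]⟩ ⟨m2.1, by linarith [m2.2]⟩ m3
    have s1 : Real.sin ((k - n) * (Real.pi / 2)) ≤ Real.sin ((k' - n) * (Real.pi / 2)) :=
      (Real.strictMonoOn_sin ⟨by linarith [m1.1], m1.2⟩ ⟨by linarith [m2.1], m2.2⟩ m3).le
    have s0 : 0 ≤ Real.sin ((k - n) * (Real.pi / 2)) :=
      Real.sin_nonneg_of_nonneg_of_le_pi m1.1 (by linarith [m1.2])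
    have p1 : k * Real.sin ((k - n) * (Real.pi / 2)) ≤ k' * Real.sin ((k' - n) * (Real.pi / 2)) :=
      mul_le_mul hkk.le s1 s0 (by linarith [hk'.1])
    have p2 := mul_lt_mul_of_pos_left c1 (half_pos hβ)
    simp only [hH]
    linarith
  have h0 : H n < 0 := by simp [hH]; linarith
  have h1 : 0 < H (n + 1) := by
    simp only [hH, add_sub_cancel_left, one_mul, Real.sin_pi_div_two, Real.cos_pi_div_two]
    linarith
  obtain ⟨a, ha, ha0⟩ := intermediate_value_Icc (by linarith : (n : ℝ) ≤ n + 1) hcont.continuousOn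
    (⟨h0.le, h1.le⟩ : (0 : ℝ) ∈ Set.Icc (H n) (H (n + 1)))
  have han : (n : ℝ) < a := lt_of_le_of_ne ha.1 (by rintro rfl; linarith)
  have han1 : a < n + 1 := lt_of_le_of_ne ha.2 (by intro h; rw [h] at ha0; linarith)
  refine ⟨a ^ 2, by gcongr, by gcongr; linarith, fun E hE1 hE2 => ?_⟩
  have hE0 : 0 ≤ E := (sq_nonneg _).trans hE1.le
  obtain ⟨k, hk0, rfl⟩ : ∃ k, 0 ≤ k ∧ E = k ^ 2 := ⟨√E, Real.sqrt_nonneg _, (Real.sq_sqrt hE0).symm⟩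
  have hk1 : (n : ℝ) < k := lt_of_pow_lt_pow_left₀ 2 hk0 hE1
  have hk2 : k ≤ n + 1 := le_of_sq_le_sq hE2 (by linarith)
  rw [pow_le_pow_iff_left₀ (by linarith) hk0 two_ne_zero]
  rcases hk2.eq_or_lt with h | h
  · rw [h]
    refine iff_of_true ?_ ha.2
    exact_mod_cast nat_sq_mem_bandSet β (Nat.le_add_left 1 n)
  · rw [sq_mem_bandSet_iff_of_pos hβ hk1 h, ← ha0]
    exact hmono.le_iff_le ha ⟨hk1.le, h.le⟩

/-- Attractive coupling: the part of the band set between two eigenvalues. -/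
theorem exists_band_of_neg {β : ℝ} (hβ : β < 0) {n : ℕ} (hn : 1 ≤ n) : ∃ b : ℝ, (n : ℝ) ^ 2 < b ∧
    b < ((n : ℝ) + 1) ^ 2 ∧ ∀ E, (n : ℝ) ^ 2 ≤ E → E < ((n : ℝ) + 1) ^ 2 →
      (E ∈ bandSet β ↔ E ≤ b) := by
  have hpi := Real.pi_pos
  have hn0 : (1 : ℝ) ≤ n := by exact_mod_cast hn
  set G : ℝ → ℝ := fun k => k * Real.cos ((k - n) * (Real.pi / 2)) +
    β / 2 * Real.sin ((k - n) * (Real.pi / 2)) with hG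
  have hcont : Continuous G := by simp only [hG]; fun_prop
  -- `G` may increase near `k = n`, so monotonicity of `k cot y` is used instead: `k' cot z < k cot
  -- y`. This amounts to `t cos z sin y < k (π/2) sin t` with `t = z - y`, which follows from `t <
  -- tan t`, `cos z < cos t` and `sin y ≤ y ≤ kπ/2`.
  have hanti : ∀ k k' : ℝ, (n : ℝ) < k → k < k' → k' < n + 1 → 0 ≤ G k' → 0 < G k := by
    intro k k' h1 h2 h3 h4
    obtain ⟨y0, y1⟩ := half_phase_mem h1 (h2.trans h3)
    obtain ⟨z0, z1⟩ := half_phase_mem (h1.trans h2) h3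
    simp only [hG] at h4 ⊢
    set y := (k - n) * (Real.pi / 2) with hy
    set z := (k' - n) * (Real.pi / 2) with hz
    have hyz : y < z := by rw [hy, hz]; gcongr
    have hsy := Real.sin_pos_of_pos_of_lt_pi y0 (by linarith)
    have hsz := Real.sin_pos_of_pos_of_lt_pi z0 (by linarith)
    have hcz := Real.cos_pos_of_mem_Ioo ⟨by linarith, z1⟩
    set t := z - y with ht
    have ht0 : 0 < t := by linarith
    have ht1 : t < Real.pi / 2 := by linarith
    have hct := Real.cos_pos_of_mem_Ioo ⟨by linarith, ht1⟩
    have htan : t * Real.cos t < Real.sin t := by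
      have := Real.lt_tan ht0 ht1
      rw [Real.tan_eq_sin_div_cos, lt_div_iff₀ hct] at this
      exact this
    have hcc : Real.cos z < Real.cos t :=
      Real.strictAntiOn_cos ⟨ht0.le, by linarith⟩ ⟨z0.le, by linarith⟩ (by linarith)
    have hsin : Real.sin t = Real.sin z * Real.cos y - Real.cos z * Real.sin y := Real.sin_sub z y
    have hkt : (k' - k) * (Real.pi / 2) = t := by rw [ht, hy, hz]; ring
    have hkpi : y ≤ k * (Real.pi / 2) := by rw [hy]; gcongr; linarith
    have hsyy : Real.sin y ≤ y := Real.sin_le y0.le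
    have hprod : t * Real.cos z * Real.sin y < k * (Real.pi / 2) * Real.sin t := by
      have e1 : t * Real.cos z ≤ Real.sin t := by nlinarith
      have e2 : t * Real.cos z < Real.sin t := by nlinarith
      have e3 : 0 < Real.sin t := by nlinarith
      calc t * Real.cos z * Real.sin y < Real.sin t * Real.sin y := by gcongr
        _ ≤ Real.sin t * (k * (Real.pi / 2)) := by gcongr; linarith
        _ = _ := by ring
    have hkey : k' * Real.cos z * Real.sin y < k * Real.cos y * Real.sin z := by
      have e4 : (k * Real.cos y * Real.sin z - k' * Real.cos z * Real.sin y) * (Real.pi / 2) =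
          k * (Real.pi / 2) * Real.sin t - t * Real.cos z * Real.sin y := by
        rw [hsin, ← hkt]; ring
      have e5 : 0 < (k * Real.cos y * Real.sin z - k' * Real.cos z * Real.sin y) * (Real.pi / 2) := by
        rw [e4]; linarith
      have := pos_of_mul_pos_left e5 (by positivity)
      linarith
    have h5 : 0 ≤ (k' * Real.cos z + β / 2 * Real.sin z) * Real.sin y := mul_nonneg h4 hsy.le
    have h6 : 0 < (k * Real.cos y + β / 2 * Real.sin y) * Real.sin z := by nlinarith
    exact pos_of_mul_pos_left h6 hsz.le
  have h0 : 0 < G n := by simp [hG]; linarith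
  have h1 : G (n + 1) < 0 := by
    simp only [hG, add_sub_cancel_left, one_mul, Real.sin_pi_div_two, Real.cos_pi_div_two]
    linarith
  obtain ⟨b, hb, hb0⟩ := intermediate_value_Icc' (by linarith : (n : ℝ) ≤ n + 1) hcont.continuousOn
    (⟨h1.le, h0.le⟩ : (0 : ℝ) ∈ Set.Icc (G (n + 1)) (G n))
  have hbn : (n : ℝ) < b := lt_of_le_of_ne hb.1 (by rintro rfl; linarith)
  have hbn1 : b < n + 1 := lt_of_le_of_ne hb.2 (by intro h; rw [h] at hb0; linarith)
  refine ⟨b ^ 2, by gcongr, by gcongr; linarith, fun E hE1 hE2 => ?_⟩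
  have hE0 : 0 ≤ E := (sq_nonneg _).trans hE1
  obtain ⟨k, hk0, rfl⟩ : ∃ k, 0 ≤ k ∧ E = k ^ 2 := ⟨√E, Real.sqrt_nonneg _, (Real.sq_sqrt hE0).symm⟩
  have hk1 : (n : ℝ) ≤ k := le_of_sq_le_sq hE1 hk0
  have hk2 : k < n + 1 := lt_of_pow_lt_pow_left₀ 2 (by linarith) hE2
  rw [pow_le_pow_iff_left₀ hk0 (by linarith) two_ne_zero]
  rcases hk1.eq_or_lt with h | h
  · rw [← h]
    exact iff_of_true (nat_sq_mem_bandSet β hn) hbn.le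
  · rw [sq_mem_bandSet_iff_of_neg hβ h hk2]
    constructor
    · intro h2
      by_contra h3
      have := hanti b k hbn (not_le.1 h3) hk2 h2
      linarith
    · intro h2
      rcases h2.eq_or_lt with rfl | h2
      · exact hb0.ge
      · exact (hanti k b h h2 hbn1 hb0.ge).le

end

noncomputable section

/-! ### Low energies -/

lemma continuous_energyRoot : Continuous energyRoot := by
  -- The real square root is zero on negative numbers, so at every energy at least one summand
  -- vanishes.
  have : energyRoot = fun E : ℝ => ((√E : ℝ) : ℂ) + Complex.I * (√(-E) : ℝ) := by
    ext E
    unfold energyRoot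
    split_ifs with h
    · rw [Real.sqrt_eq_zero_of_nonpos (by linarith : -E ≤ 0)]; simp
    · rw [Real.sqrt_eq_zero_of_nonpos (by linarith : E ≤ 0)]; simp
  rw [this]
  fun_prop

/-- The real solution of `-u'' = E u` with `u 0 = 1`, `u' 0 = 0`. -/
def cosE (E x : ℝ) : ℝ := (cosK (energyRoot E) x).re

/-- The real solution of `-u'' = E u` with `u 0 = 0`, `u' 0 = 1`. -/
def sinE (E x : ℝ) : ℝ := (sinK (energyRoot E) x).re

lemma conj_energyRoot (E : ℝ) : starRingEnd ℂ (energyRoot E) = energyRoot E ∨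
    starRingEnd ℂ (energyRoot E) = -energyRoot E := by
  rw [← sq_eq_sq_iff_eq_or_eq_neg, ← map_pow, energyRoot_sq, Complex.conj_ofReal]

lemma ofReal_cosE (E x : ℝ) : (cosE E x : ℂ) = cosK (energyRoot E) x := by
  refine Complex.conj_eq_iff_re.1 ?_
  rw [conj_cosK]
  rcases conj_energyRoot E with h | h <;> rw [h]
  exact cosK_neg _ _

lemma ofReal_sinE (E x : ℝ) : (sinE E x : ℂ) = sinK (energyRoot E) x := by
  refine Complex.conj_eq_iff_re.1 ?_
  rw [conj_sinK]
  rcases conj_energyRoot E with h | h <;> rw [h]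
  exact sinK_neg _ _

lemma hasDerivAt_sinE (E x : ℝ) : HasDerivAt (sinE E) (cosE E x) x :=
  Complex.reCLM.hasFDerivAt.comp_hasDerivAt x (hasDerivAt_sinK (energyRoot E) x)

lemma hasDerivAt_cosE (E x : ℝ) : HasDerivAt (cosE E) (-(E * sinE E x)) x := by
  have h := Complex.reCLM.hasFDerivAt.comp_hasDerivAt x (hasDerivAt_cosK (energyRoot E) x)
  rw [energyRoot_sq, ← ofReal_sinE] at h
  refine h.congr_deriv ?_
  simp

lemma sinE_zero_right (E : ℝ) : sinE E 0 = 0 := by simp [sinE, sinK_zero_right]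

lemma continuous_cosE_left (x : ℝ) : Continuous fun E => cosE E x := by
  have h : Continuous fun k => cosK k x := by unfold cosK; fun_prop
  exact Complex.continuous_re.comp (h.comp continuous_energyRoot)

lemma continuous_sinE_left (x : ℝ) : Continuous fun E => sinE E x :=
  Complex.continuous_re.comp ((continuous_sinK_left x).comp continuous_energyRoot)

lemma energyDiscr_eq (β E : ℝ) :
    energyDiscr β E = cosE E Real.pi + β / 2 * sinE E Real.pi := by
  apply Complex.ofReal_injective
  rw [← discr_eq_energyDiscr β (energyRoot_sq E), discr, ← ofReal_cosE, ← ofReal_sinE]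
  push_cast
  rfl

lemma cosE_sq_add (E x : ℝ) : cosE E x ^ 2 + E * sinE E x ^ 2 = 1 := by
  have h := cosK_sq_add (energyRoot E) x
  rw [energyRoot_sq, ← ofReal_sinE, ← ofReal_cosE] at h
  exact_mod_cast h

lemma cosE_pi (E : ℝ) : cosE E Real.pi = 2 * cosE E (Real.pi / 2) ^ 2 - 1 := by
  apply Complex.ofReal_injective
  push_cast
  rw [ofReal_cosE, ofReal_cosE, cosK, cosK, ← Complex.cos_two_mul]
  congr 1
  push_cast
  ring

lemma sinK_two_mul (k : ℂ) (x : ℝ) : sinK k (2 * x) = 2 * sinK k x * cosK k x := by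
  rcases eq_or_ne k 0 with rfl | hk
  · simp [sinK_zero_left, cosK]
  · rw [sinK_eq_div hk, sinK_eq_div hk, cosK,
      show k * ((2 * x : ℝ) : ℂ) = 2 * (k * x) by push_cast; ring, Complex.sin_two_mul]
    ring

lemma sinE_pi (E : ℝ) : sinE E Real.pi = 2 * sinE E (Real.pi / 2) * cosE E (Real.pi / 2) := by
  have h := sinK_two_mul (energyRoot E) (Real.pi / 2)
  rw [mul_div_cancel₀ Real.pi two_ne_zero, ← ofReal_sinE, ← ofReal_sinE, ← ofReal_cosE] at h
  exact_mod_cast h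

lemma cosE_neg_sq {κ : ℝ} (hκ : 0 < κ) (x : ℝ) : cosE (-κ ^ 2) x = Real.cosh (κ * x) := by
  have h : energyRoot (-κ ^ 2) = Complex.I * κ := by
    rw [energyRoot, if_neg (by nlinarith), neg_neg, Real.sqrt_sq hκ.le]
  apply Complex.ofReal_injective
  rw [ofReal_cosE, h, cosK, show Complex.I * κ * x = ((κ * x : ℝ) : ℂ) * Complex.I by
    push_cast; ring, Complex.cos_mul_I, Complex.ofReal_cosh]

lemma sinE_neg_sq {κ : ℝ} (hκ : 0 < κ) (x : ℝ) : sinE (-κ ^ 2) x = Real.sinh (κ * x) / κ := by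
  have h : energyRoot (-κ ^ 2) = Complex.I * κ := by
    rw [energyRoot, if_neg (by nlinarith), neg_neg, Real.sqrt_sq hκ.le]
  have hκ' : (κ : ℂ) ≠ 0 := by exact_mod_cast hκ.ne'
  apply Complex.ofReal_injective
  rw [ofReal_sinE, h, sinK_eq_div (mul_ne_zero Complex.I_ne_zero hκ'),
    show Complex.I * κ * x = ((κ * x : ℝ) : ℂ) * Complex.I by push_cast; ring,
    Complex.sin_mul_I]
  push_cast
  field_simp

lemma cosE_sq {k : ℝ} (hk : 0 ≤ k) (x : ℝ) : cosE (k ^ 2) x = Real.cos (k * x) := by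
  have h : energyRoot (k ^ 2) = k := by
    rw [energyRoot, if_pos (sq_nonneg k), Real.sqrt_sq hk]
  apply Complex.ofReal_injective
  rw [ofReal_cosE, h, cosK]
  push_cast
  rfl

lemma sinE_zero_left (x : ℝ) : sinE 0 x = x := by
  simp [sinE, energyRoot, sinK_zero_left]

lemma cosE_zero_left (x : ℝ) : cosE 0 x = 1 := by
  simp [cosE, energyRoot, cosK]

lemma cosE_pos {E x : ℝ} (hE : E < 1) (hx : x ∈ Set.Icc 0 (Real.pi / 2)) : 0 < cosE E x := by
  rcases lt_or_ge E 0 with h | h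
  · have e : E = -√(-E) ^ 2 := by rw [Real.sq_sqrt (by linarith), neg_neg]
    rw [e, cosE_neg_sq (Real.sqrt_pos.2 (by linarith))]
    exact Real.cosh_pos _
  · have e : E = √E ^ 2 := (Real.sq_sqrt h).symm
    rw [e, cosE_sq (Real.sqrt_nonneg _)]
    have h1 : √E < 1 := by rw [Real.sqrt_lt' one_pos]; linarith
    have h0 := Real.sqrt_nonneg E
    have hpi := Real.pi_pos
    refine Real.cos_pos_of_mem_Ioo ⟨?_, ?_⟩
    · have := mul_nonneg h0 hx.1
      linarith
    · calc √E * x ≤ √E * (Real.pi / 2) := by gcongr; exact hx.2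
        _ < 1 * (Real.pi / 2) := by gcongr
        _ = _ := one_mul _

lemma sinE_pos {E x : ℝ} (hE : E < 1) (h0 : 0 < x) (h1 : x ≤ Real.pi / 2) : 0 < sinE E x := by
  have hm : StrictMonoOn (sinE E) (Set.Icc 0 (Real.pi / 2)) := by
    refine strictMonoOn_of_deriv_pos (convex_Icc _ _)
      (fun y _ => (hasDerivAt_sinE E y).continuousAt.continuousWithinAt) fun y hy => ?_
    rw [interior_Icc] at hy
    rw [(hasDerivAt_sinE E y).deriv]
    exact cosE_pos hE (Set.Ioo_subset_Icc_self hy)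
  have := hm ⟨le_rfl, by linarith⟩ ⟨h0.le, h1⟩ h0
  rwa [sinE_zero_right] at this

/-- Sturm comparison: the Wronskian-type expression has derivative `(E' - E) sinE E x sinE E' x > 0`
and vanishes at `x = 0`. In other words, `cosE / sinE` at `π/2` decreases with the energy. -/
lemma sturm_cos_div_sin {E E' : ℝ} (h : E < E') (h1 : E' < 1) :
    cosE E' (Real.pi / 2) * sinE E (Real.pi / 2) < cosE E (Real.pi / 2) * sinE E' (Real.pi / 2) := by
  have hpi := Real.pi_pos
  have hd : ∀ x, HasDerivAt (fun x => cosE E x * sinE E' x - cosE E' x * sinE E x)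
      ((E' - E) * (sinE E x * sinE E' x)) x := by
    intro x
    refine (((hasDerivAt_cosE E x).mul (hasDerivAt_sinE E' x)).sub
      ((hasDerivAt_cosE E' x).mul (hasDerivAt_sinE E x))).congr_deriv ?_
    ring
  have hm : StrictMonoOn (fun x => cosE E x * sinE E' x - cosE E' x * sinE E x)
      (Set.Icc 0 (Real.pi / 2)) := by
    refine strictMonoOn_of_deriv_pos (convex_Icc _ _)
      (fun y _ => (hd y).continuousAt.continuousWithinAt) fun y hy => ?_
    rw [interior_Icc] at hy
    rw [(hd y).deriv]
    exact mul_pos (by linarith) (mul_pos (sinE_pos (h.trans h1) hy.1 hy.2.le)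
      (sinE_pos h1 hy.1 hy.2.le))
  have := hm ⟨le_rfl, by linarith⟩ ⟨by linarith, le_rfl⟩ (by linarith : (0 : ℝ) < Real.pi / 2)
  simp only [sinE_zero_right, mul_zero, sub_zero] at this
  linarith

/-- The companion comparison, with derivative `(E' - E) cosE E x cosE E' x > 0`: `E sinE / cosE` at
`π/2` increases with the energy. -/
lemma sturm_sin_div_cos {E E' : ℝ} (h : E < E') (h1 : E' < 1) :
    E * sinE E (Real.pi / 2) * cosE E' (Real.pi / 2) <
      E' * sinE E' (Real.pi / 2) * cosE E (Real.pi / 2) := by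
  have hpi := Real.pi_pos
  have hd : ∀ x, HasDerivAt (fun x => E' * sinE E' x * cosE E x - E * sinE E x * cosE E' x)
      ((E' - E) * (cosE E x * cosE E' x)) x := by
    intro x
    refine ((((hasDerivAt_sinE E' x).const_mul E').mul (hasDerivAt_cosE E x)).sub
      (((hasDerivAt_sinE E x).const_mul E).mul (hasDerivAt_cosE E' x))).congr_deriv ?_
    ring
  have hm : StrictMonoOn (fun x => E' * sinE E' x * cosE E x - E * sinE E x * cosE E' x)
      (Set.Icc 0 (Real.pi / 2)) := by
    refine strictMonoOn_of_deriv_pos (convex_Icc _ _)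
      (fun y _ => (hd y).continuousAt.continuousWithinAt) fun y hy => ?_
    rw [interior_Icc] at hy
    rw [(hd y).deriv]
    exact mul_pos (by linarith) (mul_pos (cosE_pos (h.trans h1) (Set.Ioo_subset_Icc_self hy))
      (cosE_pos h1 (Set.Ioo_subset_Icc_self hy)))
  have := hm ⟨le_rfl, by linarith⟩ ⟨by linarith, le_rfl⟩ (by linarith : (0 : ℝ) < Real.pi / 2)
  simp only [sinE_zero_right, mul_zero, zero_mul, sub_zero] at this
  linarith

/-- Repulsive coupling: there is no spectrum on the negative half-line. -/
lemma notMem_bandSet_of_nonpos {β E : ℝ} (hβ : 0 < β) (hE : E ≤ 0) : E ∉ bandSet β := by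
  have hpi := Real.pi_pos
  rw [bandSet, Set.mem_ofPred_eq, energyDiscr_eq, not_le]
  refine lt_of_lt_of_le ?_ (le_abs_self _)
  rcases hE.eq_or_lt with rfl | h
  · rw [sinE_zero_left, cosE_zero_left]
    have : 0 < β / 2 * Real.pi := by positivity
    linarith
  · have e : E = -√(-E) ^ 2 := by rw [Real.sq_sqrt (by linarith), neg_neg]
    have h0 : 0 < √(-E) := Real.sqrt_pos.2 (by linarith)
    rw [e, cosE_neg_sq h0, sinE_neg_sq h0]
    have h1 := Real.one_le_cosh (√(-E) * Real.pi)
    have h2 : 0 < Real.sinh (√(-E) * Real.pi) := Real.sinh_pos_iff.2 (by positivity)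
    have : 0 < β / 2 * (Real.sinh (√(-E) * Real.pi) / √(-E)) := by positivity
    linarith

/-- Attractive coupling: the part of the band set below the first eigenvalue. -/
theorem exists_lowest_band {β : ℝ} (hβ : β < 0) : ∃ a b : ℝ, a < b ∧ a < 0 ∧ b < 1 ∧
    (∀ E, E < 1 → (E ∈ bandSet β ↔ E ∈ Set.Icc a b)) ∧
    (∀ E, E < 1 → (|energyDiscr β E| = 1 ↔ E = a ∨ E = b)) ∧
    (-4 / Real.pi < β → 0 < b) ∧ (β = -4 / Real.pi → b = 0) ∧ (β < -4 / Real.pi → b < 0) := by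
  have hpi := Real.pi_pos
  set g := -β / 2 with hg
  have hg0 : 0 < g := by rw [hg]; linarith
  set σ : ℝ → ℝ := fun E => sinE E (Real.pi / 2) with hσ
  set χ : ℝ → ℝ := fun E => cosE E (Real.pi / 2) with hχ
  have hσ0 : ∀ E, E < 1 → 0 < σ E := fun E hE => sinE_pos hE (by linarith) le_rfl
  have hχ0 : ∀ E, E < 1 → 0 < χ E := fun E hE => cosE_pos hE ⟨by linarith, le_rfl⟩
  -- The half-angle factorization at `π/2` reads `1 + F = 2 χ p` and `1 - F = 2 σ q` for the
  -- discriminant `F`. Below energy `1` both `χ` and `σ` are positive, so the band is given by `p ≥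
  -- 0` and `q ≥ 0`. The zero of `q` is the lower edge `a` and the zero of `p` the upper edge `b`.
  set p : ℝ → ℝ := fun E => χ E - g * σ E with hp
  set q : ℝ → ℝ := fun E => E * σ E + g * χ E with hq
  have hpc : Continuous p := by
    have h1 := continuous_cosE_left (Real.pi / 2)
    have h2 := continuous_sinE_left (Real.pi / 2)
    simp only [hp, hχ, hσ]
    fun_prop
  have hqc : Continuous q := by
    have h1 := continuous_cosE_left (Real.pi / 2)
    have h2 := continuous_sinE_left (Real.pi / 2)
    simp only [hq, hχ, hσ]
    fun_prop
  have hFp : ∀ E, 1 + energyDiscr β E = 2 * χ E * p E := by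
    intro E
    rw [energyDiscr_eq, cosE_pi, sinE_pi]
    simp only [hp, hg, hχ, hσ]
    ring
  have hFq : ∀ E, 1 - energyDiscr β E = 2 * σ E * q E := by
    intro E
    rw [energyDiscr_eq, cosE_pi, sinE_pi]
    have := cosE_sq_add E (Real.pi / 2)
    simp only [hq, hg, hχ, hσ]
    linear_combination -2 * this
  have hmem : ∀ E, E < 1 → (E ∈ bandSet β ↔ 0 ≤ p E ∧ 0 ≤ q E) := by
    intro E hE
    have h1 := hχ0 E hE
    have h2 := hσ0 E hE
    rw [bandSet, Set.mem_ofPred_eq, abs_le, ← mul_nonneg_iff_of_pos_left (b := p E)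
      (by positivity : 0 < 2 * χ E), ← mul_nonneg_iff_of_pos_left (b := q E)
      (by positivity : 0 < 2 * σ E), ← hFp, ← hFq]
    constructor <;> rintro ⟨h3, h4⟩ <;> constructor <;> linarith
  have hpd : ∀ E E', E < E' → E' < 1 → 0 ≤ p E' → 0 < p E := by
    intro E E' h h1 h2
    have h3 : χ E' * σ E < χ E * σ E' := sturm_cos_div_sin h h1
    have h4 := hσ0 E (h.trans h1)
    have h5 := hσ0 E' h1
    simp only [hp] at h2 ⊢
    have h6 : 0 < (χ E - g * σ E) * σ E' := by nlinarith
    exact pos_of_mul_pos_left h6 h5.le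
  have hqu : ∀ E E', E < E' → E' < 1 → 0 ≤ q E → 0 < q E' := by
    intro E E' h h1 h2
    have h3 : E * σ E * χ E' < E' * σ E' * χ E := sturm_sin_div_cos h h1
    have h4 := hχ0 E (h.trans h1)
    have h5 := hχ0 E' h1
    simp only [hq] at h2 ⊢
    have h6 : 0 < (E' * σ E' + g * χ E') * χ E := by nlinarith
    exact pos_of_mul_pos_left h6 h4.le
  have hp1 : p 1 < 0 := by
    have e1 : χ 1 = 0 := by
      simp only [hχ]
      have := cosE_sq zero_le_one (Real.pi / 2)
      rw [one_pow, one_mul, Real.cos_pi_div_two] at this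
      exact this
    have e2 : 0 < σ 1 := by
      have e3 : 0 ≤ σ 1 := by
        refine ge_of_tendsto (x := nhdsWithin (1 : ℝ) (Set.Iio 1))
          ((continuous_sinE_left (Real.pi / 2)).continuousAt.continuousWithinAt) ?_
        filter_upwards [self_mem_nhdsWithin] with E hE using (hσ0 E hE).le
      refine lt_of_le_of_ne e3 fun h => ?_
      have := cosE_sq_add 1 (Real.pi / 2)
      simp only [hχ, hσ] at e1 h
      rw [e1, ← h] at this
      norm_num at this
    simp only [hp, e1]
    have := mul_pos hg0 e2
    linarith
  -- At the energy `-κ²` one has `g / κ < 1`, which makes `p` positive, while `κ sinh y` dominates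
  -- `g cosh y` and makes `q` negative.
  set κ := 2 * g + 1 with hκ
  have hκ0 : 0 < κ := by linarith
  set y := κ * (Real.pi / 2) with hy
  have hy1 : 1 < y := by
    have := Real.pi_gt_three
    nlinarith
  have hsinh : y ≤ Real.sinh y := Real.self_le_sinh_iff.2 (by linarith)
  have hlow : -κ ^ 2 < 0 := by nlinarith
  have hplow : 0 < p (-κ ^ 2) := by
    simp only [hp, hχ, hσ]
    rw [cosE_neg_sq hκ0, sinE_neg_sq hκ0, ← hy]
    have h1 := Real.sinh_lt_cosh y
    have h2 : g * (Real.sinh y / κ) ≤ Real.sinh y := by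
      rw [mul_div_assoc', div_le_iff₀ hκ0]
      nlinarith
    linarith
  have hqlow : q (-κ ^ 2) < 0 := by
    simp only [hq, hχ, hσ]
    rw [cosE_neg_sq hκ0, sinE_neg_sq hκ0, ← hy]
    have h1 : Real.cosh y = Real.sinh y + Real.exp (-y) := by
      rw [Real.cosh_eq, Real.sinh_eq]; ring
    have h2 : Real.exp (-y) ≤ 1 := Real.exp_le_one_iff.2 (by linarith)
    have h3 : -κ ^ 2 * (Real.sinh y / κ) = -(κ * Real.sinh y) := by field_simp
    rw [h1, h3, hκ]
    nlinarith
  -- The sign of `p 0` decides the sign of `b`. The threshold `g = 2/π` is `β = -4/π`, that is, `α =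
  -- -8/π`.
  have hp0 : p 0 = 1 - g * (Real.pi / 2) := by
    simp only [hp, hχ, hσ, sinE_zero_left, cosE_zero_left]
  have hq0 : 0 < q 0 := by
    simp only [hq, hχ, cosE_zero_left]
    linarith
  obtain ⟨a, ha, ha0⟩ := intermediate_value_Icc hlow.le hqc.continuousOn
    (⟨hqlow.le, hq0.le⟩ : (0 : ℝ) ∈ Set.Icc (q (-κ ^ 2)) (q 0))
  have ha1 : a < 0 := lt_of_le_of_ne ha.2 (by rintro rfl; linarith)
  obtain ⟨b, hb, hb0⟩ := intermediate_value_Icc' (by linarith : -κ ^ 2 ≤ 1) hpc.continuousOn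
    (⟨hp1.le, hplow.le⟩ : (0 : ℝ) ∈ Set.Icc (p 1) (p (-κ ^ 2)))
  have hb1 : b < 1 := lt_of_le_of_ne hb.2 (by rintro rfl; linarith)
  have hple : ∀ E, E < 1 → (0 ≤ p E ↔ E ≤ b) := by
    intro E hE
    constructor
    · intro h
      by_contra h1
      linarith [hpd b E (not_le.1 h1) hE h]
    · intro h
      rcases h.eq_or_lt with rfl | h
      · exact hb0.ge
      · exact (hpd E b h hb1 hb0.ge).le
  have hqle : ∀ E, E < 1 → (0 ≤ q E ↔ a ≤ E) := by
    intro E hE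
    constructor
    · intro h
      by_contra h1
      linarith [hqu E a (not_le.1 h1) (by linarith) h]
    · intro h
      rcases h.eq_or_lt with rfl | h
      · exact ha0.ge
      · exact (hqu a E h hE ha0.ge).le
  -- At the zero `a` of `q` the relation `a σ = -g χ` turns `χ p` into `χ² + a σ² = 1`. Hence `p` is
  -- still positive there and `a < b`.
  have hpa : 0 < p a := by
    have h1 := cosE_sq_add a (Real.pi / 2)
    have h2 : χ a * p a = 1 := by
      simp only [hq] at ha0
      simp only [hp]
      have h3 : χ a ^ 2 + a * σ a ^ 2 = 1 := h1
      linear_combination h3 - σ a * ha0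
    exact pos_of_mul_pos_right (by rw [h2]; exact one_pos) (hχ0 a (by linarith)).le
  have hab : a < b := by
    refine lt_of_le_of_ne ((hple a (by linarith)).1 hpa.le) ?_
    rintro rfl
    linarith
  refine ⟨a, b, hab, ha1, hb1, fun E hE => ?_, fun E hE => ?_, fun h => ?_, fun h => ?_, fun h => ?_⟩
  · rw [hmem E hE, hple E hE, hqle E hE, and_comm]
    rfl
  · have h1 := hχ0 E hE
    have h2 := hσ0 E hE
    have hFp' := hFp E
    have hFq' := hFq E
    constructor
    · intro h
      rcases (abs_eq zero_le_one).1 h with h3 | h3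
      · left
        have h4 : q E = 0 := by
          rw [h3, sub_self, eq_comm, mul_eq_zero] at hFq'
          exact hFq'.resolve_left (by positivity)
        by_contra h5
        rcases lt_or_gt_of_ne h5 with h6 | h6
        · exact absurd ((hqle E hE).1 h4.ge) (not_le.2 h6)
        · linarith [hqu a E h6 hE ha0.ge]
      · right
        have h4 : p E = 0 := by
          rw [h3, add_neg_cancel, eq_comm, mul_eq_zero] at hFp'
          exact hFp'.resolve_left (by positivity)
        by_contra h5
        rcases lt_or_gt_of_ne h5 with h6 | h6
        · linarith [hpd E b h6 hb1 hb0.ge]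
        · exact absurd ((hple E hE).1 h4.ge) (not_le.2 h6)
    · rintro (rfl | rfl)
      · rw [ha0, mul_zero] at hFq'
        rw [show energyDiscr β E = 1 by linarith, abs_one]
      · rw [hb0, mul_zero] at hFp'
        rw [show energyDiscr β E = -1 by linarith, abs_neg, abs_one]
  · rw [div_lt_iff₀ hpi] at h
    have h1 : 0 < p 0 := by rw [hp0, hg]; linarith
    refine lt_of_le_of_ne ((hple 0 one_pos).1 h1.le) ?_
    rintro rfl
    linarith
  · rw [eq_div_iff hpi.ne'] at h
    have h1 : p 0 = 0 := by rw [hp0, hg]; linarith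
    refine le_antisymm ?_ ((hple 0 one_pos).1 h1.ge)
    by_contra h2
    linarith [hpd 0 b (not_le.1 h2) hb1 hb0.ge]
  · rw [lt_div_iff₀ hpi] at h
    have h1 : p 0 < 0 := by rw [hp0, hg]; linarith
    by_contra h2
    exact absurd ((hple 0 one_pos).2 (not_lt.1 h2)) (not_le.2 h1)

end

noncomputable section

/-! ### Spectral bands -/

/-- For integer `A` one has `|cos Aπ| = 1`, so the modulus of `ξ` is that of the discriminant with
`β = α/2`. -/
lemma norm_xi (A : ℤ) (α : ℝ) (k : ℂ) : ‖xi A α k‖ = ‖discr (α / 2) k‖ := by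
  have hc : ‖Complex.cos (((A : ℝ) : ℂ) * Real.pi)‖ = 1 := by
    have h := Complex.sin_sq_add_cos_sq (((A : ℝ) : ℂ) * Real.pi)
    have hs : Complex.sin (((A : ℝ) : ℂ) * Real.pi) = 0 := by
      rw [Complex.ofReal_intCast]
      exact Complex.sin_int_mul_pi A
    rw [hs, zero_pow two_ne_zero, zero_add] at h
    refine (pow_eq_one_iff_of_nonneg (norm_nonneg _) two_ne_zero).1 ?_
    rw [← norm_pow, h, norm_one]
  unfold xi
  split_ifs with hk
  · rw [norm_div, hc, div_one, hk, discr, sinK_zero_left, cosK]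
    congr 1
    push_cast
    simp
    ring
  · rw [norm_div, hc, div_one, discr, sinK_eq_div hk, cosK]
    congr 1
    push_cast
    field_simp
    ring

lemma mem_bandEdgeSet_iff {A : ℤ} {α E : ℝ} :
    E ∈ bandEdgeSet A α ↔ |energyDiscr (α / 2) E| = 1 := by
  constructor
  · rintro ⟨k, hk, h⟩
    rwa [norm_xi, discr_eq_energyDiscr _ hk, Complex.norm_real, Real.norm_eq_abs] at h
  · intro h
    refine ⟨energyRoot E, energyRoot_sq E, ?_⟩
    rwa [norm_xi, discr_eq_energyDiscr _ (energyRoot_sq E), Complex.norm_real, Real.norm_eq_abs]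

/-- Repulsive coupling: the band in `(n², (n+1)²]`. -/
lemma exists_component_of_pos {β : ℝ} (hβ : 0 < β) (n : ℕ) : ∃ a : ℝ, (n : ℝ) ^ 2 < a ∧
    a < ((n : ℝ) + 1) ^ 2 ∧ ((n : ℝ) + 1) ^ 2 ∈ bandSet β ∧
    ∀ x ∈ bandSet β, x ∈ Set.Ioc ((n : ℝ) ^ 2) (((n : ℝ) + 1) ^ 2) →
      connectedComponentIn (bandSet β) x = Set.Icc a (((n : ℝ) + 1) ^ 2) := by
  obtain ⟨a, h1, h2, h3⟩ := exists_band_of_pos hβ n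
  -- The next band starts strictly above `(n + 1)²`, which provides the gap to the right of this
  -- one.
  obtain ⟨a', h1', h2', h3'⟩ := exists_band_of_pos hβ (n + 1)
  push_cast at h1' h2' h3'
  refine ⟨a, h1, h2, (h3 _ (h1.trans h2) le_rfl).2 h2.le, fun x hx hxI => ?_⟩
  refine connectedComponentIn_eq_Icc ⟨(h3 x hxI.1 hxI.2).1 hx, hxI.2⟩
    (fun E hE => (h3 E (h1.trans_le hE.1) hE.2).2 hE.1) (fun y hy => ?_) fun y hy => ?_
  · obtain ⟨z, hz1, hz2⟩ := exists_between (max_lt hy h1)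
    refine ⟨z, ⟨(le_max_left _ _).trans hz1.le, hz2⟩, fun hz => ?_⟩
    exact absurd ((h3 z ((le_max_right _ _).trans_lt hz1) (hz2.le.trans h2.le)).1 hz) (not_le.2 hz2)
  · obtain ⟨z, hz1, hz2⟩ := exists_between (lt_min hy h1')
    refine ⟨z, ⟨hz1, hz2.le.trans (min_le_left _ _)⟩, fun hz => ?_⟩
    have hz3 := hz2.trans_le (min_le_right _ _)
    exact absurd ((h3' z hz1 (hz3.le.trans h2'.le)).1 hz) (not_le.2 hz3)

/-- Attractive coupling: the band in `[n², (n+1)²)`. -/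
lemma exists_component_of_neg {β : ℝ} (hβ : β < 0) {n : ℕ} (hn : 1 ≤ n) : ∃ b : ℝ,
    (n : ℝ) ^ 2 < b ∧ b < ((n : ℝ) + 1) ^ 2 ∧
    ∀ x ∈ bandSet β, x ∈ Set.Ico ((n : ℝ) ^ 2) (((n : ℝ) + 1) ^ 2) →
      connectedComponentIn (bandSet β) x = Set.Icc ((n : ℝ) ^ 2) b := by
  obtain ⟨b, h1, h2, h3⟩ := exists_band_of_neg hβ hn
  -- The gap to the left of `n²` comes from the previous band; for `n = 1` this is the lowest band,
  -- which ends below `1`.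
  have hgap : ∃ c, c < (n : ℝ) ^ 2 ∧ ∀ E, c < E → E < (n : ℝ) ^ 2 → E ∉ bandSet β := by
    rcases hn.eq_or_lt with rfl | hn'
    · obtain ⟨a, c, -, -, h5, h6, -⟩ := exists_lowest_band hβ
      refine ⟨c, by simpa using h5, fun E hE1 hE2 hE => ?_⟩
      exact absurd ((h6 E (by simpa using hE2)).1 hE).2 (not_le.2 hE1)
    · obtain ⟨m, rfl⟩ : ∃ m, n = m + 1 := ⟨n - 1, by omega⟩
      obtain ⟨c, h4, h5, h6⟩ := exists_band_of_neg hβ (n := m) (by omega)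
      push_cast
      refine ⟨c, h5, fun E hE1 hE2 hE => ?_⟩
      exact absurd ((h6 E (h4.trans hE1).le hE2).1 hE) (not_le.2 hE1)
  obtain ⟨c, hc1, hc2⟩ := hgap
  refine ⟨b, h1, h2, fun x hx hxI => ?_⟩
  refine connectedComponentIn_eq_Icc ⟨hxI.1, (h3 x hxI.1 hxI.2).1 hx⟩
    (fun E hE => (h3 E hE.1 (hE.2.trans_lt h2)).2 hE.2) (fun y hy => ?_) fun y hy => ?_
  · obtain ⟨z, hz1, hz2⟩ := exists_between (max_lt hy hc1)
    exact ⟨z, ⟨(le_max_left _ _).trans hz1.le, hz2⟩, hc2 z ((le_max_right _ _).trans_lt hz1) hz2⟩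
  · obtain ⟨z, hz1, hz2⟩ := exists_between (lt_min hy h2)
    refine ⟨z, ⟨hz1, hz2.le.trans (min_le_left _ _)⟩, fun hz => ?_⟩
    exact absurd ((h3 z (h1.trans hz1).le (hz2.trans_le (min_le_right _ _))).1 hz) (not_le.2 hz1)

lemma exists_nat_sq_lt_le {x : ℝ} (hx : 0 < x) :
    ∃ n : ℕ, x ∈ Set.Ioc ((n : ℝ) ^ 2) (((n : ℝ) + 1) ^ 2) := by
  have hs := Real.sqrt_pos.2 hx
  have hc : 0 < ⌈√x⌉₊ := Nat.ceil_pos.2 hs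
  obtain ⟨n, hn⟩ : ∃ n, ⌈√x⌉₊ = n + 1 := ⟨⌈√x⌉₊ - 1, by omega⟩
  refine ⟨n, ?_, ?_⟩
  · rw [← Real.lt_sqrt (Nat.cast_nonneg n)]
    exact Nat.lt_ceil.1 (by omega)
  · have h := Nat.le_ceil √x
    rw [hn] at h
    push_cast at h
    exact (Real.sqrt_le_left (by positivity)).1 h

lemma exists_nat_sq_le_lt {x : ℝ} (hx : 1 ≤ x) :
    ∃ n : ℕ, 1 ≤ n ∧ x ∈ Set.Ico ((n : ℝ) ^ 2) (((n : ℝ) + 1) ^ 2) := by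
  have hs : 1 ≤ √x := Real.one_le_sqrt.2 hx
  refine ⟨⌊√x⌋₊, Nat.le_floor (by simpa using hs), ?_, ?_⟩
  · exact (Real.le_sqrt' (by exact_mod_cast Nat.floor_pos.2 hs)).1 (Nat.floor_le (by linarith))
  · exact (Real.sqrt_lt' (by positivity)).1 (Nat.lt_floor_add_one _)

end

/-! ### Assembly of the theorem -/

theorem mainTheorem2 (A : ℤ) (α : ℝ) :
    -- the Hamiltonian is self-adjoint
    IsSelfAdjoint (hamiltonian A α) ∧
    -- the eigenvalues are the numbers `k²`, `k = 1, 2, …`, each of infinite multiplicity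
    {z : ℂ | opEigenspace (hamiltonian A α) z ≠ ⊥} = {z | ∃ k : ℕ, 1 ≤ k ∧ z = (k : ℂ) ^ 2} ∧
    (∀ k : ℕ, 1 ≤ k →
      ¬ FiniteDimensional ℂ (opEigenspace (hamiltonian A α) ((k : ℂ) ^ 2))) ∧
    -- the spectrum consists of these eigenvalues and of the absolutely continuous bands,
    -- and the rest of the spectrum is purely absolutely continuous
    opSpectrum (hamiltonian A α) =
      Complex.ofReal ''
        ({e : ℝ | ∃ k : ℕ, 1 ≤ k ∧ e = (k : ℝ) ^ 2} ∪
          ⋃₀ {B : Set ℝ | IsSpectralBand (hamiltonian A α) B}) ∧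
    (ppSubspace (hamiltonian A α) ⊔ acSubspace (hamiltonian A α)).topologicalClosure = ⊤ ∧
    -- repulsive coupling
    (0 < α →
      (∀ B : Set ℝ, IsSpectralBand (hamiltonian A α) B →
        ∃ n : ℕ, B ⊆ Set.Ioc ((n : ℝ) ^ 2) (((n : ℝ) + 1) ^ 2)) ∧
      (∀ n : ℕ, ∃! B : Set ℝ, IsSpectralBand (hamiltonian A α) B ∧
        B ⊆ Set.Ioc ((n : ℝ) ^ 2) (((n : ℝ) + 1) ^ 2)) ∧
      (∀ (B : Set ℝ) (n : ℕ), IsSpectralBand (hamiltonian A α) B →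
        B ⊆ Set.Ioc ((n : ℝ) ^ 2) (((n : ℝ) + 1) ^ 2) →
          ∃ a : ℝ, a < ((n : ℝ) + 1) ^ 2 ∧ B = Set.Icc a (((n : ℝ) + 1) ^ 2))) ∧
    -- attractive coupling
    (α < 0 →
      (∀ n : ℕ, 1 ≤ n →
        (∃! B : Set ℝ, IsSpectralBand (hamiltonian A α) B ∧
          B ⊆ Set.Ico ((n : ℝ) ^ 2) (((n : ℝ) + 1) ^ 2)) ∧
        (∀ B : Set ℝ, IsSpectralBand (hamiltonian A α) B →
          B ⊆ Set.Ico ((n : ℝ) ^ 2) (((n : ℝ) + 1) ^ 2) →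
            ∃ b : ℝ, (n : ℝ) ^ 2 < b ∧ B = Set.Icc ((n : ℝ) ^ 2) b)) ∧
      (∃ a b : ℝ, a < b ∧ IsSpectralBand (hamiltonian A α) (Set.Icc a b) ∧
        -- every other band is one of the above
        (∀ B : Set ℝ, IsSpectralBand (hamiltonian A α) B → B ≠ Set.Icc a b →
          ∃ n : ℕ, 1 ≤ n ∧ B ⊆ Set.Ico ((n : ℝ) ^ 2) (((n : ℝ) + 1) ^ 2)) ∧
        IsLeast (bandEdgeSet A α) a ∧ a < 0 ∧
        IsLeast (bandEdgeSet A α \ {a}) b ∧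
        (-8 / Real.pi < α → b ∈ Set.Ioo (0 : ℝ) 1) ∧
        (α = -8 / Real.pi → b = 0) ∧
        (α < -8 / Real.pi → b < 0))) := by
  have hband : ∀ B : Set ℝ, IsSpectralBand (hamiltonian A α) B ↔
      ∃ x ∈ bandSet (α / 2), B = connectedComponentIn (bandSet (α / 2)) x := by
    intro B
    rw [IsSpectralBand, acSpectrum_hamiltonian]
  refine ⟨?_, eigenvalues_hamiltonian A α, fun k hk => infinite_multiplicity A α hk, ?_,
    ppSubspace_sup_acSubspace A α, fun hα => ?_, fun hα => ?_⟩
  · obtain ⟨c, hc⟩ := exists_surjAt A α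
    exact isSelfAdjoint_of_surjAt (hamiltonian_isFormalAdjoint A α) hc
  · rw [sUnion_spectralBands]
    exact opSpectrum_hamiltonian A α
  · have hβ : 0 < α / 2 := by linarith
    have hcomp : ∀ (B : Set ℝ) (n : ℕ), IsSpectralBand (hamiltonian A α) B →
        B ⊆ Set.Ioc ((n : ℝ) ^ 2) (((n : ℝ) + 1) ^ 2) → ∃ x ∈ bandSet (α / 2),
          x ∈ Set.Ioc ((n : ℝ) ^ 2) (((n : ℝ) + 1) ^ 2) ∧
          B = connectedComponentIn (bandSet (α / 2)) x := by
      intro B n hB hBn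
      obtain ⟨x, hx, rfl⟩ := (hband B).1 hB
      exact ⟨x, hx, hBn (mem_connectedComponentIn hx), rfl⟩
    refine ⟨fun B hB => ?_, fun n => ?_, fun B n hB hBn => ?_⟩
    · obtain ⟨x, hx, rfl⟩ := (hband B).1 hB
      have hx0 : 0 < x := by
        by_contra h
        exact notMem_bandSet_of_nonpos hβ (not_lt.1 h) hx
      obtain ⟨n, hn⟩ := exists_nat_sq_lt_le hx0
      obtain ⟨a, h1, -, -, h3⟩ := exists_component_of_pos hβ n
      refine ⟨n, ?_⟩
      rw [h3 x hx hn]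
      exact fun y hy => ⟨h1.trans_le hy.1, hy.2⟩
    · obtain ⟨a, h1, h2, h4, h3⟩ := exists_component_of_pos hβ n
      refine ⟨Set.Icc a (((n : ℝ) + 1) ^ 2), ⟨(hband _).2 ⟨_, h4, ?_⟩, ?_⟩, ?_⟩
      · exact (h3 _ h4 ⟨h1.trans h2, le_rfl⟩).symm
      · exact fun y hy => ⟨h1.trans_le hy.1, hy.2⟩
      · rintro B ⟨hB, hBn⟩
        obtain ⟨x, hx, hxn, rfl⟩ := hcomp B n hB hBn
        exact h3 x hx hxn
    · obtain ⟨a, h1, h2, -, h3⟩ := exists_component_of_pos hβ n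
      obtain ⟨x, hx, hxn, rfl⟩ := hcomp B n hB hBn
      exact ⟨a, h2, h3 x hx hxn⟩
  · have hβ : α / 2 < 0 := by linarith
    refine ⟨fun n hn => ?_, ?_⟩
    · obtain ⟨b, h1, h2, h3⟩ := exists_component_of_neg hβ hn
      have hcomp : ∀ B : Set ℝ, IsSpectralBand (hamiltonian A α) B →
          B ⊆ Set.Ico ((n : ℝ) ^ 2) (((n : ℝ) + 1) ^ 2) → B = Set.Icc ((n : ℝ) ^ 2) b := by
        intro B hB hBn
        obtain ⟨x, hx, rfl⟩ := (hband B).1 hB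
        exact h3 x hx (hBn (mem_connectedComponentIn hx))
      have hmem := nat_sq_mem_bandSet (α / 2) hn
      refine ⟨⟨Set.Icc ((n : ℝ) ^ 2) b, ⟨(hband _).2 ⟨_, hmem, ?_⟩, ?_⟩, fun B hB => ?_⟩,
        fun B hB hBn => ⟨b, h1, hcomp B hB hBn⟩⟩
      · exact (h3 _ hmem ⟨le_rfl, h1.trans h2⟩).symm
      · exact fun y hy => ⟨hy.1, hy.2.trans_lt h2⟩
      · exact hcomp B hB.1 hB.2
    · obtain ⟨a, b, hab, ha0, hb1, h1, h2, h3, h4, h5⟩ := exists_lowest_band hβ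
      have hcomp : ∀ x ∈ bandSet (α / 2), x < 1 →
          connectedComponentIn (bandSet (α / 2)) x = Set.Icc a b := by
        intro x hx hx1
        refine connectedComponentIn_eq_Icc ((h1 x hx1).1 hx)
          (fun E hE => (h1 E (hE.2.trans_lt hb1)).2 hE) (fun y hy => ?_) fun y hy => ?_
        · refine ⟨y, ⟨le_rfl, hy⟩, fun h => ?_⟩
          exact absurd ((h1 y (by linarith)).1 h).1 (not_le.2 hy)
        · obtain ⟨z, hz1, hz2⟩ := exists_between (lt_min hy hb1)
          refine ⟨z, ⟨hz1, hz2.le.trans (min_le_left _ _)⟩, fun h => ?_⟩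
          exact absurd ((h1 z (hz2.trans_le (min_le_right _ _))).1 h).2 (not_le.2 hz1)
      have ha1 : a < 1 := hab.trans hb1
      have haS := (h1 a ha1).2 ⟨le_rfl, hab.le⟩
      refine ⟨a, b, hab, (hband _).2 ⟨a, haS, (hcomp a haS ha1).symm⟩, fun B hB hne => ?_,
        ⟨mem_bandEdgeSet_iff.2 ((h2 a ha1).2 (Or.inl rfl)), fun E hE => ?_⟩, ha0,
        ⟨⟨mem_bandEdgeSet_iff.2 ((h2 b hb1).2 (Or.inr rfl)), hab.ne'⟩, fun E hE => ?_⟩,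
        fun h => ⟨h3 ?_, hb1⟩, fun h => h4 ?_, fun h => h5 ?_⟩
      · obtain ⟨x, hx, rfl⟩ := (hband B).1 hB
        have hx1 : 1 ≤ x := by
          by_contra h
          exact hne (hcomp x hx (not_le.1 h))
        obtain ⟨n, hn, hxn⟩ := exists_nat_sq_le_lt hx1
        obtain ⟨c, -, h7, h8⟩ := exists_component_of_neg hβ hn
        refine ⟨n, hn, ?_⟩
        rw [h8 x hx hxn]
        exact fun y hy => ⟨hy.1, hy.2.trans_lt h7⟩
      -- Elements of the edge set that are at least `1` do not matter, since `a` and `b` lie below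
      -- `1`, where they are the only elements.
      · rcases lt_or_ge E 1 with h | h
        · rcases (h2 E h).1 (mem_bandEdgeSet_iff.1 hE) with rfl | rfl
          · exact le_rfl
          · exact hab.le
        · linarith
      · rcases lt_or_ge E 1 with h | h
        · rcases (h2 E h).1 (mem_bandEdgeSet_iff.1 hE.1) with rfl | rfl
          · exact absurd rfl hE.2
          · exact le_rfl
        · linarith
      · have e : -4 / Real.pi = -8 / Real.pi / 2 := by ring
        rw [e]; linarith
      · rw [h]; ring
      · have e : -4 / Real.pi = -8 / Real.pi / 2 := by ring
        rw [e]; linarith
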